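/- Let $k$ be an algebraically closed field, $H$ a Hopf algebra over $k$ with coproduct $\Delta(a)=\sum a_1\otimes a_2$ and counit $\epsilon$, and $\pi\colon H\to k$ an algebra homomorphism. Let $\Xi^l_\pi(a)=\sum\pi(a_1)a_2$ and $\Xi^r_\pi(a)=\sum a_1\pi(a_2)$ be the left and right winding automorphisms of $H$, let $G^l_\pi=\langle\Xi^l_\pi\rangle$ and $G^r_\pi=\langle\Xi^r_\pi\rangle$ be the subgroups of $\mathrm{Aut}_{k\text{-alg}}(H)$ that they generate, and let $H_\pi$ be the subalgebra of elements fixed by both groups. Assume: (a) $H$ is an affine (finitely generated as an algebra), noetherian, prime ring satisfying a polynomial identity; (b) the order $n$ of $\pi$ in the group of characters of $H$ (algebra maps $H\to k$ under convolution) is finite and equals the PI-degree of $H$, that is, the least $m$ such that $H$ embeds in $M_m(C)$ for some commutative ring $C$; (c) the invariant subring $H^{G^l_\pi}$ is a (commutative) Dedekind domain; (d) if $p=\operatorname{char}k>0$, then $n$ is coprime to $p$; (e) $\operatorname{GKdim}H=\operatorname{gldim}H=1$; (f) $n>1$ and $|G^l_\pi/(G^l_\pi\cap G^r_\pi)|=1$.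 Then one of the following holds. 1. (Primitive case) $H_\pi$ is a Hopf subalgebra isomorphic to $k[x]$ with $x$ primitive, and there is a primitive $n$th root of unity $\xi\in k$ such that $H$ is isomorphic as a Hopf algebra to the Taft algebra $H(n,0,\xi)$: the algebra generated by $g,x$ with relations $g^n=1$, $xg=\xi gx$, with $g$ group-like and $\Delta(x)=x\otimes1+1\otimes x$. 2. (Group-like case) $H_\pi$ is a Hopf subalgebra isomorphic to $k[x^{\pm1}]$ with $x$ group-like, and $H$ is isomorphic as a Hopf algebra to the group algebra $k\mathbb D$ of the infinite dihedral group $\mathbb D=\langle g,x\mid g^2=1,\ gxg=x^{-1}\rangle$. Consequently $H$ is cocommutative, and the integral minor of $H$ is $1$: the left homological integral $\mathrm{Ext}^1_H(k,H)$, where $k=H/\ker\epsilon$ is the trivial left module, is one-dimensional over $k$, the character $\chi\colon H\to k$ by which $H$ acts on it from the right has finite order, and $|G^l_\chi/(G^l_\chi\cap G^r_\chi)|=1$. -/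

import Mathlib

open scoped TensorProduct

noncomputable section

namespace HopfGK

universe u v

/-! ### Ring-theoretic notions -/

/-- A (possibly noncommutative) ring is prime if it is nonzero and `a R b = 0` forces
`a = 0` or `b = 0`. -/
def IsPrimeRing (R : Type v) [Ring R] : Prop :=
  Nontrivial R ∧ ∀ a b : R, (∀ r : R, a * r * b = 0) → a = 0 ∨ b = 0

/-- A `k`-algebra is PI if some nonzero noncommutative polynomial over the field `k` vanishes
under every substitution of elements of the algebra for the variables. -/
def IsPIAlgebra (k : Type u) (A : Type v) [Field k] [Ring A] [Algebra k A] : Prop :=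
  ∃ f : FreeAlgebra k ℕ, f ≠ 0 ∧ ∀ s : ℕ → A, FreeAlgebra.lift k s f = 0

/-- `n` is the PI-degree of `R`: the least `m` such that `R` embeds in the `m × m` matrices over
some commutative ring. (Only the matrix entries of the image of `R` matter, so commutative rings in
the universe of `R` suffice.) -/
def HasPIDegree (R : Type v) [Ring R] (n : ℕ) : Prop :=
  IsLeast {m : ℕ | ∃ (C : Type v) (_ : CommRing C) (f : R →+* Matrix (Fin m) (Fin m) C),
    Function.Injective f} n

/-- The Gelfand–Kirillov dimension: the supremum, over finite-dimensional subspaces `V`, of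
`limsup log (dim (k + V)^m) / log m`. Note `(k + V)^m = k + V + ⋯ + V^m`. -/
def gkDim (k : Type u) (A : Type v) [Field k] [Ring A] [Algebra k A] : EReal :=
  ⨆ V : {V : Submodule k A // V.FG},
    Filter.limsup (fun m : ℕ =>
      ((Real.log (Module.finrank k ↥((1 ⊔ V.1) ^ m : Submodule k A)) / Real.log m : ℝ) : EReal))
      Filter.atTop

/-- The (left) global dimension: the supremum of the projective dimensions of left modules. -/
def globalDim (R : Type v) [Ring R] : WithBot ℕ∞ :=
  ⨆ M : ModuleCat.{v} R, CategoryTheory.projectiveDimension M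

/-! ### Characters and winding automorphisms -/

section Winding

variable {k : Type u} {H : Type v} [Field k] [Ring H] [HopfAlgebra k H]

/-- The order of a character `π : H → k` in the group of characters of `H` under convolution
(`0` if the order is infinite). -/
def charOrder (π : H →ₐ[k] k) : ℕ := orderOf (WithConv.toConv π)

/-- The left winding endomorphism `a ↦ ∑ π(a₁) a₂`. -/
def leftWindingHom (π : H →ₐ[k] k) : H →ₐ[k] H :=
  (Algebra.TensorProduct.lid k H).toAlgHom.comp
    ((Algebra.TensorProduct.map π (AlgHom.id k H)).comp (Bialgebra.comulAlgHom k H))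

/-- The right winding endomorphism `a ↦ ∑ a₁ π(a₂)`. -/
def rightWindingHom (π : H →ₐ[k] k) : H →ₐ[k] H :=
  (Algebra.TensorProduct.rid k k H).toAlgHom.comp
    ((Algebra.TensorProduct.map (AlgHom.id k H) π).comp (Bialgebra.comulAlgHom k H))

/-- The character `π ∘ S`, the convolution inverse of `π`. -/
def charInv (π : H →ₐ[k] k) : H →ₐ[k] k :=
  AlgHom.ofLinearMap (π.toLinearMap ∘ₗ HopfAlgebra.antipode k) (by simp)
    (fun a b => by simp [HopfAlgebra.antipode_mul_antidistrib, mul_comm])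

lemma map_mul'_eq (π : H →ₐ[k] k) (f g : H →ₗ[k] H) (z : H ⊗[k] H) :
    π (LinearMap.mul' k H (TensorProduct.map f g z)) =
      LinearMap.mul' k k (TensorProduct.map (π.toLinearMap ∘ₗ f) (π.toLinearMap ∘ₗ g) z) := by
  induction z with
  | zero => simp
  | tmul a b => simp
  | add a b ha hb => simp only [map_add, ha, hb]

lemma convMul_apply' (ρ π : H →ₐ[k] k) (a : H) :
    (WithConv.toConv ρ * WithConv.toConv π).ofConv a =
      LinearMap.mul' k k (TensorProduct.map ρ.toLinearMap π.toLinearMap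
        (Coalgebra.comul (R := k) a)) := rfl

lemma charInv_mul (π : H →ₐ[k] k) :
    WithConv.toConv (charInv π) * WithConv.toConv π = 1 := by
  apply WithConv.ofConv_injective
  ext a
  rw [convMul_apply']
  have h := map_mul'_eq π (HopfAlgebra.antipode k) LinearMap.id (Coalgebra.comul (R := k) a)
  rw [LinearMap.comp_id] at h
  refine h.symm.trans ?_
  have h2 := HopfAlgebra.mul_antipode_rTensor_comul_apply (R := k) a
  rw [LinearMap.rTensor] at h2
  rw [h2]
  simp [AlgHom.convOne_def]

lemma mul_charInv (π : H →ₐ[k] k) :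
    WithConv.toConv π * WithConv.toConv (charInv π) = 1 := by
  apply WithConv.ofConv_injective
  ext a
  rw [convMul_apply']
  have h := map_mul'_eq π LinearMap.id (HopfAlgebra.antipode k) (Coalgebra.comul (R := k) a)
  rw [LinearMap.comp_id] at h
  refine h.symm.trans ?_
  have h2 := HopfAlgebra.mul_antipode_lTensor_comul_apply (R := k) a
  rw [LinearMap.lTensor] at h2
  rw [h2]
  simp [AlgHom.convOne_def]

lemma leftWindingHom_one :
    leftWindingHom (WithConv.ofConv (1 : WithConv (H →ₐ[k] k))) = AlgHom.id k H := by
  ext a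
  have h := Coalgebra.rTensor_counit_comul (R := k) a
  have : leftWindingHom (WithConv.ofConv (1 : WithConv (H →ₐ[k] k))) a =
      TensorProduct.lid k H ((Coalgebra.counit (R := k) (A := H)).rTensor H
        (Coalgebra.comul (R := k) a)) := rfl
  rw [this, h]
  simp

lemma rightWindingHom_one :
    rightWindingHom (WithConv.ofConv (1 : WithConv (H →ₐ[k] k))) = AlgHom.id k H := by
  ext a
  have h := Coalgebra.lTensor_counit_comul (R := k) a
  have : rightWindingHom (WithConv.ofConv (1 : WithConv (H →ₐ[k] k))) a =
      TensorProduct.rid k H ((Coalgebra.counit (R := k) (A := H)).lTensor H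
        (Coalgebra.comul (R := k) a)) := rfl
  rw [this, h]
  simp

lemma leftWindingHom_comp (ρ π : H →ₐ[k] k) :
    (leftWindingHom π).comp (leftWindingHom ρ) =
      leftWindingHom (WithConv.toConv ρ * WithConv.toConv π).ofConv := by
  ext a
  let F : H ⊗[k] (H ⊗[k] H) →ₗ[k] H :=
    (TensorProduct.lid k H).toLinearMap ∘ₗ TensorProduct.map ρ.toLinearMap
      ((TensorProduct.lid k H).toLinearMap ∘ₗ TensorProduct.map π.toLinearMap LinearMap.id)
  have h1 : ∀ z : H ⊗[k] H,
      leftWindingHom π (TensorProduct.lid k H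
        (TensorProduct.map ρ.toLinearMap LinearMap.id z)) =
      F ((Coalgebra.comul (R := k) (A := H)).lTensor H z) := by
    intro z
    induction z with
    | zero => simp
    | tmul x y => simp [F]; rfl
    | add x y hx hy => simp only [map_add, hx, hy]
  have h3 : ∀ (z : H ⊗[k] H) (y : H),
      LinearMap.mul' k k (TensorProduct.map ρ.toLinearMap π.toLinearMap z) • y =
        F (TensorProduct.assoc k H H H (z ⊗ₜ y)) := by
    intro z y
    induction z with
    | zero => simp
    | tmul p q => simp [F, mul_smul, smul_comm (π q)]
    | add p q hp hq => simp only [map_add, add_smul, TensorProduct.add_tmul, hp, hq]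
  have h2 : ∀ z : H ⊗[k] H,
      TensorProduct.lid k H (TensorProduct.map
        (WithConv.toConv ρ * WithConv.toConv π).ofConv.toLinearMap LinearMap.id z) =
      F (TensorProduct.assoc k H H H ((Coalgebra.comul (R := k) (A := H)).rTensor H z)) := by
    intro z
    induction z with
    | zero => simp
    | tmul x y =>
      rw [LinearMap.rTensor_tmul, ← h3]
      simp only [TensorProduct.map_tmul, TensorProduct.lid_tmul, LinearMap.id_apply,
        AlgHom.toLinearMap_apply]
      rfl
    | add x y hx hy => simp only [map_add, hx, hy]
  refine (h1 (Coalgebra.comul (R := k) a)).trans ?_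
  rw [← Coalgebra.coassoc_apply]
  exact (h2 (Coalgebra.comul (R := k) a)).symm

lemma rightWindingHom_comp (ρ π : H →ₐ[k] k) :
    (rightWindingHom ρ).comp (rightWindingHom π) =
      rightWindingHom (WithConv.toConv ρ * WithConv.toConv π).ofConv := by
  ext a
  let F : H ⊗[k] (H ⊗[k] H) →ₗ[k] H :=
    (TensorProduct.rid k H).toLinearMap ∘ₗ TensorProduct.map LinearMap.id
      (LinearMap.mul' k k ∘ₗ TensorProduct.map ρ.toLinearMap π.toLinearMap)
  have h3 : ∀ (z : H ⊗[k] H) (y : H),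
      π y • TensorProduct.rid k H (TensorProduct.map LinearMap.id ρ.toLinearMap z) =
        F (TensorProduct.assoc k H H H (z ⊗ₜ y)) := by
    intro z y
    induction z with
    | zero => simp
    | tmul p q => simp [F, mul_smul, smul_comm (π y)]
    | add p q hp hq => simp only [map_add, smul_add, TensorProduct.add_tmul, hp, hq]
  have h1 : ∀ z : H ⊗[k] H,
      rightWindingHom ρ (TensorProduct.rid k H
        (TensorProduct.map LinearMap.id π.toLinearMap z)) =
      F (TensorProduct.assoc k H H H ((Coalgebra.comul (R := k) (A := H)).rTensor H z)) := by
    intro z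
    induction z with
    | zero => simp
    | tmul x y =>
      rw [LinearMap.rTensor_tmul, ← h3]
      simp only [TensorProduct.map_tmul, TensorProduct.rid_tmul, LinearMap.id_apply,
        AlgHom.toLinearMap_apply, map_smul]
      rfl
    | add x y hx hy => simp only [map_add, hx, hy]
  have h2 : ∀ z : H ⊗[k] H,
      TensorProduct.rid k H (TensorProduct.map LinearMap.id
        (WithConv.toConv ρ * WithConv.toConv π).ofConv.toLinearMap z) =
      F ((Coalgebra.comul (R := k) (A := H)).lTensor H z) := by
    intro z
    induction z with
    | zero => simp
    | tmul x y => simp [F]; rfl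
    | add x y hx hy => simp only [map_add, hx, hy]
  refine (h1 (Coalgebra.comul (R := k) a)).trans ?_
  rw [Coalgebra.coassoc_apply]
  exact (h2 (Coalgebra.comul (R := k) a)).symm

/-- The left winding automorphism `Ξˡ_π : a ↦ ∑ π(a₁) a₂`. -/
def leftWinding (π : H →ₐ[k] k) : H ≃ₐ[k] H :=
  AlgEquiv.ofAlgHom (leftWindingHom π) (leftWindingHom (charInv π))
    (by rw [leftWindingHom_comp, charInv_mul, leftWindingHom_one])
    (by rw [leftWindingHom_comp, mul_charInv, leftWindingHom_one])

/-- The right winding automorphism `Ξʳ_π : a ↦ ∑ a₁ π(a₂)`. -/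
def rightWinding (π : H →ₐ[k] k) : H ≃ₐ[k] H :=
  AlgEquiv.ofAlgHom (rightWindingHom π) (rightWindingHom (charInv π))
    (by rw [rightWindingHom_comp, mul_charInv, rightWindingHom_one])
    (by rw [rightWindingHom_comp, charInv_mul, rightWindingHom_one])

/-- `Gˡ_π`, the group of algebra automorphisms generated by `Ξˡ_π`. -/
def leftGroup (π : H →ₐ[k] k) : Subgroup (H ≃ₐ[k] H) := Subgroup.closure {leftWinding π}

/-- `Gʳ_π`, the group of algebra automorphisms generated by `Ξʳ_π`. -/
def rightGroup (π : H →ₐ[k] k) : Subgroup (H ≃ₐ[k] H) := Subgroup.closure {rightWinding π}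

/-- The index `|Gˡ_π / (Gˡ_π ∩ Gʳ_π)|`. -/
def windingIndex (π : H →ₐ[k] k) : ℕ := (rightGroup π).relIndex (leftGroup π)

/-- The subalgebra of elements fixed by a group of algebra automorphisms. -/
def invariants (G : Subgroup (H ≃ₐ[k] H)) : Subalgebra k H where
  carrier := {a | ∀ σ ∈ G, σ a = a}
  mul_mem' ha hb σ hσ := by rw [map_mul, ha σ hσ, hb σ hσ]
  add_mem' ha hb σ hσ := by rw [map_add, ha σ hσ, hb σ hσ]
  algebraMap_mem' c σ _ := σ.commutes c

/-- `H_π`, the invariants of the group generated by `Gˡ_π` and `Gʳ_π`. -/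
def classicalComponent (π : H →ₐ[k] k) : Subalgebra k H :=
  invariants (leftGroup π ⊔ rightGroup π)

/-- The primitive case: `H_π` is a Hopf subalgebra isomorphic to `k[X]` with `X` primitive. -/
def IsPrimitiveCase (π : H →ₐ[k] k) : Prop :=
  ∃ f : Polynomial k →ₐ[k] H, Function.Injective f ∧ f.range = classicalComponent π ∧
    Coalgebra.comul (R := k) (f Polynomial.X) =
      f Polynomial.X ⊗ₜ[k] (1 : H) + (1 : H) ⊗ₜ[k] f Polynomial.X

/-- The group-like case: `H_π` is a Hopf subalgebra isomorphic to `k[X, X⁻¹]` with `X`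
group-like. -/
def IsGroupLikeCase (π : H →ₐ[k] k) : Prop :=
  ∃ f : LaurentPolynomial k →ₐ[k] H, Function.Injective f ∧ f.range = classicalComponent π ∧
    Coalgebra.comul (R := k) (f (LaurentPolynomial.T 1)) =
      f (LaurentPolynomial.T 1) ⊗ₜ[k] f (LaurentPolynomial.T 1)

end Winding

/-! ### The standing hypotheses -/

/-- The ring `B`, not known in advance to be commutative, is a commutative Dedekind domain. -/
def IsCommDedekind (B : Type v) [Ring B] : Prop :=
  ∃ (D : Type v) (_ : CommRing D) (_ : IsDedekindDomain D), Nonempty (D ≃+* B)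

/-- `H` is an affine, noetherian, prime, PI Hopf algebra; the order of the character `π` is finite,
equal to the PI-degree `n` of `H`, and coprime to the characteristic of `k` if that is positive; the
invariants of the left winding automorphism of `π` form a Dedekind domain; and `H` has
Gelfand–Kirillov dimension and global dimension one. -/
structure Hypotheses (k : Type u) (H : Type v) [Field k] [Ring H] [HopfAlgebra k H]
    (π : H →ₐ[k] k) (n : ℕ) : Prop where
  affine : Algebra.FiniteType k H
  noetherian_left : IsNoetherianRing H
  noetherian_right : IsNoetherianRing Hᵐᵒᵖ
  prime : IsPrimeRing H
  pi : IsPIAlgebra k H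
  order_pos : 0 < n
  order_eq : charOrder π = n
  piDegree_eq : HasPIDegree H n
  dedekind : IsCommDedekind (invariants (leftGroup π))
  coprime_char : ∀ p : ℕ, 0 < p → CharP k p → Nat.Coprime n p
  gkDim_eq : gkDim k H = 1
  globalDim_eq : globalDim H = 1

/-! ### The homological integral -/

section Integral

open CategoryTheory

variable (k : Type u) (H : Type v) [Field k] [Ring H] [HopfAlgebra k H]

/-- The trivial left `H`-module `H / ker ε`. -/
def trivialModule : ModuleCat.{v} H :=
  ModuleCat.of H (H ⧸ (RingHom.ker (Bialgebra.counitAlgHom k H) : Submodule H H))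

/-- The left homological integral `Ext¹_H(k, H)`, for `H` of injective dimension one. -/
abbrev LeftIntegral : Type v :=
  Abelian.Ext.{v} (trivialModule k H) (ModuleCat.of H H) 1

variable {k H}

/-- The right action of `h : H` on `Ext¹_H(k, H)`, induced by the endomorphism `r ↦ r h` of the left
module `H`. Restricted to scalars from `k`, it is the vector space structure. -/
def LeftIntegral.act (α : LeftIntegral k H) (h : H) : LeftIntegral k H :=
  α.comp (Abelian.Ext.mk₀ (ModuleCat.ofHom (LinearMap.toSpanSingleton H H h))) (add_zero 1)

/-- `χ` is the character given by the right structure of the left homological integral: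
`Ext¹_H(k, H)` is one-dimensional over `k`, and `h : H` acts on it from the right as `χ h`. -/
structure IsIntegralCharacter (χ : H →ₐ[k] k) : Prop where
  one_dimensional : ∃ α : LeftIntegral k H, α ≠ 0 ∧
    ∀ β : LeftIntegral k H, ∃ c : k, β = α.act (algebraMap k H c)
  act_eq : ∀ (α : LeftIntegral k H) (h : H), α.act h = α.act (algebraMap k H (χ h))

variable (k H) in
/-- The integral minor of `H` is defined and equal to `m`: the left homological integral of `H` is
one-dimensional, the character `χ` of its right structure has finite order, and
`|Gˡ_χ / (Gˡ_χ ∩ Gʳ_χ)| = m`. -/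
def HasIntegralMinor (m : ℕ) : Prop :=
  ∃ χ : H →ₐ[k] k, IsIntegralCharacter χ ∧ 0 < charOrder χ ∧ windingIndex χ = m

end Integral

/-! ### Taft algebras -/

/-- The two generators of the Taft algebras. -/
inductive TaftGen : Type
  | g : TaftGen
  | x : TaftGen

section Taft

variable (k : Type u) [Field k]

/-- The relations `gⁿ = 1` and `x g = ξ g x`. -/
inductive TaftRel (n : ℕ) (ξ : k) : FreeAlgebra k TaftGen → FreeAlgebra k TaftGen → Prop
  | pow : TaftRel n ξ (FreeAlgebra.ι k TaftGen.g ^ n) 1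
  | comm : TaftRel n ξ (FreeAlgebra.ι k TaftGen.x * FreeAlgebra.ι k TaftGen.g)
      (ξ • (FreeAlgebra.ι k TaftGen.g * FreeAlgebra.ι k TaftGen.x))

/-- The Taft algebra `H(n, t, ξ)`. As an algebra it does not depend on `t`, which enters the
comultiplication only. -/
def Taft (n _t : ℕ) (ξ : k) : Type u := RingQuot (TaftRel k n ξ)

variable (n t : ℕ) (ξ : k)

instance : Ring (Taft k n t ξ) := inferInstanceAs (Ring (RingQuot (TaftRel k n ξ)))
instance : Algebra k (Taft k n t ξ) := inferInstanceAs (Algebra k (RingQuot (TaftRel k n ξ)))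

namespace Taft

/-- The quotient map from the free algebra. -/
def mk : FreeAlgebra k TaftGen →ₐ[k] Taft k n t ξ := RingQuot.mkAlgHom k (TaftRel k n ξ)

/-- The generator `g`. -/
def g : Taft k n t ξ := mk k n t ξ (FreeAlgebra.ι k TaftGen.g)

/-- The generator `x`. -/
def x : Taft k n t ξ := mk k n t ξ (FreeAlgebra.ι k TaftGen.x)

lemma g_pow : g k n t ξ ^ n = 1 := by
  have h := RingQuot.mkAlgHom_rel k (TaftRel.pow (k := k) (n := n) (ξ := ξ))
  rw [map_pow, map_one] at h
  exact h

lemma x_mul_g : x k n t ξ * g k n t ξ = ξ • (g k n t ξ * x k n t ξ) := by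
  have h := RingQuot.mkAlgHom_rel k (TaftRel.comm (k := k) (n := n) (ξ := ξ))
  rw [map_mul, map_smul, map_mul] at h
  exact h

variable {k n t ξ}

/-- The universal property of the presentation. -/
def lift {A : Type*} [Ring A] [Algebra k A] (a b : A) (ha : a ^ n = 1)
    (hab : b * a = ξ • (a * b)) : Taft k n t ξ →ₐ[k] A :=
  RingQuot.liftAlgHom k ⟨FreeAlgebra.lift k (fun i => match i with | .g => a | .x => b), by
    intro p q h
    cases h <;> simp [ha, hab]⟩

section

variable {A : Type*} [Ring A] [Algebra k A]

@[simp] lemma lift_g (a b : A) (ha : a ^ n = 1) (hab : b * a = ξ • (a * b)) :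
    lift (t := t) a b ha hab (g k n t ξ) = a := by
  refine (RingQuot.liftAlgHom_mkAlgHom_apply k _ _ _).trans ?_
  simp

@[simp] lemma lift_x (a b : A) (ha : a ^ n = 1) (hab : b * a = ξ • (a * b)) :
    lift (t := t) a b ha hab (x k n t ξ) = b := by
  refine (RingQuot.liftAlgHom_mkAlgHom_apply k _ _ _).trans ?_
  simp

lemma hom_ext {f₁ f₂ : Taft k n t ξ →ₐ[k] A} (hg : f₁ (g k n t ξ) = f₂ (g k n t ξ))
    (hx : f₁ (x k n t ξ) = f₂ (x k n t ξ)) : f₁ = f₂ := by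
  refine RingQuot.ringQuot_ext' k f₁ f₂ ?_
  apply FreeAlgebra.hom_ext
  funext i
  cases i
  · exact hg
  · exact hx

end

@[elab_as_elim]
lemma induction {P : Taft k n t ξ → Prop} (hc : ∀ c : k, P (algebraMap k _ c))
    (hg : P (g k n t ξ)) (hx : P (x k n t ξ)) (hmul : ∀ a b, P a → P b → P (a * b))
    (hadd : ∀ a b, P a → P b → P (a + b)) (a : Taft k n t ξ) : P a := by
  obtain ⟨p, rfl⟩ := RingQuot.mkAlgHom_surjective k (TaftRel k n ξ) a
  change P (mk k n t ξ p)
  induction p using FreeAlgebra.induction with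
  | grade0 c => rw [AlgHom.commutes]; exact hc c
  | grade1 i => cases i; exacts [hg, hx]
  | mul a b ha hb => rw [map_mul]; exact hmul _ _ ha hb
  | add a b ha hb => rw [map_add]; exact hadd _ _ ha hb

lemma g_pow_mul_g_pow_comm (i j : ℕ) :
    g k n t ξ ^ i * g k n t ξ ^ j = g k n t ξ ^ j * g k n t ξ ^ i := by
  rw [← pow_add, ← pow_add, add_comm]

variable (k n t ξ)

/-- `Δ(g) = g ⊗ g`, `Δ(x) = x ⊗ gᵗ + 1 ⊗ x`. -/
def comulHom : Taft k n t ξ →ₐ[k] Taft k n t ξ ⊗[k] Taft k n t ξ :=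
  lift (g k n t ξ ⊗ₜ g k n t ξ) (x k n t ξ ⊗ₜ (g k n t ξ ^ t) + 1 ⊗ₜ x k n t ξ)
    (by simp [Algebra.TensorProduct.tmul_pow, g_pow, Algebra.TensorProduct.one_def])
    (by
      simp only [add_mul, mul_add, Algebra.TensorProduct.tmul_mul_tmul, x_mul_g, one_mul, mul_one,
        smul_add, TensorProduct.tmul_smul, TensorProduct.smul_tmul', ← pow_succ, ← pow_succ'])

/-- `ε(g) = 1`, `ε(x) = 0`. -/
def counitHom : Taft k n t ξ →ₐ[k] k := lift 1 0 (by simp) (by simp)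

instance : Bialgebra k (Taft k n t ξ) :=
  Bialgebra.ofAlgHom (comulHom k n t ξ) (counitHom k n t ξ)
    (by
      apply hom_ext <;>
      simp [comulHom, Algebra.TensorProduct.one_def, TensorProduct.add_tmul,
        TensorProduct.tmul_add, Algebra.TensorProduct.tmul_pow, add_assoc])
    (by
      apply hom_ext <;>
      simp [comulHom, counitHom])
    (by
      apply hom_ext <;>
      simp [comulHom, counitHom])

lemma comul_eq (a : Taft k n t ξ) : Coalgebra.comul (R := k) a = comulHom k n t ξ a := rfl

lemma counit_eq (a : Taft k n t ξ) : Coalgebra.counit (R := k) a = counitHom k n t ξ a := rfl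

variable [NeZero n]

lemma g_mul_inv : g k n t ξ * g k n t ξ ^ (n - 1) = 1 := by
  rw [← pow_succ', Nat.sub_add_cancel (NeZero.one_le), g_pow]

lemma inv_mul_g : g k n t ξ ^ (n - 1) * g k n t ξ = 1 := by
  rw [← pow_succ, Nat.sub_add_cancel (NeZero.one_le), g_pow]

lemma inv_mul_x :
    g k n t ξ ^ (n - 1) * x k n t ξ = ξ • (x k n t ξ * g k n t ξ ^ (n - 1)) := by
  have h := congrArg (fun a => g k n t ξ ^ (n - 1) * a * g k n t ξ ^ (n - 1)) (x_mul_g k n t ξ)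
  simp only [mul_smul_comm, smul_mul_assoc] at h
  rw [← mul_assoc, mul_assoc _ (g k n t ξ) (g k n t ξ ^ (n - 1)), g_mul_inv, mul_one,
    ← mul_assoc, inv_mul_g, one_mul] at h
  exact h

/-- `S(g) = g⁻¹`, `S(x) = -x g⁻ᵗ`, extended to an algebra anti-homomorphism; here
`g⁻¹ = gⁿ⁻¹`. -/
def antipodeOp : Taft k n t ξ →ₐ[k] (Taft k n t ξ)ᵐᵒᵖ :=
  lift (MulOpposite.op (g k n t ξ ^ (n - 1)))
    (MulOpposite.op (-(x k n t ξ * (g k n t ξ ^ (n - 1)) ^ t)))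
    (by rw [← MulOpposite.op_pow, ← pow_mul, mul_comm, pow_mul, g_pow, one_pow,
      MulOpposite.op_one])
    (by
      rw [← MulOpposite.op_mul, ← MulOpposite.op_mul, ← MulOpposite.op_smul, mul_neg, neg_mul,
        smul_neg, ← mul_assoc, inv_mul_x, smul_mul_assoc, mul_assoc, mul_assoc, ← pow_succ,
        ← pow_succ'])

/-- The antipode. -/
def antipodeLin : Taft k n t ξ →ₗ[k] Taft k n t ξ :=
  (MulOpposite.opLinearEquiv k).symm.toLinearMap ∘ₗ (antipodeOp k n t ξ).toLinearMap

lemma antipodeLin_mul (a b : Taft k n t ξ) :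
    antipodeLin k n t ξ (a * b) = antipodeLin k n t ξ b * antipodeLin k n t ξ a := by
  simp [antipodeLin]

lemma antipodeLin_g : antipodeLin k n t ξ (g k n t ξ) = g k n t ξ ^ (n - 1) := by
  simp [antipodeLin, antipodeOp]

lemma antipodeLin_x :
    antipodeLin k n t ξ (x k n t ξ) = -(x k n t ξ * (g k n t ξ ^ (n - 1)) ^ t) := by
  simp [antipodeLin, antipodeOp]

lemma antipodeLin_one : antipodeLin k n t ξ 1 = 1 := by
  simp [antipodeLin]

lemma antipodeLin_g_pow (i : ℕ) :
    antipodeLin k n t ξ (g k n t ξ ^ i) = (g k n t ξ ^ (n - 1)) ^ i := by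
  induction i with
  | zero => simp [antipodeLin_one]
  | succ i ih => rw [pow_succ, antipodeLin_mul, ih, antipodeLin_g, ← pow_succ']

lemma inv_pow_mul_g_pow (i : ℕ) : (g k n t ξ ^ (n - 1)) ^ i * g k n t ξ ^ i = 1 := by
  rw [← pow_mul, mul_comm (n - 1) i, pow_mul, ← pow_succ, Nat.sub_add_cancel NeZero.one_le,
    ← pow_mul, mul_comm, pow_mul, g_pow, one_pow]

lemma g_pow_mul_inv_pow (i : ℕ) : g k n t ξ ^ i * (g k n t ξ ^ (n - 1)) ^ i = 1 := by
  rw [← pow_mul, g_pow_mul_g_pow_comm, pow_mul, inv_pow_mul_g_pow]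

lemma antipode_left (a : Taft k n t ξ) :
    LinearMap.mul' k _ ((antipodeLin k n t ξ).rTensor _ (comulHom k n t ξ a)) =
      algebraMap k _ (counitHom k n t ξ a) := by
  have key : ∀ (b : Taft k n t ξ) (c : k),
      LinearMap.mul' k _ ((antipodeLin k n t ξ).rTensor _ (comulHom k n t ξ b)) =
        algebraMap k _ c → ∀ z : Taft k n t ξ ⊗[k] Taft k n t ξ,
      LinearMap.mul' k _ ((antipodeLin k n t ξ).rTensor _ (comulHom k n t ξ b * z)) =
        c • LinearMap.mul' k _ ((antipodeLin k n t ξ).rTensor _ z) := by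
    intro b c hb z
    induction z with
    | zero => simp
    | add p q hp hq => simp only [mul_add, map_add, smul_add, hp, hq]
    | tmul p q =>
      have h : ∀ w : Taft k n t ξ ⊗[k] Taft k n t ξ,
          LinearMap.mul' k _ ((antipodeLin k n t ξ).rTensor _ (w * p ⊗ₜ q)) =
            antipodeLin k n t ξ p *
              LinearMap.mul' k _ ((antipodeLin k n t ξ).rTensor _ w) * q := by
        intro w
        induction w with
        | zero => simp
        | add u v hu hv => simp only [add_mul, mul_add, map_add, hu, hv]
        | tmul u v => simp [antipodeLin_mul, mul_assoc]
      rw [h, hb]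
      simp [Algebra.algebraMap_eq_smul_one]
  induction a using Taft.induction with
  | hc c => simp [Algebra.TensorProduct.one_def, Algebra.algebraMap_eq_smul_one, antipodeLin_one]
  | hg => simp [comulHom, counitHom, antipodeLin_g, inv_mul_g]
  | hx =>
    simp [comulHom, counitHom, antipodeLin_x, antipodeLin_one, mul_assoc, inv_pow_mul_g_pow]
  | hmul a b ha hb =>
    rw [map_mul, key a _ ha, hb, map_mul, map_mul, Algebra.smul_def]
  | hadd a b ha hb => simp only [map_add, ha, hb]

lemma antipode_right (a : Taft k n t ξ) :
    LinearMap.mul' k _ ((antipodeLin k n t ξ).lTensor _ (comulHom k n t ξ a)) =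
      algebraMap k _ (counitHom k n t ξ a) := by
  have key : ∀ (b : Taft k n t ξ) (c : k),
      LinearMap.mul' k _ ((antipodeLin k n t ξ).lTensor _ (comulHom k n t ξ b)) =
        algebraMap k _ c → ∀ z : Taft k n t ξ ⊗[k] Taft k n t ξ,
      LinearMap.mul' k _ ((antipodeLin k n t ξ).lTensor _ (z * comulHom k n t ξ b)) =
        c • LinearMap.mul' k _ ((antipodeLin k n t ξ).lTensor _ z) := by
    intro b c hb z
    induction z with
    | zero => simp
    | add p q hp hq => simp only [add_mul, map_add, smul_add, hp, hq]
    | tmul p q =>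
      have h : ∀ w : Taft k n t ξ ⊗[k] Taft k n t ξ,
          LinearMap.mul' k _ ((antipodeLin k n t ξ).lTensor _ (p ⊗ₜ q * w)) =
            p * LinearMap.mul' k _ ((antipodeLin k n t ξ).lTensor _ w) *
              antipodeLin k n t ξ q := by
        intro w
        induction w with
        | zero => simp
        | add u v hu hv => simp only [add_mul, mul_add, map_add, hu, hv]
        | tmul u v => simp [antipodeLin_mul, mul_assoc]
      rw [h, hb]
      simp [Algebra.algebraMap_eq_smul_one]
  induction a using Taft.induction with
  | hc c => simp [Algebra.TensorProduct.one_def, Algebra.algebraMap_eq_smul_one, antipodeLin_one]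
  | hg => simp [comulHom, counitHom, antipodeLin_g, g_mul_inv]
  | hx => simp [comulHom, counitHom, antipodeLin_x, antipodeLin_g_pow]
  | hmul a b ha hb =>
    rw [map_mul, key b _ hb, ha, map_mul, Algebra.smul_def, ← map_mul, mul_comm]
  | hadd a b ha hb => simp only [map_add, ha, hb]

instance : HopfAlgebra k (Taft k n t ξ) where
  antipode := antipodeLin k n t ξ
  mul_antipode_rTensor_comul := LinearMap.ext (antipode_left k n t ξ)
  mul_antipode_lTensor_comul := LinearMap.ext (antipode_right k n t ξ)

end Taft

end Taft

end HopfGK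

end

/-! Since the winding index is one, the left winding automorphism of `π` is also a right one, and
comparing counits shows that it equals the right winding automorphism of the same `π`. Call it `σ`.
Its order is `n`, which is invertible in `k`, so `H` splits into eigenspaces `H_i`, graded by `ℤ/n`.
As `σ` may be applied to either leg of `Δ`, one has `Δ(H_i) ⊆ H_i ⊗ H_i`
(`IsBiwinding.comul_eq_map_proj`), and `D = H_0` is a commutative Hopf algebra. The characters `ε ∘
σ^j` are distinct, hence linearly independent, so each `H_i` contains some `v` with `ε(v) = 1`; the
antipode identity at `v` puts `1` into `H_{-i} H_i`. The grading is therefore strong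
(`IsBiwinding.one_mem_comp_mul_comp`). It follows that `D` is affine (`IsBiwinding.finiteType`), and
Gelfand–Kirillov dimension one makes `D` larger than `k` and any two of its elements algebraically
dependent.

So `D` is the coordinate ring of a connected affine group of dimension one, which must be the
additive or the multiplicative group (`exists_polynomial_or_laurent`). The classification works with
`k`-points. The group is commutative because the conjugation action on `A / m^j`, `m` the
augmentation ideal, would otherwise yield nonconstant class functions (`pt_mul_comm`). If there is a
nontrivial group-like function, such functions span, and their group is free of rank one
(`exists_laurent_of_isMultFun`). If there is none, there is a nonzero additive function `x`, and a
semi-invariant modulo `k[x]` is shown to lie in `k[x]`: by a subleading coefficient in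
characteristic zero, and by `p`-polynomials and Artin–Schreier descent for a well chosen `x` in
characteristic `p` (`exists_bijective_aeval`).

In both cases `D` is a principal ideal domain, so `H_1` contains a unit `u`
(`IsBiwinding.exists_unit_mem_comp`), normalised by `ε(u) = 1`. It is group-like: `Δ(u) = (u ⊗ u) w`
with `w` a unit of `D ⊗ D` whose slices are group-like, and a connected group has no nonconstant
family of these (`IsBiwinding.comul_unit`). Now `H` is the sum of the `u^i D`. If `u^d` centralises
`D` for some `d ∣ n`, then `H` embeds in `d × d` matrices over a commutative ring
(`IsBiwinding.le_of_hasPIDegree`), so conjugation by `u` on `D` has order exactly `n`. On `k[x]` it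
is `x ↦ ξ x` with `ξ` a primitive `n`th root of unity, which gives the Taft algebra; on `k[y, y⁻¹]`
it is `y ↦ y⁻¹`, so `n = 2`, which gives the dihedral group algebra.

Both algebras are cocommutative, so every character has winding index one. For the integral minor it
remains to compute `Ext¹(k, H)` from the augmentation sequence, with one explicit generator, and to
see that its character has finite order because it agrees with `ε` on `D`. -/

noncomputable section

namespace HopfGK

open WithConv Polynomial

set_option linter.unusedSectionVars false

/-! ### Slices of a tensor -/

section Slice

variable {k : Type*} {A : Type*} [Field k] [CommRing A] [Algebra k A]

/-- Evaluation of the second tensor factor at a point. -/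
def slice (h : A →ₐ[k] k) : A ⊗[k] A →ₐ[k] A :=
  Algebra.TensorProduct.lift (AlgHom.id k A) ((Algebra.ofId k A).comp h) (fun _ _ => .all _ _)

@[simp] lemma slice_tmul (h : A →ₐ[k] k) (a b : A) : slice h (a ⊗ₜ b) = h b • a := by
  simp [slice, Algebra.ofId_apply, Algebra.smul_def, mul_comm]

/-- Turns a linear functional of a slice into a regular function of the point. This is how the
characters and cocycles found below by linear algebra become elements of `A`. -/
lemma exists_eval_eq_slice (l : A →ₗ[k] k) (w : A ⊗[k] A) :
    ∃ z : A, ∀ h : A →ₐ[k] k, h z = l (slice h w) := by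
  induction w with
  | zero => exact ⟨0, by simp⟩
  | tmul a b => exact ⟨l a • b, fun h => by simp [mul_comm]⟩
  | add x y hx hy =>
    obtain ⟨z₁, h₁⟩ := hx
    obtain ⟨z₂, h₂⟩ := hy
    exact ⟨z₁ + z₂, fun h => by simp [h₁, h₂]⟩

end Slice

/-! ### Points of a commutative Hopf algebra -/

section Points

variable {k : Type*} {A : Type*} [Field k] [CommRing A] [HopfAlgebra k A]

/-- Postcomposition with an algebra homomorphism, as a homomorphism of convolution monoids. -/
def postComp {B C : Type*} [CommRing B] [CommRing C] [Algebra k B] [Algebra k C] (φ : B →ₐ[k] C) :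
    WithConv (A →ₐ[k] B) →* WithConv (A →ₐ[k] C) where
  toFun f := toConv (φ.comp f.ofConv)
  map_one' := by
    apply ofConv_injective
    ext a
    simp [AlgHom.convOne_def]
  map_mul' f g := by
    apply ofConv_injective
    exact AlgHom.comp_convMul_distrib φ f g

lemma postComp_apply {B C : Type*} [CommRing B] [CommRing C] [Algebra k B] [Algebra k C]
    (φ : B →ₐ[k] C) (f : WithConv (A →ₐ[k] B)) (a : A) : postComp φ f a = φ (f a) := rfl

/-- The constant `A`-point attached to a `k`-point. -/
def constPt (h : WithConv (A →ₐ[k] k)) : WithConv (A →ₐ[k] A) :=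
  postComp (Algebra.ofId k A) h

/-- The generic point. -/
def genPt : WithConv (A →ₐ[k] A) := toConv (AlgHom.id k A)

lemma postComp_genPt (g : WithConv (A →ₐ[k] k)) : postComp g.ofConv genPt = g := rfl

lemma postComp_constPt (g h : WithConv (A →ₐ[k] k)) : postComp g.ofConv (constPt h) = h := by
  apply ofConv_injective
  ext a
  change g.ofConv (Algebra.ofId k A (h a)) = h a
  simp [Algebra.ofId_apply]

/-- Translation of functions: `(rTrans h a)(g) = a(g h)`. -/
def rTrans (h : WithConv (A →ₐ[k] k)) : A →ₐ[k] A := (genPt * constPt h).ofConv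

lemma apply_rTrans (g h : WithConv (A →ₐ[k] k)) (a : A) : g (rTrans h a) = (g * h) a := by
  have : postComp g.ofConv (genPt * constPt h) = g * h := by
    rw [map_mul, postComp_genPt, postComp_constPt]
  rw [← this]
  rfl

/-- Conjugation of functions: `(conjPt h a)(g) = a(h⁻¹ g h)`. -/
def conjPt (h : WithConv (A →ₐ[k] k)) : A →ₐ[k] A := (constPt h⁻¹ * genPt * constPt h).ofConv

lemma apply_conjPt (g h : WithConv (A →ₐ[k] k)) (a : A) :
    g (conjPt h a) = (h⁻¹ * g * h) a := by
  have : postComp g.ofConv (constPt h⁻¹ * genPt * constPt h) = h⁻¹ * g * h := by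
    rw [map_mul, map_mul, postComp_genPt, postComp_constPt, postComp_constPt]
  rw [← this]
  rfl

/-- The orbit map of conjugation: `(orbitPt h a)(g) = a(g⁻¹ h g)`. -/
def orbitPt (h : WithConv (A →ₐ[k] k)) : A →ₐ[k] A :=
  (genPt⁻¹ * constPt h * genPt).ofConv

lemma apply_orbitPt (g h : WithConv (A →ₐ[k] k)) (a : A) :
    g (orbitPt h a) = (g⁻¹ * h * g) a := by
  have : postComp g.ofConv (genPt⁻¹ * constPt h * genPt) = g⁻¹ * h * g := by
    rw [map_mul, map_mul, map_inv, postComp_genPt, postComp_constPt]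
  rw [← this]
  rfl

/-- The two inclusions into `A ⊗ A` form a universal pair of points. Specialising the second to `h`
turns their conjugate into conjugation by `h`, so conjugation depends algebraically on the
conjugating point. -/
lemma exists_slice_eq_conjPt (a : A) :
    ∃ w : A ⊗[k] A, ∀ h : WithConv (A →ₐ[k] k), conjPt h a = slice h.ofConv w := by
  let il : WithConv (A →ₐ[k] A ⊗[k] A) := toConv Algebra.TensorProduct.includeLeft
  let ir : WithConv (A →ₐ[k] A ⊗[k] A) := toConv Algebra.TensorProduct.includeRight
  refine ⟨(ir⁻¹ * il * ir) a, fun h => ?_⟩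
  have hl : postComp (slice h.ofConv) il = genPt := by
    apply ofConv_injective; ext a; simp [postComp, il, genPt]
  have hr : postComp (slice h.ofConv) ir = constPt h := by
    apply ofConv_injective; ext a
    simp [postComp, ir, constPt, Algebra.ofId_apply, Algebra.algebraMap_eq_smul_one]
  have hi : postComp (slice h.ofConv) ir⁻¹ = constPt h⁻¹ := by
    have : postComp (slice h.ofConv) ir⁻¹ = (postComp (slice h.ofConv) ir)⁻¹ := rfl
    rw [this, hr]
    rfl
  rw [← postComp_apply, map_mul, map_mul, hl, hr, hi]
  rfl

lemma one_apply_pt (a : A) : (1 : WithConv (A →ₐ[k] k)) a = Coalgebra.counit (R := k) a := rfl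

end Points

/-! ### Points are dense, and the consequences of dimension one -/

section Dense

variable {k : Type*} {A : Type*} [Field k] [IsAlgClosed k] [CommRing A] [Algebra k A]
  [Algebra.FiniteType k A]

/-- By Zariski's lemma the residue field is finite over the algebraically closed field `k`, hence
equal to it. -/
lemma exists_algHom_ker_eq (m : Ideal A) [hm : m.IsMaximal] :
    ∃ g : A →ₐ[k] k, RingHom.ker g = m := by
  let _ : Field (A ⧸ m) := Ideal.Quotient.field m
  have : Module.Finite k (A ⧸ m) := finite_of_finite_type_of_isJacobsonRing k (A ⧸ m)
  let e : k ≃ₐ[k] A ⧸ m := AlgEquiv.ofBijective (Algebra.ofId k (A ⧸ m))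
    (IsAlgClosed.algebraMap_bijective_of_isIntegral (k := k) (K := A ⧸ m))
  refine ⟨e.symm.toAlgHom.comp (Ideal.Quotient.mkₐ k m), ?_⟩
  ext a
  simp [RingHom.mem_ker, Ideal.Quotient.eq_zero_iff_mem]

/-- The Nullstellensatz: a function vanishing at all points is zero. -/
lemma eq_zero_of_forall_pt [IsDomain A] (a : A) (h : ∀ g : A →ₐ[k] k, g a = 0) : a = 0 := by
  have hJ : IsJacobsonRing A := isJacobsonRing_of_finiteType (A := k)
  have hb : (⊥ : Ideal A).jacobson = ⊥ := hJ.out Ideal.isPrime_bot.isRadical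
  rw [← Ideal.mem_bot, ← hb, Ideal.jacobson, Ideal.mem_sInf]
  rintro m ⟨-, hm⟩
  obtain ⟨g, rfl⟩ := exists_algHom_ker_eq (k := k) m
  exact h g

lemma eq_of_forall_pt [IsDomain A] {a b : A} (h : ∀ g : A →ₐ[k] k, g a = g b) : a = b :=
  sub_eq_zero.1 (eq_zero_of_forall_pt (k := k) _ fun g => by rw [map_sub, h, sub_self])

/-- Expand `w` along a basis of the first factor. The coefficients lie in the second factor, and
their values at `g` are the coordinates of `slice g w`. -/
lemma tensor_eq_zero_of_forall_slice [IsDomain A] (w : A ⊗[k] A)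
    (h : ∀ g : A →ₐ[k] k, slice g w = 0) : w = 0 := by
  classical
  let b := Module.Basis.ofVectorSpace k A
  apply (TensorProduct.equivFinsuppOfBasisLeft (N := A) b).injective
  rw [map_zero]
  ext i
  rw [TensorProduct.equivFinsuppOfBasisLeft_apply, Finsupp.zero_apply]
  refine eq_zero_of_forall_pt (k := k) _ fun g => ?_
  have key : ∀ w : A ⊗[k] A,
      g (TensorProduct.lid k A ((b.coord i).rTensor A w)) = b.coord i (slice g w) := by
    intro w
    induction w with
    | zero => simp
    | tmul x y => simp [mul_comm]
    | add x y hx hy => simp only [map_add, hx, hy]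
  rw [key, h, map_zero]

/-- A homomorphism to a domain that is constant on a nonconstant function is constant. -/
lemma exists_pt_of_map_const [IsDedekindDomain A] {B : Type*} [CommRing B] [IsDomain B]
    [Algebra k B] (φ : A →ₐ[k] B) (z : A) (hz : z ∉ (algebraMap k A).range) (c : k)
    (hc : φ z = algebraMap k B c) : ∃ g : A →ₐ[k] k, ∀ a, φ a = algebraMap k B (g a) := by
  have hp : (RingHom.ker φ).IsPrime := RingHom.ker_isPrime _
  -- The kernel contains `z - c`, so it is a nonzero prime of a Dedekind domain. It is therefore
  -- maximal, which means that `φ` factors through a point.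
  have hne : RingHom.ker φ ≠ ⊥ := by
    intro h
    have : z - algebraMap k A c ∈ RingHom.ker φ := by simp [RingHom.mem_ker, hc]
    rw [h, Ideal.mem_bot, sub_eq_zero] at this
    exact hz ⟨c, this.symm⟩
  have hm := hp.isMaximal hne
  obtain ⟨g, hg⟩ := exists_algHom_ker_eq (k := k) (RingHom.ker φ)
  refine ⟨g, fun a => ?_⟩
  have : a - algebraMap k A (g a) ∈ RingHom.ker φ := by
    rw [← hg]; simp [RingHom.mem_ker]
  rw [RingHom.mem_ker, map_sub, sub_eq_zero, AlgHom.commutes] at this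
  exact this

end Dense

/-! ### One-dimensional affine groups are commutative -/

section Commutative

variable {k : Type*} {A : Type*} [Field k] [IsAlgClosed k] [CommRing A] [IsDedekindDomain A]
  [HopfAlgebra k A] [Algebra.FiniteType k A]

/-- A class function is constant along the orbit map `g ↦ g⁻¹ h g`. In dimension one the orbit map
is then constant, and its value at the identity is `h`. -/
lemma pt_mul_comm_of_class_function (z : A) (hz : z ∉ (algebraMap k A).range)
    (hcl : ∀ g h : WithConv (A →ₐ[k] k), (g * h) z = (h * g) z)
    (g h : WithConv (A →ₐ[k] k)) : g * h = h * g := by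
  have hc : orbitPt h z = algebraMap k A (h z) := by
    refine eq_of_forall_pt (k := k) fun g => ?_
    have := apply_orbitPt (toConv g) h z
    rw [hcl, ← mul_assoc, mul_inv_cancel, one_mul] at this
    rw [AlgHom.commutes]
    exact this
  obtain ⟨g₀, hg₀⟩ := exists_pt_of_map_const (orbitPt h) z hz _ hc
  have h1 : ∀ g : WithConv (A →ₐ[k] k), ∀ a, (g⁻¹ * h * g) a = g₀ a := by
    intro g a
    rw [← apply_orbitPt, hg₀]
    exact g.ofConv.commutes _
  have h2 : g⁻¹ * h * g = h := by
    apply ofConv_injective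
    ext a
    have h3 := h1 1 a
    rw [inv_one, one_mul, mul_one] at h3
    exact (h1 g a).trans h3.symm
  calc g * h = g * (g⁻¹ * h * g) := by rw [h2]
    _ = h * g := by group

lemma conjPt_mul (g h : WithConv (A →ₐ[k] k)) (a : A) :
    conjPt (g * h) a = conjPt g (conjPt h a) := by
  refine eq_of_forall_pt (k := k) fun x => ?_
  have h1 := apply_conjPt (toConv x) (g * h) a
  have h2 := (apply_conjPt (toConv x) g (conjPt h a)).trans (apply_conjPt _ _ _)
  refine h1.trans (Eq.trans ?_ h2.symm)
  congr 1
  group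

lemma conjPt_one (a : A) : conjPt (1 : WithConv (A →ₐ[k] k)) a = a := by
  refine eq_of_forall_pt (k := k) fun x => ?_
  have h1 := apply_conjPt (toConv x) 1 a
  rw [inv_one, one_mul, mul_one] at h1
  exact h1

lemma counit_conjPt (h : WithConv (A →ₐ[k] k)) (a : A) :
    Coalgebra.counit (R := k) (conjPt h a) = Coalgebra.counit (R := k) a := by
  have h1 := apply_conjPt 1 h a
  rw [mul_one, inv_mul_cancel] at h1
  exact h1

variable (k A) in
/-- The augmentation ideal. -/
abbrev augIdeal : Ideal A := RingHom.ker (Bialgebra.counitAlgHom k A)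

lemma conjPt_mem_pow (h : WithConv (A →ₐ[k] k)) (j : ℕ) {a : A} (ha : a ∈ augIdeal k A ^ j) :
    conjPt h a ∈ augIdeal k A ^ j := by
  have h1 : augIdeal k A ≤ (augIdeal k A).comap (conjPt h) := by
    intro a ha
    rw [RingHom.mem_ker, Bialgebra.counitAlgHom_apply] at ha
    rw [Ideal.mem_comap, RingHom.mem_ker, Bialgebra.counitAlgHom_apply, counit_conjPt, ha]
  exact Ideal.le_comap_pow _ j (Ideal.pow_right_mono h1 j ha)

/-- Functions on a one-dimensional affine group satisfy `a(g h) = a(h g)`. -/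
theorem pt_mul_comm (z₀ : A) (hz₀ : z₀ ∉ (algebraMap k A).range)
    (g h : WithConv (A →ₐ[k] k)) : g * h = h * g := by
  by_contra hgh
  -- Under the assumption of noncommutativity every class function is constant. The rest of the
  -- proof manufactures class functions from the action by conjugation.
  have hclass : ∀ z : A, (∀ g h : WithConv (A →ₐ[k] k), (g * h) z = (h * g) z) →
      ∀ g : WithConv (A →ₐ[k] k), g z = (1 : WithConv (A →ₐ[k] k)) z := by
    intro z hz g'
    by_cases hr : z ∈ (algebraMap k A).range
    · obtain ⟨c, rfl⟩ := hr
      exact (g'.ofConv.commutes c).trans ((1 : WithConv (A →ₐ[k] k)).ofConv.commutes c).symm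
    · exact (hgh (pt_mul_comm_of_class_function z hr hz g h)).elim
  set m := augIdeal k A with hm
  have hmp : m.IsPrime := RingHom.ker_isPrime _
  have hεc : ∀ c : k, Coalgebra.counit (R := k) (algebraMap k A c) = c := fun c => by simp
  have hsub : ∀ a : A, a - algebraMap k A (Coalgebra.counit (R := k) a) ∈ m := by
    intro a
    simp [hm, RingHom.mem_ker]
  have hm0 : m ≠ ⊥ := by
    intro h0
    have := hsub z₀
    rw [h0, Ideal.mem_bot, sub_eq_zero] at this
    exact hz₀ ⟨_, this.symm⟩
  -- the action on the cotangent space is by a character, hence trivial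
  obtain ⟨t, htm, htm2⟩ := SetLike.exists_of_lt (Ideal.pow_succ_lt_pow hm0 1)
  rw [pow_one] at htm
  change t ∉ m ^ 2 at htm2
  have hcot : ∀ f ∈ m, ∃ c : k, f - c • t ∈ m ^ 2 := by
    intro f hf
    obtain ⟨d, e, he, hde⟩ := Ideal.exists_mul_add_mem_pow_succ hm0 (i := 1) t f
      (by rwa [pow_one]) htm2 (by rwa [pow_one])
    refine ⟨Coalgebra.counit (R := k) d, ?_⟩
    have : f - Coalgebra.counit (R := k) d • t =
        t * (d - algebraMap k A (Coalgebra.counit (R := k) d)) + e := by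
      rw [← hde, Algebra.smul_def]; ring
    rw [this]
    refine Ideal.add_mem _ ?_ he
    rw [pow_two]
    exact Ideal.mul_mem_mul htm (hsub d)
  obtain ⟨l, hlt, hl⟩ := Submodule.exists_le_ker_of_notMem
    (p := Submodule.restrictScalars k (m ^ 2 : Ideal A)) (v := t)
    (by rw [Submodule.restrictScalars_mem]; exact htm2)
  have hl0 : ∀ a ∈ m ^ 2, l a = 0 := fun a ha => hl ha
  obtain ⟨w, hw⟩ := exists_slice_eq_conjPt (k := k) t
  -- The functional `l` kills `m ^ 2` but not `t`, so `(l t)⁻¹ • l` reads off the coefficient of `t`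
  -- in the cotangent line.
  obtain ⟨γ, hγ⟩ := exists_eval_eq_slice ((l t)⁻¹ • l) w
  have hγ1 : ∀ g : WithConv (A →ₐ[k] k), conjPt g t - g γ • t ∈ m ^ 2 := by
    intro g
    obtain ⟨c, hc⟩ := hcot (conjPt g t) (by
      have := conjPt_mem_pow g 1 (a := t) (by rwa [pow_one]); rwa [pow_one] at this)
    have h1 := hγ g.ofConv
    rw [← hw] at h1
    have h2 := hl0 _ hc
    rw [map_sub, map_smul, sub_eq_zero] at h2
    have h3 : g γ = c := by
      refine h1.trans ?_
      rw [LinearMap.smul_apply, h2, smul_eq_mul, smul_eq_mul]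
      field_simp
    rwa [h3]
  have hγmul : ∀ g h : WithConv (A →ₐ[k] k), (g * h) γ = g γ * h γ := by
    intro g h
    have h1 := hγ1 (g * h)
    have h2 := conjPt_mem_pow g 2 (hγ1 h)
    have h3 := Ideal.mul_mem_left _ (algebraMap k A (h γ)) (hγ1 g)
    have h4 : (g γ * h γ - (g * h) γ) • t ∈ m ^ 2 := by
      have := Ideal.sub_mem _ h1 (Ideal.add_mem _ h2 h3)
      rw [conjPt_mul, map_sub, map_smul] at this
      convert this using 1
      simp only [Algebra.smul_def, map_sub, map_mul]
      ring
    have h5 := hl0 _ h4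
    rw [map_smul, smul_eq_mul, mul_eq_zero, or_iff_left hlt, sub_eq_zero] at h5
    exact h5.symm
  have hγ2 : ∀ g : WithConv (A →ₐ[k] k), g γ = 1 := by
    have h1 : ∀ g : WithConv (A →ₐ[k] k), g γ = (1 : WithConv (A →ₐ[k] k)) γ :=
      hclass γ fun g h => by rw [hγmul, hγmul, mul_comm]
    have h2 : (1 : WithConv (A →ₐ[k] k)) γ = 1 := by
      refine (hγ (1 : WithConv (A →ₐ[k] k)).ofConv).trans ?_
      rw [← hw, conjPt_one, LinearMap.smul_apply, smul_eq_mul, inv_mul_cancel₀ hlt]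
    intro g
    rw [h1, h2]
  have hgr1 : ∀ (g : WithConv (A →ₐ[k] k)), ∀ f ∈ m, conjPt g f - f ∈ m ^ 2 := by
    intro g f hf
    obtain ⟨c, hc⟩ := hcot f hf
    have h1 := hγ1 g
    rw [hγ2, one_smul] at h1
    have h2 := Ideal.sub_mem _ (Ideal.add_mem _ (conjPt_mem_pow g 2 hc)
      (Ideal.mul_mem_left _ (algebraMap k A c) h1)) hc
    convert h2 using 1
    simp only [map_sub, Algebra.smul_def, map_mul, AlgHom.commutes]
    ring
  -- hence the action on each graded piece is trivial
  have hgr : ∀ (g : WithConv (A →ₐ[k] k)) (j : ℕ), ∀ f ∈ m ^ j, conjPt g f - f ∈ m ^ (j + 1) := by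
    intro g j
    induction j with
    | zero =>
      intro f _
      rw [zero_add, pow_one, hm, RingHom.mem_ker, map_sub, Bialgebra.counitAlgHom_apply,
        Bialgebra.counitAlgHom_apply, counit_conjPt, sub_self]
    | succ j ih =>
      intro f hf
      rw [pow_succ'] at hf
      refine Submodule.mul_induction_on hf ?_ ?_
      · intro a ha b hb
        have : conjPt g (a * b) - a * b =
            (conjPt g a - a) * conjPt g b + a * (conjPt g b - b) := by
          rw [map_mul]; ring
        rw [this]
        refine Ideal.add_mem _ ?_ ?_
        · have := Ideal.mul_mem_mul (hgr1 g a ha) (conjPt_mem_pow g j hb)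
          rwa [← pow_add, show 2 + j = j + 1 + 1 by ring] at this
        · have := Ideal.mul_mem_mul ha (ih b hb)
          rwa [← pow_succ'] at this
      · intro x y hx hy
        have := Ideal.add_mem _ hx hy
        convert this using 1
        rw [map_add]; ring
  have hall : ∀ (j : ℕ) (g : WithConv (A →ₐ[k] k)) (f : A), conjPt g f - f ∈ m ^ j := by
    intro j
    induction j with
    | zero => intro g f; simp
    | succ j ih =>
      intro g f
      by_contra hnot
      obtain ⟨l, hlf, hl⟩ := Submodule.exists_le_ker_of_notMem
        (p := (m ^ (j + 1)).restrictScalars k) hnot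
      have hl0 : ∀ a ∈ m ^ (j + 1), l a = 0 := fun a ha => hl ha
      obtain ⟨w, hw⟩ := exists_slice_eq_conjPt (k := k) f
      obtain ⟨z, hz⟩ := exists_eval_eq_slice l w
      have hz' : ∀ g : WithConv (A →ₐ[k] k), g z = l (conjPt g f) := by
        intro g
        rw [hw]; exact hz g.ofConv
      -- Conjugation is trivial on `m ^ j / m ^ (j + 1)`, so modulo `m ^ (j + 1)` the difference
      -- `conjPt g f - f` is additive in `g`. Hence `z` is a class function.
      have hadd : ∀ g h : WithConv (A →ₐ[k] k), (g * h) z + l f = g z + h z := by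
        intro g h
        have h1 := hl0 _ (hgr g j _ (ih h f))
        rw [hz', hz', hz', conjPt_mul]
        simp only [map_sub] at h1
        linear_combination h1
      have h1 := hclass z (fun g h => by
        have e1 := hadd g h
        have e2 := hadd h g
        linear_combination e1 - e2) g
      rw [hz', hz', conjPt_one] at h1
      apply hlf
      rw [map_sub, h1, sub_self]
  have hconj : ∀ (g : WithConv (A →ₐ[k] k)) (f : A), conjPt g f = f := by
    intro g f
    rw [← sub_eq_zero, ← Ideal.mem_bot, ← Ideal.iInf_pow_eq_bot_of_isDomain m hmp.ne_top,
      Ideal.mem_iInf]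
    exact fun j => hall j g f
  apply hgh
  have : h⁻¹ * g * h = g := by
    apply ofConv_injective
    ext a
    have := apply_conjPt g h a
    rw [hconj] at this
    exact this.symm
  calc g * h = h * (h⁻¹ * g * h) := by group
    _ = h * g := by rw [this]

end Commutative

/-! ### Common eigenvectors of translations -/

/-- If some operator is not a scalar, one of its eigenspaces is proper, nonzero and stable under the
others. The induction is on a bound `d` for the dimension, since the space changes. -/
lemma exists_common_eigenvector {k : Type*} [Field k] [IsAlgClosed k] {ι : Type*} :
    ∀ (d : ℕ) {V : Type*} [AddCommGroup V] [Module k V] [FiniteDimensional k V] [Nontrivial V]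
      (T : ι → Module.End k V), Module.finrank k V ≤ d → (∀ i j, Commute (T i) (T j)) →
      ∃ v : V, v ≠ 0 ∧ ∀ i, ∃ c : k, T i v = c • v := by
  intro d
  induction d with
  | zero =>
    intro V _ _ _ _ T hd
    have := Module.finrank_pos (R := k) (M := V)
    omega
  | succ d ih =>
    intro V _ _ _ _ T hd hT
    by_cases hs : ∀ i, ∃ c : k, ∀ v, T i v = c • v
    · obtain ⟨v, hv⟩ := exists_ne (0 : V)
      exact ⟨v, hv, fun i => (hs i).imp fun c hc => hc v⟩
    · push Not at hs
      obtain ⟨i, hi⟩ := hs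
      obtain ⟨c, hc⟩ := Module.End.exists_eigenvalue (T i)
      let E := (T i).eigenspace c
      have hEtop : E < ⊤ := by
        rw [lt_top_iff_ne_top]
        intro h
        obtain ⟨v, hv⟩ := hi c
        exact hv (Module.End.mem_eigenspace_iff.1 (h ▸ Submodule.mem_top : v ∈ E))
      have hst : ∀ j, ∀ v ∈ E, T j v ∈ E := by
        intro j v hv
        rw [Module.End.mem_eigenspace_iff] at hv ⊢
        have := LinearMap.congr_fun (hT i j) v
        rw [Module.End.mul_apply, Module.End.mul_apply, hv, map_smul] at this
        exact this
      have : Nontrivial E := Submodule.nontrivial_iff_ne_bot.2 hc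
      obtain ⟨v, hv, h⟩ := ih (V := E) (fun j => (T j).restrict (hst j))
        (by have := Submodule.finrank_lt hEtop.ne; omega)
        (fun a b => by
          ext v
          have := LinearMap.congr_fun (hT a b) (v : V)
          simpa using this)
      refine ⟨v, by simpa using hv, fun j => (h j).imp fun c hc => ?_⟩
      simpa using congrArg Subtype.val hc

/-! ### Translation of functions: multiplicative, additive and semi-invariant functions -/

section Translation

variable {k : Type*} {A : Type*} [Field k] [IsAlgClosed k] [CommRing A] [IsDedekindDomain A]
  [HopfAlgebra k A] [Algebra.FiniteType k A]

lemma rTrans_eq_slice (h : WithConv (A →ₐ[k] k)) (a : A) :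
    rTrans h a = slice h.ofConv (Coalgebra.comul (R := k) a) := by
  change (genPt * constPt h : WithConv (A →ₐ[k] A)) a = _
  rw [AlgHom.convMul_apply]
  rfl

lemma rTrans_mul (g h : WithConv (A →ₐ[k] k)) (a : A) :
    rTrans (g * h) a = rTrans g (rTrans h a) := by
  refine eq_of_forall_pt (k := k) fun x => ?_
  have h1 := apply_rTrans (toConv x) (g * h) a
  have h2 := (apply_rTrans (toConv x) g (rTrans h a)).trans (apply_rTrans _ _ _)
  refine h1.trans (Eq.trans ?_ h2.symm)
  rw [mul_assoc]

lemma rTrans_one (a : A) : rTrans (1 : WithConv (A →ₐ[k] k)) a = a := by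
  refine eq_of_forall_pt (k := k) fun x => ?_
  have h1 := apply_rTrans (toConv x) 1 a
  rw [mul_one] at h1
  exact h1

/-- Applied to a comultiplication, this is the local finiteness of the translation action. -/
lemma exists_fg_slice_mem (w : A ⊗[k] A) :
    ∃ S : Submodule k A, S.FG ∧ ∀ h : A →ₐ[k] k, slice h w ∈ S := by
  induction w with
  | zero => exact ⟨⊥, Submodule.fg_bot, by simp⟩
  | tmul a b =>
    refine ⟨Submodule.span k {a}, Submodule.fg_span_singleton a, fun h => ?_⟩
    rw [slice_tmul]
    exact Submodule.smul_mem _ _ (Submodule.mem_span_singleton_self a)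
  | add x y hx hy =>
    obtain ⟨S, hS, h1⟩ := hx
    obtain ⟨S', hS', h2⟩ := hy
    refine ⟨S ⊔ S', hS.sup hS', fun h => ?_⟩
    rw [map_add]
    exact Submodule.add_mem_sup (h1 h) (h2 h)

lemma exists_eval_eq_rTrans (l : A →ₗ[k] k) (a : A) :
    ∃ z : A, ∀ h : WithConv (A →ₐ[k] k), h z = l (rTrans h a) := by
  obtain ⟨z, hz⟩ := exists_eval_eq_slice l (Coalgebra.comul (R := k) a)
  exact ⟨z, fun h => (hz h.ofConv).trans (by rw [rTrans_eq_slice])⟩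

variable (k) in
/-- A function that is multiplicative on points. -/
def IsMultFun (γ : A) : Prop :=
  (∀ g h : WithConv (A →ₐ[k] k), (g * h) γ = g γ * h γ) ∧ (1 : WithConv (A →ₐ[k] k)) γ = 1

variable (k) in
/-- A function that is additive on points. -/
def IsAddFun (z : A) : Prop :=
  ∀ g h : WithConv (A →ₐ[k] k), (g * h) z = g z + h z

lemma IsMultFun.rTrans {γ : A} (hγ : IsMultFun k γ) (h : WithConv (A →ₐ[k] k)) :
    rTrans h γ = h γ • γ := by
  refine eq_of_forall_pt (k := k) fun x => ?_
  refine (apply_rTrans (toConv x) h γ).trans ((hγ.1 _ _).trans ?_)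
  rw [map_smul, smul_eq_mul, mul_comm]

lemma IsAddFun.rTrans {z : A} (hz : IsAddFun k z) (h : WithConv (A →ₐ[k] k)) :
    rTrans h z = z + algebraMap k A (h z) := by
  refine eq_of_forall_pt (k := k) fun x => ?_
  refine (apply_rTrans (toConv x) h z).trans ((hz _ _).trans ?_)
  rw [map_add, AlgHom.commutes]
  rfl

/-- The identity `Δ(γ) = γ ⊗ γ` can be tested on slices, where it says how translations act on `γ`.
-/
lemma isMultFun_iff {γ : A} : IsMultFun k γ ↔ IsGroupLikeElem k γ := by
  constructor
  · intro hγ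
    refine ⟨hγ.2, ?_⟩
    rw [← sub_eq_zero]
    refine tensor_eq_zero_of_forall_slice _ fun h => ?_
    rw [map_sub, slice_tmul, sub_eq_zero]
    exact (rTrans_eq_slice (toConv h) γ).symm.trans (hγ.rTrans (toConv h))
  · intro hγ
    refine ⟨fun g h => ?_, hγ.counit_eq_one⟩
    rw [← apply_rTrans, rTrans_eq_slice, hγ.comul_eq_tmul_self, slice_tmul]
    exact (map_smul g.ofConv _ _).trans (mul_comm _ _)

lemma IsAddFun.comul_eq {z : A} (hz : IsAddFun k z) :
    Coalgebra.comul (R := k) z = z ⊗ₜ[k] (1 : A) + (1 : A) ⊗ₜ[k] z := by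
  rw [← sub_eq_zero]
  refine tensor_eq_zero_of_forall_slice _ fun h => ?_
  rw [map_sub, map_add, slice_tmul, slice_tmul, sub_eq_zero]
  refine (rTrans_eq_slice (toConv h) z).symm.trans ((hz.rTrans (toConv h)).trans ?_)
  rw [map_one, one_smul, Algebra.algebraMap_eq_smul_one]

lemma IsMultFun.exists_inv {γ : A} (hγ : IsMultFun k γ) : ∃ γ', IsMultFun k γ' ∧ γ * γ' = 1 := by
  rw [isMultFun_iff] at hγ
  exact ⟨HopfAlgebra.antipode k γ, isMultFun_iff.2 hγ.antipode, hγ.mul_antipode_cancel⟩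

lemma IsMultFun.ne_zero {γ : A} (hγ : IsMultFun k γ) : γ ≠ 0 := by
  rintro rfl
  have := hγ.2
  rw [one_apply_pt, map_zero] at this
  exact zero_ne_one this

variable (k) in
lemma isMultFun_one : IsMultFun k (1 : A) := isMultFun_iff.2 .one

lemma IsMultFun.notMem_range {γ : A} (hγ : IsMultFun k γ) (h1 : γ ≠ 1) :
    γ ∉ (algebraMap k A).range := by
  rintro ⟨c, rfl⟩
  have := hγ.2
  rw [one_apply_pt, Bialgebra.counit_algebraMap] at this
  exact h1 (by rw [this, map_one])

lemma IsAddFun.one_apply {z : A} (hz : IsAddFun k z) : (1 : WithConv (A →ₐ[k] k)) z = 0 := by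
  have := hz 1 1
  rw [mul_one] at this
  exact left_eq_add.1 this

lemma IsAddFun.notMem_range {z : A} (hz : IsAddFun k z) (h0 : z ≠ 0) :
    z ∉ (algebraMap k A).range := by
  rintro ⟨c, rfl⟩
  have := hz.one_apply
  rw [one_apply_pt, Bialgebra.counit_algebraMap] at this
  exact h0 (by rw [this, map_zero])

/-- Modulo a proper translation-stable subspace there is a semi-invariant, whose character is a
regular function. -/
lemma exists_semiinvariant (hcomm : ∀ g h : WithConv (A →ₐ[k] k), g * h = h * g)
    (U : Submodule k A) (hU : ∀ h : WithConv (A →ₐ[k] k), ∀ a ∈ U, rTrans h a ∈ U)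
    (hne : U ≠ ⊤) :
    ∃ a ∉ U, ∃ γ : A, IsMultFun k γ ∧
      ∀ h : WithConv (A →ₐ[k] k), rTrans h a - h γ • a ∈ U := by
  obtain ⟨a₀, -, ha₀⟩ := SetLike.exists_of_lt (lt_top_iff_ne_top.2 hne)
  -- The span of the translates of `a₀` is stable and finite-dimensional. Its image in `A ⧸ U` is
  -- nonzero, and the translations commute on it, so they have a common eigenvector.
  let W := Submodule.span k (Set.range fun h : WithConv (A →ₐ[k] k) => rTrans h a₀)
  have hWfg : FiniteDimensional k W := by
    obtain ⟨S, hS, h1⟩ := exists_fg_slice_mem (Coalgebra.comul (R := k) a₀)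
    have : FiniteDimensional k S := Module.Finite.iff_fg.2 hS
    refine Submodule.finiteDimensional_of_le (S₂ := S) ?_
    rw [Submodule.span_le]
    rintro _ ⟨h, rfl⟩
    change rTrans h a₀ ∈ S
    rw [rTrans_eq_slice]
    exact h1 _
  have hWst : ∀ h : WithConv (A →ₐ[k] k), ∀ a ∈ W, rTrans h a ∈ W := by
    intro h a ha
    induction ha using Submodule.span_induction with
    | mem x hx =>
      obtain ⟨g, rfl⟩ := hx
      refine Submodule.subset_span ⟨h * g, rTrans_mul h g a₀⟩
    | zero => simp
    | add x y _ _ hx hy => rw [map_add]; exact W.add_mem hx hy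
    | smul c x _ hx => rw [map_smul]; exact W.smul_mem c hx
  let T : WithConv (A →ₐ[k] k) → Module.End k (A ⧸ U) :=
    fun h => U.mapQ U (rTrans h).toLinearMap (fun a ha => hU h a ha)
  let V := W.map U.mkQ
  have hVst : ∀ h, ∀ v ∈ V, T h v ∈ V := by
    rintro h _ ⟨a, ha, rfl⟩
    exact ⟨rTrans h a, hWst h a ha, rfl⟩
  have hVnt : Nontrivial V := by
    refine ⟨⟨⟨U.mkQ a₀, a₀, Submodule.subset_span ⟨1, rTrans_one a₀⟩, rfl⟩, 0, ?_⟩⟩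
    intro h
    have := congrArg Subtype.val h
    simp only [Submodule.mkQ_apply, ZeroMemClass.coe_zero, Submodule.Quotient.mk_eq_zero] at this
    exact ha₀ this
  obtain ⟨v, hv0, hv⟩ := exists_common_eigenvector (k := k) _ (V := V)
    (fun h => (T h).restrict (hVst h)) le_rfl (fun g h => by
      ext ⟨v, a, ha, rfl⟩
      change U.mkQ (rTrans g (rTrans h a)) = U.mkQ (rTrans h (rTrans g a))
      rw [← rTrans_mul, ← rTrans_mul, hcomm])
  obtain ⟨_, a, ha, rfl⟩ := v
  have haU : a ∉ U := by
    intro h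
    exact hv0 (Subtype.ext ((Submodule.Quotient.mk_eq_zero U).2 h))
  choose χ hχ using hv
  have hχ' : ∀ h, rTrans h a - χ h • a ∈ U := by
    intro h
    have h1 := congrArg Subtype.val (hχ h)
    have h2 : U.mkQ (rTrans h a) = U.mkQ (χ h • a) := by rw [map_smul]; exact h1
    exact (Submodule.Quotient.eq U).1 h2
  obtain ⟨l, hla, hl⟩ := Submodule.exists_le_ker_of_notMem haU
  have hl0 : ∀ u ∈ U, l u = 0 := fun u hu => hl hu
  -- The eigenvalue at `h` is a matrix coefficient of translation, hence a regular function of `h`.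
  obtain ⟨γ, hγ⟩ := exists_eval_eq_rTrans ((l a)⁻¹ • l) a
  have hγχ : ∀ h : WithConv (A →ₐ[k] k), h γ = χ h := by
    intro h
    have h1 := hl0 _ (hχ' h)
    rw [map_sub, map_smul, sub_eq_zero] at h1
    rw [hγ, LinearMap.smul_apply, h1, smul_eq_mul, smul_eq_mul]
    field_simp
  refine ⟨a, haU, γ, ⟨fun g h => ?_, ?_⟩, fun h => by rw [hγχ]; exact hχ' h⟩
  · have h1 := hl0 _ (U.sub_mem (hχ' (g * h)) (U.add_mem (hU g _ (hχ' h))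
      (U.smul_mem (χ h) (hχ' g))))
    rw [rTrans_mul] at h1
    simp only [map_sub, map_add, map_smul, smul_eq_mul] at h1
    rw [hγχ, hγχ, hγχ]
    have h2 : (χ g * χ h - χ (g * h)) * l a = 0 := by linear_combination h1
    rcases mul_eq_zero.1 h2 with h3 | h3
    · exact (sub_eq_zero.1 h3).symm
    · exact (hla h3).elim
  · rw [hγ, rTrans_one, LinearMap.smul_apply, smul_eq_mul, inv_mul_cancel₀ hla]

/-- A function whose translates differ from it by constants is additive up to a constant. -/
lemma isAddFun_sub_counit {a : A} (ha : ∀ h : WithConv (A →ₐ[k] k),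
    rTrans h a - a ∈ Submodule.span k {(1 : A)}) :
    IsAddFun k (a - algebraMap k A ((1 : WithConv (A →ₐ[k] k)) a)) := by
  have h1 : ∀ g h : WithConv (A →ₐ[k] k), (g * h) a - g a = h a - (1 : WithConv (A →ₐ[k] k)) a := by
    intro g h
    obtain ⟨c, hc⟩ := Submodule.mem_span_singleton.1 (ha h)
    have h2 : ∀ x : WithConv (A →ₐ[k] k), (x * h) a - x a = c := by
      intro x
      rw [← apply_rTrans]
      have := congrArg x.ofConv hc
      rw [map_smul, map_one, map_sub, smul_eq_mul, mul_one] at this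
      exact this.symm
    have h3 := h2 1
    rw [one_mul] at h3
    rw [h2, h3]
  intro g h
  have h2 : ∀ (x : WithConv (A →ₐ[k] k)) (c : k), x (a - algebraMap k A c) = x a - c := by
    intro x c
    exact (map_sub x.ofConv _ _).trans (by rw [AlgHom.commutes]; rfl)
  rw [h2, h2, h2]
  linear_combination h1 g h

end Translation

/-! ### Algebraic relations and their translates -/

/-- The relation `P(a, b) = 0` for a polynomial `P` in two variables. -/
def Rel {k A : Type*} [Field k] [CommRing A] [Algebra k A] (a b : A) (P : k[X][X]) : Prop :=
  P.eval₂ (aeval a : k[X] →ₐ[k] A).toRingHom b = 0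

/-- Any two elements are algebraically dependent over `k`. -/
def AlgDep (k A : Type*) [Field k] [CommRing A] [Algebra k A] : Prop :=
  ∀ a b : A, ∃ P : k[X][X], P ≠ 0 ∧ Rel a b P

/-- A relation of least degree in the second variable. It serves as the minimal polynomial of `b`
over `k(a)`, without passing to fractions. -/
lemma AlgDep.exists_minimal {k A : Type*} [Field k] [CommRing A] [Algebra k A] (h : AlgDep k A)
    (a b : A) : ∃ P : k[X][X], P ≠ 0 ∧ Rel a b P ∧
      ∀ Q : k[X][X], Rel a b Q → Q.natDegree < P.natDegree → Q = 0 := by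
  classical
  have hex : ∃ d : ℕ, ∃ P : k[X][X], P ≠ 0 ∧ Rel a b P ∧ P.natDegree = d := by
    obtain ⟨P, h0, h1⟩ := h a b
    exact ⟨_, P, h0, h1, rfl⟩
  obtain ⟨P, h0, h1, h2⟩ := Nat.find_spec hex
  refine ⟨P, h0, h1, fun Q hQ hlt => ?_⟩
  by_contra hne
  exact Nat.find_min hex (h2 ▸ hlt) ⟨Q, hne, hQ, rfl⟩

lemma natDegree_lt_of_coeff_eq_zero {R : Type*} [Semiring R] {Q : R[X]} {r : ℕ} (hr : r ≠ 0)
    (h : ∀ m, r ≤ m → Q.coeff m = 0) : Q.natDegree < r := by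
  by_contra hlt
  have h1 := h _ (not_lt.1 hlt)
  rw [coeff_natDegree, leadingCoeff_eq_zero] at h1
  rw [h1, natDegree_zero] at hlt
  omega

/-- Over an algebraically closed field `p` splits, and in a domain one of the factors `x - c` must
vanish. -/
lemma mem_range_of_aeval_eq_zero {k A : Type*} [Field k] [IsAlgClosed k] [CommRing A] [IsDomain A]
    [Algebra k A] {x : A} {p : k[X]} (hp : p ≠ 0) (h : aeval x p = 0) :
    x ∈ (algebraMap k A).range := by
  rw [(IsAlgClosed.splits p).eq_prod_roots, map_mul, aeval_C, map_multiset_prod,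
    Multiset.map_map] at h
  rcases mul_eq_zero.1 h with h | h
  · rw [map_eq_zero_iff _ (FaithfulSMul.algebraMap_injective k A), leadingCoeff_eq_zero] at h
    exact (hp h).elim
  · obtain ⟨c, -, hc⟩ := Multiset.mem_map.1 (Multiset.prod_eq_zero_iff.1 h)
    simp only [Function.comp_apply, map_sub, aeval_X, aeval_C, sub_eq_zero] at hc
    exact ⟨c, hc.symm⟩

lemma aeval_injective_of_notMem_range {k A : Type*} [Field k] [IsAlgClosed k] [CommRing A]
    [IsDomain A] [Algebra k A] {x : A} (hx : x ∉ (algebraMap k A).range) :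
    Function.Injective (aeval x : k[X] →ₐ[k] A) := by
  rw [injective_iff_map_eq_zero]
  intro p hp
  by_contra h0
  exact hx (mem_range_of_aeval_eq_zero h0 hp)

/-! ### Multiplicative functions span as soon as one is nontrivial -/

section Multiplicative

variable {k : Type*} {A : Type*} [Field k] [IsAlgClosed k] [CommRing A] [IsDedekindDomain A]
  [HopfAlgebra k A] [Algebra.FiniteType k A]

lemma IsAddFun.rTrans_aeval {x : A} (hx : IsAddFun k x) (h : WithConv (A →ₐ[k] k)) (p : k[X]) :
    HopfGK.rTrans h (aeval x p) = aeval x (taylor (h x) p) := by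
  rw [← aeval_algHom_apply, hx.rTrans, taylor_apply, aeval_comp]
  simp

lemma rTrans_eval₂ (x y : A) (hx : IsAddFun k x) (h : WithConv (A →ₐ[k] k)) (P : k[X][X]) :
    rTrans h (P.eval₂ (aeval x : k[X] →ₐ[k] A).toRingHom y) =
      (P.map (taylorAlgHom (h x)).toRingHom).eval₂ (aeval x : k[X] →ₐ[k] A).toRingHom
        (rTrans h y) := by
  rw [eval₂_map]
  refine (hom_eval₂ P _ (rTrans h).toRingHom y).trans ?_
  congr 1
  ext p
  · simp
  · have := hx.rTrans_aeval h X
    simp only [aeval_X] at this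
    simpa using this

/-- A nontrivial multiplicative function and a nonzero additive function are algebraically
independent. -/
lemma not_isAddFun_of_isMultFun (hdep : AlgDep k A) {y z : A} (hy : IsMultFun k y) (hy1 : y ≠ 1)
    (hz : IsAddFun k z) : z = 0 := by
  by_contra hz0
  have hzr := hz.notMem_range hz0
  have hinj := aeval_injective_of_notMem_range (k := k) hzr
  obtain ⟨P, hP0, hP, hmin⟩ := hdep.exists_minimal z y
  set r := P.natDegree with hr
  have hr0 : r ≠ 0 := by
    intro h0
    rw [eq_C_of_natDegree_eq_zero (hr.symm.trans h0), Rel, eval₂_C] at hP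
    have h1 : P.coeff 0 = 0 := hinj (hP.trans (map_zero _).symm)
    apply hP0
    rw [eq_C_of_natDegree_eq_zero (hr.symm.trans h0), h1, C_0]
  -- Otherwise the relation is divisible by `Y`, and cancelling the nonzero factor `y` lowers its
  -- degree.
  have hc0 : P.coeff 0 ≠ 0 := by
    intro h0
    have h1 : P = X * P.divX := by
      conv_lhs => rw [← X_mul_divX_add P, h0, C_0, add_zero]
    have h2 : Rel z y P.divX := by
      rw [h1, Rel, eval₂_mul, eval₂_X] at hP
      exact (mul_eq_zero.1 hP).resolve_left hy.ne_zero
    have h3 := hmin _ h2 (by rw [natDegree_divX_eq_natDegree_tsub_one]; omega)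
    rw [h3, mul_zero] at h1
    exact hP0 h1
  have hlc : P.coeff r ≠ 0 := by rwa [hr, coeff_natDegree, leadingCoeff_ne_zero]
  -- Translation by `h` replaces `z` by `z + s` and `y` by `c y`, giving a second relation `P'`.
  -- Eliminating the top coefficient between `P` and `P'` leaves a relation of smaller degree, hence
  -- zero. Its constant term, compared by leading coefficients in `z`, gives `c ^ r = 1`.
  have hpow : ∀ h : WithConv (A →ₐ[k] k), (h y) ^ r = 1 := by
    intro h
    set s := h z
    set c := h y
    let τ : k[X] →+* k[X] := (taylorAlgHom s).toRingHom
    let P' : k[X][X] := (P.map τ).comp (C (C c) * X)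
    have hcoe : ∀ i, P'.coeff i = taylor s (P.coeff i) * C c ^ i := by
      intro i
      rw [comp_C_mul_X_coeff, coeff_map]
      rfl
    have hP' : Rel z y P' := by
      have := congrArg (rTrans h) hP
      rw [map_zero, rTrans_eval₂ z y hz, hy.rTrans] at this
      rw [Rel, eval₂_comp, eval₂_mul, eval₂_X, eval₂_C]
      convert this using 2
      simp [Algebra.smul_def, c]
    let Q : k[X][X] := C (P.coeff r) * P' - C (C c ^ r * taylor s (P.coeff r)) * P
    have hQ : Rel z y Q := by
      rw [Rel] at hP hP' ⊢
      rw [eval₂_sub, eval₂_mul, eval₂_mul, hP, hP', mul_zero, mul_zero, sub_zero]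
    have hQdeg : Q.natDegree < r := by
      refine natDegree_lt_of_coeff_eq_zero hr0 fun m hm => ?_
      rcases hm.eq_or_lt with rfl | hm
      · simp only [Q, coeff_sub, coeff_C_mul, hcoe]
        ring
      · have h1 : P.coeff m = 0 := coeff_eq_zero_of_natDegree_lt hm
        simp only [Q, coeff_sub, coeff_C_mul, hcoe, h1]
        simp
    have h0 := congrArg (fun R => coeff R 0) (hmin Q hQ hQdeg)
    simp only [Q, coeff_sub, coeff_C_mul, hcoe, coeff_zero, pow_zero, mul_one, sub_eq_zero] at h0
    have h1 := congrArg leadingCoeff h0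
    rw [leadingCoeff_mul, leadingCoeff_mul, leadingCoeff_mul, leadingCoeff_taylor,
      leadingCoeff_taylor, ← C_pow, leadingCoeff_C] at h1
    have h2 : (P.coeff r).leadingCoeff * (P.coeff 0).leadingCoeff ≠ 0 :=
      mul_ne_zero (leadingCoeff_ne_zero.2 hlc) (leadingCoeff_ne_zero.2 hc0)
    apply mul_right_cancel₀ h2
    linear_combination -h1
  refine hy.notMem_range hy1 (mem_range_of_aeval_eq_zero (p := X ^ r - C 1) ?_ ?_)
  · exact X_pow_sub_C_ne_zero (Nat.pos_of_ne_zero hr0) 1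
  · rw [map_sub, map_pow, aeval_X, C_1, map_one, sub_eq_zero]
    refine eq_of_forall_pt (k := k) fun g => ?_
    rw [map_pow, map_one]
    exact hpow (toConv g)

/-- Removing the components of a one-cocycle at nontrivial characters. -/
lemma exists_sub_trivial_cocycle (hcomm : ∀ g h : WithConv (A →ₐ[k] k), g * h = h * g)
    (S : Finset A) (hS : ∀ γ ∈ S, IsMultFun k γ) :
    ∀ a : A, (∀ h : WithConv (A →ₐ[k] k),
        rTrans h a - a ∈ Submodule.span k (insert 1 (S : Set A))) →
      ∃ u ∈ Submodule.span k {γ : A | IsMultFun k γ}, ∀ h : WithConv (A →ₐ[k] k),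
        rTrans h (a - u) - (a - u) ∈ Submodule.span k {(1 : A)} := by
  classical
  induction S using Finset.induction_on with
  | empty =>
    intro a ha
    refine ⟨0, Submodule.zero_mem _, fun h => ?_⟩
    simpa using ha h
  | insert γ S hγS ih =>
    intro a ha
    have hSm : ∀ γ ∈ S, IsMultFun k γ := fun x hx => hS x (Finset.mem_insert_of_mem hx)
    have hγ : IsMultFun k γ := hS γ (Finset.mem_insert_self _ _)
    have hins : insert (1 : A) ((insert γ S : Finset A) : Set A) =
        insert γ (insert 1 (S : Set A)) := by
      rw [Finset.coe_insert, Set.insert_comm]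
    rw [hins] at ha
    set U := Submodule.span k (insert 1 (S : Set A)) with hU
    by_cases hmem : γ ∈ U
    · refine ih hSm a fun h => ?_
      have := ha h
      rwa [Submodule.span_insert_eq_span hmem] at this
    have hUst : ∀ (g : WithConv (A →ₐ[k] k)), ∀ u ∈ U, rTrans g u ∈ U := by
      intro g u hu
      induction hu using Submodule.span_induction with
      | mem x hx =>
        have hxm : IsMultFun k x := by
          rcases hx with rfl | hx
          · exact isMultFun_one k
          · exact hSm x hx
        rw [hxm.rTrans]
        exact U.smul_mem _ (Submodule.subset_span hx)
      | zero => simp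
      | add x y _ _ hx hy => rw [map_add]; exact U.add_mem hx hy
      | smul c x _ hx => rw [map_smul]; exact U.smul_mem c hx
    obtain ⟨l, hlγ, hl⟩ := Submodule.exists_le_ker_of_notMem hmem
    have hl0 : ∀ u ∈ U, l u = 0 := fun u hu => hl hu
    have hc : ∀ h : WithConv (A →ₐ[k] k), ∃ c : k, rTrans h a - a - c • γ ∈ U := by
      intro h
      obtain ⟨c, u, hu, hcu⟩ := Submodule.mem_span_insert.1 (ha h)
      refine ⟨c, ?_⟩
      rw [hcu, add_sub_cancel_left]
      exact hu
    choose c hc using hc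
    have hcoc : ∀ g h : WithConv (A →ₐ[k] k), c (g * h) = c g + g γ * c h := by
      intro g h
      have h1 := hl0 _ (U.sub_mem (hc (g * h)) (U.add_mem (hUst g _ (hc h)) (hc g)))
      rw [rTrans_mul] at h1
      simp only [map_sub, map_add, map_smul, hγ.rTrans, smul_eq_mul] at h1
      have h2 : (c g + g γ * c h - c (g * h)) * l γ = 0 := by linear_combination h1
      rcases mul_eq_zero.1 h2 with h3 | h3
      · exact (sub_eq_zero.1 h3).symm
      · exact (hlγ h3).elim
    have hγ1 : ∃ h₀ : WithConv (A →ₐ[k] k), h₀ γ ≠ 1 := by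
      by_contra hcon
      push Not at hcon
      apply hmem
      have : γ = 1 := eq_of_forall_pt (k := k) fun g => (hcon (toConv g)).trans (map_one g).symm
      rw [this]
      exact Submodule.subset_span (Set.mem_insert _ _)
    obtain ⟨h₀, hh₀⟩ := hγ1
    have hh₀' : h₀ γ - 1 ≠ 0 := sub_ne_zero.2 hh₀
    set κ := c h₀ / (h₀ γ - 1)
    -- Expanding `c (g * h₀) = c (h₀ * g)` in both orders, with `γ(h₀) ≠ 1`, shows that the cocycle
    -- `c` is a coboundary. Subtracting `κ • γ` from `a` therefore removes its `γ`-component.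
    have hcκ : ∀ g : WithConv (A →ₐ[k] k), c g = κ * (g γ - 1) := by
      intro g
      have h1 := hcoc g h₀
      rw [hcomm, hcoc] at h1
      simp only [κ]
      field_simp
      linear_combination h1
    obtain ⟨u, hu, hau⟩ := ih hSm (a - κ • γ) (fun h => by
      have h1 := hc h
      rw [hcκ] at h1
      rw [map_sub, map_smul, hγ.rTrans]
      convert h1 using 1
      module)
    refine ⟨κ • γ + u, Submodule.add_mem _ (Submodule.smul_mem _ _ (Submodule.subset_span hγ)) hu,
      fun h => ?_⟩
    have := hau h
    rwa [sub_sub] at this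

lemma span_isMultFun_stable (h : WithConv (A →ₐ[k] k)) (a : A)
    (ha : a ∈ Submodule.span k {γ : A | IsMultFun k γ}) :
    rTrans h a ∈ Submodule.span k {γ : A | IsMultFun k γ} := by
  induction ha using Submodule.span_induction with
  | mem x hx =>
    rw [IsMultFun.rTrans hx]
    exact Submodule.smul_mem _ _ (Submodule.subset_span hx)
  | zero => simp
  | add x y _ _ hx hy => rw [map_add]; exact Submodule.add_mem _ hx hy
  | smul c x _ hx => rw [map_smul]; exact Submodule.smul_mem _ c hx

lemma mul_mem_span_isMultFun {γ : A} (hγ : IsMultFun k γ) (a : A)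
    (ha : a ∈ Submodule.span k {γ : A | IsMultFun k γ}) :
    γ * a ∈ Submodule.span k {γ : A | IsMultFun k γ} := by
  induction ha using Submodule.span_induction with
  | mem x hx =>
    exact Submodule.subset_span (isMultFun_iff.2 ((isMultFun_iff.1 hγ).mul (isMultFun_iff.1 hx)))
  | zero => simp
  | add x y _ _ hx hy => rw [mul_add]; exact Submodule.add_mem _ hx hy
  | smul c x _ hx => rw [mul_smul_comm]; exact Submodule.smul_mem _ c hx

lemma exists_finset_of_fg_le_span {S : Set A} {V : Submodule k A} (hV : V.FG)
    (h : V ≤ Submodule.span k S) : ∃ F : Finset A, (F : Set A) ⊆ S ∧ V ≤ Submodule.span k F := by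
  classical
  obtain ⟨T, rfl⟩ := hV
  have h1 : ∀ t : A, ∃ F : Finset A, (F : Set A) ⊆ S ∧ (t ∈ T → t ∈ Submodule.span k (F : Set A)) := by
    intro t
    by_cases ht : t ∈ T
    · obtain ⟨F, hF, hF'⟩ := Submodule.mem_span_finite_of_mem_span (h (Submodule.subset_span ht))
      exact ⟨F, hF, fun _ => hF'⟩
    · exact ⟨∅, by simp, fun h => (ht h).elim⟩
  choose F hF hF' using h1
  refine ⟨T.biUnion F, ?_, ?_⟩
  · simp only [Finset.coe_biUnion, Set.iUnion_subset_iff]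
    exact fun t _ => hF t
  · rw [Submodule.span_le]
    intro t ht
    refine Submodule.span_mono ?_ (hF' t ht)
    exact_mod_cast Finset.subset_biUnion_of_mem F ht

/-- If there is a nontrivial multiplicative function, multiplicative functions span. -/
lemma span_isMultFun_eq_top (hcomm : ∀ g h : WithConv (A →ₐ[k] k), g * h = h * g)
    (hdep : AlgDep k A) {y : A} (hy : IsMultFun k y) (hy1 : y ≠ 1) :
    Submodule.span k {γ : A | IsMultFun k γ} = ⊤ := by
  by_contra hne
  set U := Submodule.span k {γ : A | IsMultFun k γ} with hU
  obtain ⟨a₀, ha₀, γ₀, hγ₀, ha⟩ := exists_semiinvariant hcomm U span_isMultFun_stable hne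
  obtain ⟨γ₁, hγ₁, hinv⟩ := hγ₀.exists_inv
  -- Dividing by the character `γ₀` makes the semi-invariant invariant modulo `U`.
  set a := γ₁ * a₀ with hadef
  have haU : a ∉ U := by
    intro h
    apply ha₀
    have := mul_mem_span_isMultFun hγ₀ _ h
    rwa [hadef, ← mul_assoc, hinv, one_mul] at this
  have hat : ∀ h : WithConv (A →ₐ[k] k), rTrans h a - a ∈ U := by
    intro h
    have h1 : h γ₁ * h γ₀ = 1 := by
      have := congrArg h.ofConv hinv
      rw [map_mul, map_one] at this
      rw [mul_comm]; exact this
    have h2 := U.smul_mem (h γ₁) (mul_mem_span_isMultFun hγ₁ _ (ha h))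
    convert h2 using 1
    rw [hadef, map_mul, hγ₁.rTrans, mul_sub, smul_sub, mul_smul_comm, smul_smul, h1, one_smul,
      smul_mul_assoc]
  -- All differences `rTrans h a - a` lie in one finite-dimensional subspace, so only finitely many
  -- characters occur in them.
  obtain ⟨T, hT, hT'⟩ := exists_fg_slice_mem (Coalgebra.comul (R := k) a - a ⊗ₜ[k] (1 : A))
  have hT'' : ∀ h : WithConv (A →ₐ[k] k), rTrans h a - a ∈ T ⊓ U := by
    intro h
    refine ⟨?_, hat h⟩
    have := hT' h.ofConv
    rwa [map_sub, slice_tmul, map_one, one_smul, ← rTrans_eq_slice] at this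
  have hTU : (T ⊓ U).FG := by
    have : FiniteDimensional k T := Module.Finite.iff_fg.2 hT
    have : FiniteDimensional k (T ⊓ U : Submodule k A) :=
      Submodule.finiteDimensional_of_le inf_le_left
    exact Module.Finite.iff_fg.1 this
  obtain ⟨S, hS, hS'⟩ := exists_finset_of_fg_le_span hTU inf_le_right
  obtain ⟨u, hu, hau⟩ := exists_sub_trivial_cocycle hcomm S hS a (fun h =>
    Submodule.span_mono (Set.subset_insert _ _) (hS' (hT'' h)))
  -- Once the nontrivial characters are removed, `a - u` is additive up to a constant. An additive
  -- function vanishes in the presence of `y`, so `a` lies in `U` after all.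
  have hz := not_isAddFun_of_isMultFun hdep hy hy1 (isAddFun_sub_counit hau)
  apply haU
  rw [sub_eq_zero, sub_eq_iff_eq_add] at hz
  rw [hz]
  refine U.add_mem ?_ hu
  rw [Algebra.algebraMap_eq_smul_one]
  exact U.smul_mem _ (Submodule.subset_span (isMultFun_one k))

end Multiplicative

/-! ### Multiplicative groups of dimension one -/

section MonoidAlgebraLift

variable {k B M : Type*} [Field k] [Ring B] [Algebra k B] [Monoid M]

lemma monoidAlgebra_lift_eq_linearCombination (F : M →* B) (f : MonoidAlgebra k M) :
    MonoidAlgebra.lift k B M F f = Finsupp.linearCombination k (fun m => F m) f.coeff := by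
  rw [MonoidAlgebra.lift_apply, Finsupp.linearCombination_apply]

lemma monoidAlgebra_lift_injective (F : M →* B) (h : LinearIndependent k (fun m => F m)) :
    Function.Injective (MonoidAlgebra.lift k B M F) := by
  intro f g hfg
  rw [monoidAlgebra_lift_eq_linearCombination, monoidAlgebra_lift_eq_linearCombination] at hfg
  exact MonoidAlgebra.coeff_injective (h hfg)

lemma monoidAlgebra_lift_surjective (F : M →* B)
    (h : Submodule.span k (Set.range fun m => F m) = ⊤) :
    Function.Surjective (MonoidAlgebra.lift k B M F) := by
  intro b
  have hb : b ∈ Submodule.span k (Set.range fun m => F m) := h ▸ Submodule.mem_top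
  obtain ⟨f, hf⟩ := (Finsupp.mem_span_range_iff_exists_finsupp).1 hb
  refine ⟨MonoidAlgebra.ofCoeff f, ?_⟩
  rw [MonoidAlgebra.lift_apply]
  exact hf

/-- Evaluation of Laurent polynomials at a unit. -/
def laurentHom (y : Bˣ) : LaurentPolynomial k →ₐ[k] B :=
  AddMonoidAlgebra.lift k B ℤ ((Units.coeHom B).comp (zpowersHom Bˣ y))

lemma laurentHom_T (y : Bˣ) (m : ℤ) :
    laurentHom y (LaurentPolynomial.T m : LaurentPolynomial k) = ((y ^ m : Bˣ) : B) := by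
  rw [laurentHom, LaurentPolynomial.T, AddMonoidAlgebra.lift_single, one_smul]
  rfl

lemma laurentHom_eq_linearCombination (y : Bˣ) (f : LaurentPolynomial k) :
    laurentHom y f = Finsupp.linearCombination k (fun m : ℤ => ((y ^ m : Bˣ) : B)) f.coeff := by
  rw [laurentHom, AddMonoidAlgebra.lift_apply, Finsupp.linearCombination_apply]
  rfl

lemma laurentHom_injective (y : Bˣ) (h : LinearIndependent k (fun m : ℤ => ((y ^ m : Bˣ) : B))) :
    Function.Injective (laurentHom (k := k) y) := by
  intro f g hfg
  rw [laurentHom_eq_linearCombination, laurentHom_eq_linearCombination] at hfg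
  exact AddMonoidAlgebra.coeff_injective (h hfg)

lemma laurentHom_surjective (y : Bˣ)
    (h : Submodule.span k (Set.range fun m : ℤ => ((y ^ m : Bˣ) : B)) = ⊤) :
    Function.Surjective (laurentHom (k := k) y) := by
  intro b
  have hb : b ∈ Submodule.span k (Set.range fun m : ℤ => ((y ^ m : Bˣ) : B)) :=
    h ▸ Submodule.mem_top
  obtain ⟨f, hf⟩ := (Finsupp.mem_span_range_iff_exists_finsupp).1 hb
  refine ⟨AddMonoidAlgebra.ofCoeff f, ?_⟩
  rw [laurentHom_eq_linearCombination, Finsupp.linearCombination_apply]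
  exact hf

end MonoidAlgebraLift

section Multiplicative

variable {k : Type*} {A : Type*} [Field k] [IsAlgClosed k] [CommRing A] [IsDedekindDomain A]
  [HopfAlgebra k A] [Algebra.FiniteType k A]

variable (k A) in
/-- The inclusion of the group-like elements. -/
def groupLikeHom : GroupLike k A →* A where
  toFun := GroupLike.val
  map_one' := rfl
  map_mul' _ _ := rfl

lemma groupLike_pow_ne_one (γ : GroupLike k A) (hγ : γ ≠ 1) {m : ℕ} (hm : m ≠ 0) : γ ^ m ≠ 1 := by
  intro h
  have h1 : IsMultFun k γ.val := isMultFun_iff.2 γ.2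
  refine h1.notMem_range (fun h => hγ (GroupLike.val_injective h))
    (mem_range_of_aeval_eq_zero (p := X ^ m - C 1) ?_ ?_)
  · exact X_pow_sub_C_ne_zero (Nat.pos_of_ne_zero hm) 1
  · have := congrArg GroupLike.val h
    rw [map_sub, map_pow, aeval_X, C_1, map_one, sub_eq_zero]
    exact this

/-- Two group-like elements of a one-dimensional Hopf algebra are multiplicatively dependent. -/
lemma exists_groupLike_relation (hdep : AlgDep k A) (a b : GroupLike k A) :
    ¬ Function.Injective (fun p : ℕ × ℕ => a ^ p.1 * b ^ p.2) := by
  intro hinj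
  obtain ⟨P, hP0, hP⟩ := hdep a.val b.val
  have hli := (linearIndep_groupLikeVal (R := k) (A := A)).comp _ hinj
  have h1 : ∑ q ∈ P.support.sigma (fun j => (P.coeff j).support),
      ((P.coeff q.1).coeff q.2) • (a.val ^ q.2 * b.val ^ q.1) = 0 := by
    rw [Rel, eval₂_eq_sum, Polynomial.sum] at hP
    rw [Finset.sum_sigma, ← hP]
    refine Finset.sum_congr rfl fun j _ => ?_
    -- Expanding the coefficients turns the relation into a linear relation between the monomials
    -- `aⁱ bʲ`. These are distinct group-like elements, hence linearly independent.
    have : aeval a.val (P.coeff j) =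
        ∑ i ∈ (P.coeff j).support, (P.coeff j).coeff i • a.val ^ i := by
      rw [aeval_def, eval₂_eq_sum, Polynomial.sum]
      exact Finset.sum_congr rfl fun i _ => (Algebra.smul_def _ _).symm
    change _ = aeval a.val (P.coeff j) * b.val ^ j
    rw [this, Finset.sum_mul]
    refine Finset.sum_congr rfl fun i _ => ?_
    rw [smul_mul_assoc]
  apply hP0
  ext j i
  rw [coeff_zero, coeff_zero]
  by_contra hne
  have hli2 := hli.comp (fun q : (_ : ℕ) × ℕ => (q.2, q.1)) (by
    rintro ⟨a, b⟩ ⟨c, d⟩ h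
    simp only [Prod.mk.injEq] at h
    rw [h.1, h.2])
  refine hne ((linearIndependent_iff'.1 hli2) _ (fun q => (P.coeff q.1).coeff q.2) h1 ⟨j, i⟩ ?_)
  rw [Finset.mem_sigma]
  refine ⟨?_, by rwa [mem_support_iff]⟩
  rw [mem_support_iff]
  intro h
  simp [h] at hne

/-- A one-dimensional Hopf algebra spanned by group-like elements is a Laurent polynomial ring. -/
theorem exists_laurent_of_isMultFun (hcomm : ∀ g h : WithConv (A →ₐ[k] k), g * h = h * g)
    (hdep : AlgDep k A) {y₀ : A} (hy₀ : IsMultFun k y₀) (hy₀1 : y₀ ≠ 1) :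
    ∃ y : Aˣ, IsGroupLikeElem k (y : A) ∧ Function.Bijective (laurentHom (k := k) y) := by
  have hspan := span_isMultFun_eq_top hcomm hdep hy₀ hy₀1
  have hrange : (Set.range fun m => groupLikeHom k A m) = {γ : A | IsMultFun k γ} := by
    ext γ
    exact ⟨by rintro ⟨g, rfl⟩; exact isMultFun_iff.2 g.2, fun h => ⟨⟨γ, isMultFun_iff.1 h⟩, rfl⟩⟩
  have hbij : Function.Bijective (MonoidAlgebra.lift k A _ (groupLikeHom k A)) :=
    ⟨monoidAlgebra_lift_injective _ linearIndep_groupLikeVal,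
      monoidAlgebra_lift_surjective _ (by rw [hrange]; exact hspan)⟩
  let e := AlgEquiv.ofBijective _ hbij
  -- `A` is the group algebra of its group-like elements. That group is finitely generated because
  -- `A` is affine, and torsion-free because a group-like root of unity is algebraic over `k`, hence
  -- constant. So it is free; algebraic dependence bounds its rank by one, and `y₀` excludes rank
  -- zero.
  have hft : Algebra.FiniteType k (MonoidAlgebra k (GroupLike k A)) :=
    Algebra.FiniteType.equiv ‹_› e.symm
  have hfg : Group.FG (GroupLike k A) := MonoidAlgebra.finiteType_iff_group_fg.1 hft
  have hfin : Module.Finite ℤ (Additive (GroupLike k A)) :=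
    Module.Finite.iff_addGroup_fg.2 inferInstance
  have htf : Module.IsTorsionFree ℤ (Additive (GroupLike k A)) := by
    refine Module.IsTorsionFree.of_smul_eq_zero fun r m h => ?_
    by_contra! hcon
    obtain ⟨hr, hm⟩ := hcon
    refine groupLike_pow_ne_one (Additive.toMul m) hm (m := r.natAbs) (by simpa using hr) ?_
    have h1 : (Additive.toMul m) ^ r = 1 := h
    rcases Int.natAbs_eq r with h2 | h2
    · rw [h2, zpow_natCast] at h1; exact h1
    · rw [h2, zpow_neg, zpow_natCast, inv_eq_one] at h1; exact h1
  obtain ⟨n, b⟩ := Module.basisOfFiniteTypeTorsionFree' (R := ℤ) (M := Additive (GroupLike k A))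
  have hn1 : n ≤ 1 := by
    by_contra! hn
    let i : Fin n := ⟨0, by omega⟩
    let j : Fin n := ⟨1, hn⟩
    have hij : i ≠ j := by simp [i, j, Fin.ext_iff]
    refine exists_groupLike_relation hdep (Additive.toMul (b i)) (Additive.toMul (b j)) ?_
    rintro ⟨p, q⟩ ⟨p', q'⟩ h
    have h1 : (p : ℤ) • b i + (q : ℤ) • b j = (p' : ℤ) • b i + (q' : ℤ) • b j := by
      simp only [natCast_zsmul]
      exact h
    have h2 := congrArg (fun v => b.repr v i) h1
    have h3 := congrArg (fun v => b.repr v j) h1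
    simp [hij, hij.symm] at h2 h3
    rw [h2, h3]
  have hn0 : n ≠ 0 := by
    rintro rfl
    have : Subsingleton (Additive (GroupLike k A)) := b.repr.injective.subsingleton
    have h1 : (⟨y₀, isMultFun_iff.1 hy₀⟩ : GroupLike k A) = 1 :=
      this.elim (Additive.ofMul _) (Additive.ofMul _)
    exact hy₀1 (congrArg GroupLike.val h1)
  obtain rfl : n = 1 := by omega
  set y : GroupLike k A := Additive.toMul (b 0) with hy
  have hgen : ∀ γ : GroupLike k A, ∃ m : ℤ, γ = y ^ m := by
    intro γ
    refine ⟨b.repr (Additive.ofMul γ) 0, ?_⟩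
    have := b.sum_repr (Additive.ofMul γ)
    rw [Fin.sum_univ_one] at this
    exact this.symm
  have hval : ∀ m : ℤ, ((GroupLike.toUnits k y ^ m : Aˣ) : A) = (y ^ m).val := by
    intro m
    rw [← map_zpow (GroupLike.toUnits k) y m]
    rfl
  refine ⟨GroupLike.toUnits k y, y.2, laurentHom_injective _ ?_, laurentHom_surjective _ ?_⟩
  · have hinj : Function.Injective (fun m : ℤ => y ^ m) := by
      intro m m' h
      have h1 : m • b 0 = m' • b 0 := h
      have h2 := congrArg (fun v => b.repr v 0) h1
      simpa using h2
    have := (linearIndep_groupLikeVal (R := k) (A := A)).comp _ hinj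
    have h2 : (fun m : ℤ => ((GroupLike.toUnits k y ^ m : Aˣ) : A)) =
        GroupLike.val ∘ fun m => y ^ m := funext hval
    rw [h2]
    exact this
  · rw [← hspan, ← hrange]
    congr 1
    ext a
    constructor
    · rintro ⟨m, rfl⟩
      exact ⟨y ^ m, (hval m).symm⟩
    · rintro ⟨γ, rfl⟩
      obtain ⟨m, rfl⟩ := hgen γ
      exact ⟨m, hval m⟩

end Multiplicative

/-! ### Additive groups of dimension one -/

/-- In degree `m - 1` only the two top terms of `f` contribute. This is the first coefficient to
notice the translation. -/
lemma coeff_taylor_pred {R : Type*} [CommRing R] (f : R[X]) (u : R) {m : ℕ} (hm : m ≠ 0)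
    (hf : f.natDegree ≤ m) :
    (taylor u f).coeff (m - 1) = f.coeff (m - 1) + m * f.coeff m * u := by
  obtain ⟨m, rfl⟩ := Nat.exists_eq_succ_of_ne_zero hm
  rw [Nat.succ_eq_add_one, Nat.add_sub_cancel, taylor_coeff]
  have hd : (hasseDeriv m f).natDegree < 2 := by
    have := natDegree_hasseDeriv_le f m
    omega
  rw [eval_eq_sum_range' hd, Finset.sum_range_succ, Finset.sum_range_one, hasseDeriv_coeff,
    hasseDeriv_coeff, zero_add, Nat.choose_self, add_comm 1 m, Nat.choose_succ_self_right]
  push_cast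
  ring

section Additive

variable {k : Type*} {A : Type*} [Field k] [IsAlgClosed k] [CommRing A] [IsDedekindDomain A]
  [HopfAlgebra k A] [Algebra.FiniteType k A]

lemma eq_zero_of_forall_eval {x : A} (hx : x ∉ (algebraMap k A).range) (p : k[X])
    (h : ∀ g : WithConv (A →ₐ[k] k), p.eval (g x) = 0) : p = 0 := by
  apply aeval_injective_of_notMem_range (k := k) hx
  rw [map_zero]
  refine eq_zero_of_forall_pt (k := k) _ fun g => ?_
  rw [← aeval_algHom_apply, coe_aeval_eq_eval]
  exact h (toConv g)

/-- Evaluation at `0` gives `p(x(g)) = p(0)` at every point `g`, and a polynomial is determined by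
its values on those of the nonconstant function `x`. -/
lemma eq_C_of_forall_taylor {x : A} (hx : x ∉ (algebraMap k A).range) (p : k[X])
    (h : ∀ g : WithConv (A →ₐ[k] k), taylor (g x) p = p) : p = C (p.eval 0) := by
  rw [← sub_eq_zero]
  refine eq_zero_of_forall_eval hx _ fun g => ?_
  have := congrArg (eval 0) (h g)
  rw [taylor_eval, zero_add] at this
  rw [eval_sub, eval_C, this, sub_self]

/-- The translates of `y` differ from `y` by polynomials in `x`. -/
def QuasiAdd (x y : A) : Prop :=
  ∀ h : WithConv (A →ₐ[k] k), ∃ u : k[X], rTrans h y = y + aeval x u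

lemma IsAddFun.quasiAdd {w : A} (hw : IsAddFun k w) (x : A) : QuasiAdd (k := k) x w :=
  fun h => ⟨C (h w), by rw [hw.rTrans, aeval_C]⟩

/-- A quasi-additive function that is rational in `x` is a polynomial in `x`. -/
lemma QuasiAdd.mem_range_of_mul {x v : A} (hx : IsAddFun k x) (hx0 : x ≠ 0)
    (hv : QuasiAdd (k := k) x v) {a b : k[X]} (hb : b ≠ 0) (hab : aeval x b * v = aeval x a) :
    v ∈ (aeval x : k[X] →ₐ[k] A).range := by
  classical
  have hxr := hx.notMem_range hx0
  have hinj := aeval_injective_of_notMem_range (k := k) hxr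
  set d := EuclideanDomain.gcd a b
  have hd : d ≠ 0 := fun h => hb (EuclideanDomain.gcd_eq_zero_iff.1 h).2
  obtain ⟨a', ha'⟩ : d ∣ a := EuclideanDomain.gcd_dvd_left a b
  obtain ⟨b', hb'⟩ : d ∣ b := EuclideanDomain.gcd_dvd_right a b
  have hcop : IsCoprime b' a' := by
    obtain ⟨s, t, hst⟩ : ∃ s t, d = a * s + b * t := ⟨_, _, EuclideanDomain.gcd_eq_gcd_ab a b⟩
    refine ⟨t, s, ?_⟩
    apply mul_left_cancel₀ hd
    calc d * (t * b' + s * a') = (d * a') * s + (d * b') * t := by ring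
      _ = d * 1 := by rw [← ha', ← hb', ← hst, mul_one]
  have hb'0 : b' ≠ 0 := by
    rintro rfl
    exact hb (by rw [hb', mul_zero])
  have hab' : aeval x b' * v = aeval x a' := by
    have hd' : aeval x d ≠ 0 := fun h => hd (hinj (h.trans (map_zero _).symm))
    apply mul_left_cancel₀ hd'
    rw [← mul_assoc, ← map_mul, ← map_mul, ← ha', ← hb', hab]
  -- In lowest terms `v = a'/b'`. A translate of `v` differs from `v` by a polynomial in `x`, so
  -- `b'` divides its own translate; the two have equal degree and leading coefficient and so
  -- coincide. Hence `b'` is a constant.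
  have hshift : ∀ h : WithConv (A →ₐ[k] k), taylor (h x) b' = b' := by
    intro h
    obtain ⟨u, hu⟩ := hv h
    have h1 := congrArg (rTrans h) hab'
    rw [map_mul, hx.rTrans_aeval, hx.rTrans_aeval, hu] at h1
    have h2 : taylor (h x) b' * (a' + b' * u) = b' * taylor (h x) a' := by
      apply hinj
      rw [map_mul, map_mul, ← h1, map_add, map_mul, ← hab']
      ring
    have h3 : b' ∣ taylor (h x) b' := by
      have h4 : IsCoprime b' (a' + b' * u) := hcop.add_mul_left_right u
      exact h4.dvd_of_dvd_mul_right ⟨_, h2⟩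
    have hne : taylor (h x) b' ≠ 0 := by
      intro h0
      have := leadingCoeff_taylor (h x) b'
      rw [h0, leadingCoeff_zero] at this
      exact hb'0 (leadingCoeff_eq_zero.1 this.symm)
    obtain ⟨q, hq⟩ := h3
    have hq0 : q ≠ 0 := by
      rintro rfl
      exact hne (by rw [hq, mul_zero])
    have hdeg := congrArg natDegree hq
    rw [natDegree_taylor, natDegree_mul hb'0 hq0] at hdeg
    have hqc := eq_C_of_natDegree_eq_zero (show q.natDegree = 0 by omega)
    have hl := congrArg leadingCoeff hq
    rw [leadingCoeff_taylor, leadingCoeff_mul, hqc, leadingCoeff_C] at hl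
    have h5 : q.coeff 0 = 1 := mul_left_cancel₀ (leadingCoeff_ne_zero.2 hb'0) (by
      rw [← hl, mul_one])
    rw [hq, hqc, h5, C_1, mul_one]
  have hc := eq_C_of_forall_taylor hxr b' hshift
  have hc0 : b'.eval 0 ≠ 0 := by
    intro h0
    rw [h0, C_0] at hc
    exact hb'0 hc
  refine ⟨C (b'.eval 0)⁻¹ * a', ?_⟩
  change aeval x _ = v
  rw [map_mul, ← hab', hc, aeval_C, aeval_C, eval_C, ← mul_assoc, ← map_mul,
    inv_mul_cancel₀ hc0, map_one, one_mul]

/-- In characteristic zero quasi-additive functions are polynomials. -/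
lemma QuasiAdd.mem_range_of_charZero [CharZero k] (hdep : AlgDep k A) {x y : A}
    (hx : IsAddFun k x) (hx0 : x ≠ 0) (hy : QuasiAdd (k := k) x y) :
    y ∈ (aeval x : k[X] →ₐ[k] A).range := by
  have hxr := hx.notMem_range hx0
  have hinj := aeval_injective_of_notMem_range (k := k) hxr
  obtain ⟨P, hP0, hP, hmin⟩ := hdep.exists_minimal x y
  set r := P.natDegree with hr
  have hr0 : r ≠ 0 := by
    intro h0
    rw [eq_C_of_natDegree_eq_zero (hr.symm.trans h0), Rel, eval₂_C] at hP
    have h1 : P.coeff 0 = 0 := hinj (hP.trans (map_zero _).symm)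
    apply hP0
    rw [eq_C_of_natDegree_eq_zero (hr.symm.trans h0), h1, C_0]
  set b := P.coeff r with hb
  set b' := P.coeff (r - 1) with hb'
  have hb0 : b ≠ 0 := by rwa [hb, hr, coeff_natDegree, leadingCoeff_ne_zero]
  -- Passing from `y` to `y + u` in the relation adds `r b u` to the subleading coefficient, and
  -- minimality makes the translated relation proportional to `P`. Hence `y' / b` is invariant under
  -- translation, that is, a constant, and `y` is rational in `x` because `r ≠ 0` in characteristic
  -- zero.
  set y' := (r : A) * aeval x b * y + aeval x b' with hy'
  have key : ∀ h : WithConv (A →ₐ[k] k),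
      aeval x b * rTrans h y' = aeval x (taylor (h x) b) * y' := by
    intro h
    obtain ⟨u, hu⟩ := hy h
    set s := h x
    let τ : k[X] →+* k[X] := (taylorAlgHom s).toRingHom
    let P' : k[X][X] := taylor u (P.map τ)
    have hP' : Rel x y P' := by
      have := congrArg (rTrans h) hP
      rw [map_zero, rTrans_eval₂ x y hx, hu] at this
      simp only [P', taylor_apply]
      rw [Rel, eval₂_comp, eval₂_add, eval₂_X, eval₂_C]
      exact this
    let Q : k[X][X] := C b * P' - C (taylor s b) * P
    have hQ : Rel x y Q := by
      rw [Rel] at hP hP' ⊢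
      rw [eval₂_sub, eval₂_mul, eval₂_mul, hP, hP', mul_zero, mul_zero, sub_zero]
    have hdeg : (P.map τ).natDegree ≤ r := natDegree_map_le
    have hQdeg : Q.natDegree < r := by
      refine natDegree_lt_of_coeff_eq_zero hr0 fun m hm => ?_
      have hP'deg : P'.natDegree ≤ r := by rw [natDegree_taylor]; exact hdeg
      rcases hm.eq_or_lt with rfl | hm
      · have h1 : P'.coeff r = taylor s b := by
          have h2 : (taylor u (P.map τ)).coeff r = (P.map τ).coeff r := by
            rw [taylor_coeff]
            have hd : (hasseDeriv r (P.map τ)).natDegree < 1 := by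
              have := natDegree_hasseDeriv_le (P.map τ) r
              omega
            rw [eval_eq_sum_range' hd, Finset.sum_range_one, hasseDeriv_coeff, zero_add,
              Nat.choose_self]
            simp
          rw [h2, coeff_map]
          rfl
        simp only [Q, coeff_sub, coeff_C_mul, h1, ← hb]
        ring
      · have h1 : P.coeff m = 0 := coeff_eq_zero_of_natDegree_lt hm
        have h2 : P'.coeff m = 0 := coeff_eq_zero_of_natDegree_lt (hP'deg.trans_lt hm)
        simp only [Q, coeff_sub, coeff_C_mul, h1, h2, mul_zero, sub_zero]
    have h0 := congrArg (fun R => coeff R (r - 1)) (hmin Q hQ hQdeg)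
    simp only [Q, coeff_sub, coeff_C_mul, coeff_zero, P'] at h0
    rw [coeff_taylor_pred _ _ hr0 hdeg, coeff_map, coeff_map, ← hb, ← hb', sub_eq_zero] at h0
    have h1 := congrArg (aeval x) h0
    simp only [map_mul, map_add, map_natCast] at h1
    have h2 : ∀ p : k[X], aeval x (τ p) = aeval x (taylor s p) := fun p => rfl
    rw [h2, h2] at h1
    rw [hy', map_add, map_mul, map_mul, map_natCast, hx.rTrans_aeval, hx.rTrans_aeval, hu]
    linear_combination h1
  obtain ⟨g, hg⟩ : ∃ g : WithConv (A →ₐ[k] k), b.eval (g x) ≠ 0 := by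
    by_contra! hcon
    exact hb0 (eq_zero_of_forall_eval hxr b hcon)
  have hev : ∀ (q : WithConv (A →ₐ[k] k)) (p : k[X]), q (aeval x p) = p.eval (q x) := by
    intro q p
    exact (aeval_algHom_apply q.ofConv x p).symm.trans (by rw [coe_aeval_eq_eval])
  set c := g y' / b.eval (g x) with hc
  -- The translation that carries `g` to an arbitrary point `q` determines `y'` at `q` from its
  -- value at `g`.
  have hyc : y' = aeval x (C c * b) := by
    refine eq_of_forall_pt (k := k) fun q => ?_
    have h1 := congrArg g.ofConv (key (g⁻¹ * toConv q))
    rw [map_mul, map_mul] at h1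
    have h2 := apply_rTrans g (g⁻¹ * toConv q) y'
    rw [mul_inv_cancel_left] at h2
    rw [h2, hev, hev, taylor_eval] at h1
    have h3 : (toConv q : WithConv (A →ₐ[k] k)) x = g x + (g⁻¹ * toConv q) x := by
      rw [← hx, mul_inv_cancel_left]
    rw [← h3] at h1
    have h4 : q (aeval x (C c * b)) = c * b.eval (q x) := by
      refine (hev (toConv q) _).trans ?_
      rw [eval_mul, eval_C]
    rw [h4, hc]
    field_simp
    change b.eval (g x) * q y' = b.eval (q x) * g y' at h1
    linear_combination h1
  refine hy.mem_range_of_mul hx hx0 (b := (r : k[X]) * b) (a := C c * b - b')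
    (mul_ne_zero (by exact_mod_cast hr0) hb0) ?_
  rw [map_sub, ← hyc, hy', map_mul, map_natCast]
  ring

end Additive

/-! ### Additive groups of dimension one in positive characteristic -/

/-- Right division of a `p`-polynomial by `X ^ p - a X`. -/
lemma exists_pPolynomial_div {k : Type*} [Field k] (p : ℕ) [Fact p.Prime] [CharP k p] (a : k)
    (r : ℕ) : ∀ c : ℕ → k, ∃ (c' : ℕ → k) (e : k), c' r = c (r + 1) ∧
    ∑ i ∈ Finset.range (r + 2), C (c i) * X ^ p ^ i =
      ∑ i ∈ Finset.range (r + 1), C (c' i) * (X ^ p - C a * X) ^ p ^ i + C e * X := by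
  induction r with
  | zero =>
    intro c
    refine ⟨fun _ => c 1, c 0 + c 1 * a, rfl, ?_⟩
    simp only [zero_add, Finset.sum_range_succ, Finset.range_zero, Finset.sum_empty, pow_zero,
      pow_one, C_add, C_mul]
    ring
  | succ r ih =>
    intro c
    -- The top term is `c (r + 2) * (X ^ p - a X) ^ p ^ (r + 1)` plus a multiple of `X ^ p ^ (r +
    -- 1)`, which is absorbed in the next coefficient before the induction hypothesis is applied.
    obtain ⟨c', e, -, h⟩ := ih fun i => if i = r + 1 then c i + c (r + 2) * a ^ p ^ (r + 1) else c i
    refine ⟨fun i => if i = r + 1 then c (r + 2) else c' i, e, by simp, ?_⟩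
    rw [Finset.sum_range_succ _ (r + 1), Finset.sum_range_succ _ (r + 2)]
    beta_reduce
    rw [if_pos rfl]
    rw [Finset.sum_range_succ _ (r + 1), if_pos rfl] at h
    have h1 : ∑ i ∈ Finset.range (r + 1), C (if i = r + 1 then c (r + 2) else c' i) *
        (X ^ p - C a * X) ^ p ^ i =
        ∑ i ∈ Finset.range (r + 1), C (c' i) * (X ^ p - C a * X) ^ p ^ i := by
      refine Finset.sum_congr rfl fun i hi => ?_
      rw [if_neg (by have := Finset.mem_range.1 hi; omega)]
    have h2 : ∑ i ∈ Finset.range (r + 1), C (if i = r + 1 then c i + c (r + 2) *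
        a ^ p ^ (r + 1) else c i) * X ^ p ^ i = ∑ i ∈ Finset.range (r + 1), C (c i) * X ^ p ^ i := by
      refine Finset.sum_congr rfl fun i hi => ?_
      rw [if_neg (by have := Finset.mem_range.1 hi; omega)]
    rw [h2] at h
    rw [h1, sub_pow_char_pow, Finset.sum_range_succ _ (r + 1), mul_pow, ← C_pow, ← pow_mul,
      ← pow_succ']
    simp only [C_add, C_mul] at h
    linear_combination h

/-- If the coefficient of `X` is nonzero, there is a nonzero root `β`. It is also a root of `X ^ p -
β ^ (p - 1) X`, so the linear remainder of the division vanishes at `β` and is zero. Otherwise the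
`p`-polynomial is one in `X ^ p`, and `β = 0`. -/
lemma exists_pPolynomial_factor {k : Type*} [Field k] [IsAlgClosed k] (p : ℕ) [Fact p.Prime]
    [CharP k p] (r : ℕ) (c : ℕ → k) (hc : c (r + 1) = 1) : ∃ (c' : ℕ → k) (β : k), c' r = 1 ∧
    ∑ i ∈ Finset.range (r + 2), C (c i) * X ^ p ^ i =
      ∑ i ∈ Finset.range (r + 1), C (c' i) * (X ^ p - C (β ^ (p - 1)) * X) ^ p ^ i := by
  have hp : p.Prime := Fact.out
  by_cases h0 : c 0 = 0
  · refine ⟨fun i => c (i + 1), 0, hc, ?_⟩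
    rw [Finset.sum_range_succ', h0, C_0, zero_mul, add_zero,
      zero_pow (by have := hp.two_le; omega), C_0, zero_mul, sub_zero]
    refine Finset.sum_congr rfl fun i _ => ?_
    rw [← pow_mul, ← pow_succ']
  · let q : k[X] := ∑ i ∈ Finset.range (r + 2), C (c i) * X ^ (p ^ i - 1)
    have hq : X * q = ∑ i ∈ Finset.range (r + 2), C (c i) * X ^ p ^ i := by
      rw [Finset.mul_sum]
      refine Finset.sum_congr rfl fun i _ => ?_
      rw [mul_left_comm, ← pow_succ', Nat.sub_add_cancel (Nat.one_le_pow _ _ hp.pos)]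
    have hqc : q.coeff (p ^ (r + 1) - 1) = 1 := by
      rw [← coeff_X_mul, hq, Nat.sub_add_cancel (Nat.one_le_pow _ _ hp.pos), finsetSum_coeff,
        Finset.sum_eq_single (r + 1)]
      · rw [coeff_C_mul, coeff_X_pow, if_pos rfl, hc, mul_one]
      · intro i _ hi
        rw [coeff_C_mul, coeff_X_pow, if_neg, mul_zero]
        intro h
        exact hi (Nat.pow_right_injective hp.two_le h).symm
      · simp
    have hq0 : q.coeff 0 = c 0 := by
      rw [← coeff_X_mul, hq, finsetSum_coeff, Finset.sum_eq_single 0]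
      · rw [coeff_C_mul, coeff_X_pow, if_pos (by simp), mul_one]
      · intro i _ hi
        rw [coeff_C_mul, coeff_X_pow, if_neg, mul_zero]
        intro h
        have := Nat.one_lt_pow hi hp.one_lt
        omega
      · simp
    have hdeg : q.degree ≠ 0 := by
      have h1 : p ^ (r + 1) - 1 ≤ q.natDegree := le_natDegree_of_ne_zero (by rw [hqc]; simp)
      have h2 : 1 < p ^ (r + 1) := Nat.one_lt_pow (Nat.succ_ne_zero r) hp.one_lt
      intro h
      have : q.natDegree = 0 := natDegree_eq_of_degree_eq_some h
      omega
    obtain ⟨β, hβ⟩ := IsAlgClosed.exists_root q hdeg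
    have hβ0 : β ≠ 0 := by
      rintro rfl
      rw [IsRoot, ← coeff_zero_eq_eval_zero, hq0] at hβ
      exact h0 hβ
    obtain ⟨c', e, hc', h⟩ := exists_pPolynomial_div p (β ^ (p - 1)) r c
    refine ⟨c', β, hc'.trans hc, ?_⟩
    have he : e = 0 := by
      have h1 := congrArg (eval β) h
      rw [← hq, eval_mul, hβ.eq_zero, mul_zero, eval_add, eval_finsetSum,
        Finset.sum_eq_zero] at h1
      · simpa [hβ0] using h1
      · intro i _
        rw [eval_mul, eval_pow, eval_sub, eval_mul, eval_C, eval_C, eval_X, eval_pow, eval_X,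
          ← pow_succ, Nat.sub_add_cancel hp.one_le, sub_self, zero_pow, mul_zero]
        exact (pow_pos hp.pos i).ne'
    rw [h, he, C_0, zero_mul, add_zero]

/-! ### Quasi-additive functions, maximal additive functions and `p`-th roots -/

section Additive

variable {k : Type*} {A : Type*} [Field k] [IsAlgClosed k] [CommRing A] [IsDedekindDomain A]
  [HopfAlgebra k A] [Algebra.FiniteType k A]

/-- The quasi-additive functions relative to `x`. -/
def quasiAddSubmodule (x : A) : Submodule k A where
  carrier := {y | QuasiAdd (k := k) x y}
  zero_mem' h := ⟨0, by simp⟩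
  add_mem' {y z} hy hz h := by
    obtain ⟨u, hu⟩ := hy h
    obtain ⟨v, hv⟩ := hz h
    exact ⟨u + v, by rw [map_add, hu, hv, map_add]; ring⟩
  smul_mem' c y hy h := by
    obtain ⟨u, hu⟩ := hy h
    exact ⟨c • u, by rw [map_smul, hu, map_smul, smul_add]⟩

lemma IsAddFun.quasiAdd_aeval {x : A} (hx : IsAddFun k x) (q : k[X]) :
    QuasiAdd (k := k) x (aeval x q) :=
  fun h => ⟨taylor (h x) q - q, by rw [hx.rTrans_aeval, map_sub]; ring⟩

lemma QuasiAdd.pow_char (p : ℕ) [Fact p.Prime] [CharP A p] {x y : A}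
    (hy : QuasiAdd (k := k) x y) : QuasiAdd (k := k) x (y ^ p) := fun h => by
  obtain ⟨u, hu⟩ := hy h
  exact ⟨u ^ p, by rw [map_pow, hu, add_pow_char, map_pow]⟩

lemma QuasiAdd.pow_char_pow (p : ℕ) [Fact p.Prime] [CharP A p] {x y : A}
    (hy : QuasiAdd (k := k) x y) (i : ℕ) : QuasiAdd (k := k) x (y ^ p ^ i) := by
  induction i with
  | zero => simpa using hy
  | succ i ih => rw [pow_succ, pow_mul]; exact ih.pow_char p

/-- Additivity may be checked after the injective Frobenius map of `k`. -/
lemma isAddFun_of_pow_char (p : ℕ) [Fact p.Prime] [CharP k p] {x w : A} (hx : IsAddFun k x) {c : k}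
    (hw : w ^ p = c • x) : IsAddFun k w := by
  intro g h
  have hap : ∀ q : WithConv (A →ₐ[k] k), q w ^ p = c * q x := fun q => by
    rw [← smul_eq_mul]
    exact (map_pow q.ofConv w p).symm.trans ((congrArg q.ofConv hw).trans (map_smul q.ofConv c x))
  refine frobenius_inj k p ?_
  rw [frobenius_def, frobenius_def, add_pow_char, hap, hap, hap, hx, mul_add]

/-- `k[x]` is maximal among the subalgebras generated by an additive function. -/
def IsMaxAdd (x : A) : Prop :=
  ∀ w : A, IsAddFun k w → x ∈ (aeval w : k[X] →ₐ[k] A).range →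
    w ∈ (aeval x : k[X] →ₐ[k] A).range

/-- A `p`-th root `w` of `c x` would be additive with `x` in `k[w]`. By maximality `w = q(x)`, and
`q ^ p = c X` is impossible by degree. -/
lemma IsMaxAdd.pow_char_ne (p : ℕ) [Fact p.Prime] [CharP k p] {x : A} (hmax : IsMaxAdd (k := k) x)
    (hx : IsAddFun k x) (hx0 : x ≠ 0) {c : k} (hc : c ≠ 0) (w : A) : w ^ p ≠ c • x := by
  intro hw
  have hinj := aeval_injective_of_notMem_range (k := k) (hx.notMem_range hx0)
  obtain ⟨q, hq⟩ := hmax w (isAddFun_of_pow_char p hx hw) ⟨C c⁻¹ * X ^ p, by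
    change aeval w _ = x
    rw [map_mul, aeval_C, map_pow, aeval_X, hw, Algebra.smul_def, ← mul_assoc, ← map_mul,
      inv_mul_cancel₀ hc, map_one, one_mul]⟩
  have h1 : q ^ p = C c * X := by
    apply hinj
    rw [map_pow, map_mul, aeval_X, aeval_C, ← Algebra.smul_def, ← hw, ← hq]
    rfl
  have h2 := congrArg natDegree h1
  rw [natDegree_pow, natDegree_C_mul_X _ hc] at h2
  exact (Fact.out : p.Prime).one_lt.ne' (Nat.dvd_one.1 ⟨_, h2.symm⟩)

/-- Write `y ^ p = f(x)`. Translation changes `f` by a `p`-th power, so `f'` is invariant under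
translation, hence a constant `c`. Over the perfect field `k` the polynomial `f - c X` is then a
`p`-th power, and subtracting its root from `y` leaves a `p`-th root of `c x`. Maximality of `x`
forces `c = 0`. -/
lemma QuasiAdd.mem_range_of_pow_char (p : ℕ) [Fact p.Prime] [CharP k p] {x y : A}
    (hmax : IsMaxAdd (k := k) x) (hx : IsAddFun k x) (hx0 : x ≠ 0) (hy : QuasiAdd (k := k) x y)
    (h : y ^ p ∈ (aeval x : k[X] →ₐ[k] A).range) : y ∈ (aeval x : k[X] →ₐ[k] A).range := by
  have : CharP A p := charP_of_injective_algebraMap (algebraMap k A).injective p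
  have hp : p.Prime := Fact.out
  have hinj := aeval_injective_of_notMem_range (k := k) (hx.notMem_range hx0)
  obtain ⟨f, hf⟩ := h
  change aeval x f = y ^ p at hf
  have hder : ∀ g : WithConv (A →ₐ[k] k), taylor (g x) (derivative f) = derivative f := by
    intro g
    obtain ⟨u, hu⟩ := hy g
    have h1 := congrArg (rTrans g) hf
    rw [map_pow, hu, add_pow_char, hx.rTrans_aeval, ← hf, ← map_pow, ← map_add] at h1
    have h2 := congrArg derivative (hinj h1)
    rw [derivative_add, derivative_pow, CharP.cast_eq_zero, C_0, zero_mul, zero_mul,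
      add_zero] at h2
    rw [taylor_apply, derivative_comp, derivative_add, derivative_X, derivative_C, add_zero,
      one_mul] at h2
    rw [taylor_apply, h2]
  have hfc := eq_C_of_forall_taylor (hx.notMem_range hx0) _ hder
  set c := (derivative f).eval 0
  have h3 : derivative (f - C c * X) = 0 := by
    rw [derivative_sub, hfc, derivative_C_mul, derivative_X, mul_one, sub_self]
  have h4 := expand_contract p h3 hp.ne_zero
  set q := contract p (f - C c * X)
  let q' : k[X] := q.map (frobeniusEquiv k p).symm.toRingHom
  have hq' : q' ^ p = expand k p q := by
    rw [← map_frobenius_expand, map_expand, Polynomial.map_map]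
    congr 1
    have hid : (frobenius k p).comp (frobeniusEquiv k p).symm.toRingHom = RingHom.id k :=
      RingHom.ext fun t => (frobeniusEquiv k p).apply_symm_apply t
    rw [hid, Polynomial.map_id]
  have h5 : (y - aeval x q') ^ p = c • x := by
    rw [sub_pow_char, ← map_pow, hq', h4, map_sub, hf, map_mul, aeval_C, aeval_X,
      Algebra.smul_def]
    ring
  by_cases hc : c = 0
  · rw [hc, zero_smul] at h5
    have h6 := (pow_eq_zero_iff hp.ne_zero).1 h5
    exact ⟨q', (sub_eq_zero.1 h6).symm⟩
  · exact absurd h5 (hmax.pow_char_ne p hx hx0 hc _)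

end Additive

/-! ### Artin–Schreier equations for quasi-additive functions -/

section Additive

variable {k : Type*} {A : Type*} [Field k] [IsAlgClosed k] [CommRing A] [IsDedekindDomain A]
  [HopfAlgebra k A] [Algebra.FiniteType k A]

lemma natDegree_pow_char_sub_self {k : Type*} [Field k] (p : ℕ) (hp : 1 < p) (u : k[X]) :
    (u ^ p - u).natDegree = p * u.natDegree := by
  rcases Nat.eq_zero_or_pos u.natDegree with h | h
  · rw [eq_C_of_natDegree_eq_zero h, ← C_pow, ← C_sub, natDegree_C, natDegree_C, mul_zero]
  · rw [natDegree_sub_eq_left_of_natDegree_lt, natDegree_pow]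
    rw [natDegree_pow]
    nlinarith

lemma coeff_pow_char (p : ℕ) [Fact p.Prime] [CharP k p] (u : k[X]) (e : ℕ) :
    (u ^ p).coeff (e * p) = u.coeff e ^ p := by
  rw [← map_frobenius_expand, coeff_map, coeff_expand_mul (Fact.out : p.Prime).pos,
    frobenius_def]

/-- The coefficient of the polynomials measuring the failure of additivity of `y` is a function. -/
lemma QuasiAdd.exists_coeff {x y : A} (hx : IsAddFun k x) (hx0 : x ≠ 0) (e : ℕ) :
    ∃ w : A, ∀ (h : WithConv (A →ₐ[k] k)) (u : k[X]), rTrans h y = y + aeval x u →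
      h w = u.coeff e := by
  have hinj := aeval_injective_of_notMem_range (k := k) (hx.notMem_range hx0)
  obtain ⟨l, hl⟩ := LinearMap.exists_leftInverse_of_injective
    (aeval x : k[X] →ₐ[k] A).toLinearMap (LinearMap.ker_eq_bot.2 hinj)
  obtain ⟨z, hz⟩ := exists_eval_eq_rTrans ((lcoeff k e).comp l) y
  refine ⟨z - algebraMap k A ((lcoeff k e).comp l y), fun h u hu => ?_⟩
  have h1 : h (z - algebraMap k A ((lcoeff k e).comp l y)) = h z - (lcoeff k e).comp l y :=
    (map_sub h.ofConv _ _).trans (by rw [AlgHom.commutes]; rfl)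
  rw [h1, hz, hu, map_add, add_sub_cancel_left]
  have h2 : l (aeval x u) = u := LinearMap.congr_fun hl u
  simp [h2]

/-- Induction on the degree `m` of the right-hand side `Q`. If `p ∣ m`, the degree can be lowered.
Otherwise the coefficient of degree `m - 1` in the translated equation leaves only `m ≤ 1`, where
`y` is constant or additive up to a constant. -/
lemma QuasiAdd.mem_range_of_artinSchreier (p : ℕ) [Fact p.Prime] [CharP k p] {x : A}
    (hmax : IsMaxAdd (k := k) x) (hx : IsAddFun k x) (hx0 : x ≠ 0) (m : ℕ) :
    ∀ (y : A) (_ : QuasiAdd (k := k) x y) (Q : k[X]) (_ : Q.natDegree = m)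
      (_ : y ^ p - y = aeval x Q), y ∈ (aeval x : k[X] →ₐ[k] A).range := by
  have : CharP A p := charP_of_injective_algebraMap (algebraMap k A).injective p
  have hp : p.Prime := Fact.out
  have hp1 := hp.one_lt
  have hinj := aeval_injective_of_notMem_range (k := k) (hx.notMem_range hx0)
  induction m using Nat.strong_induction_on with
  | _ m ih =>
  intro y hy Q hQm hQ
  rcases Nat.eq_zero_or_pos m with rfl | hm
  · have hQ' := eq_C_of_natDegree_eq_zero hQm
    rw [hQ', aeval_C] at hQ
    obtain ⟨c, hc⟩ := mem_range_of_aeval_eq_zero (k := k) (x := y)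
      (p := X ^ p - X - C (Q.coeff 0)) (by
        intro h
        have h1 := congrArg (fun q => coeff q p) h
        simp [coeff_X, coeff_C, hp1.ne, hp.ne_zero] at h1) (by simp [hQ])
    exact ⟨C c, by change aeval x _ = y; rw [aeval_C, hc]⟩
  have hlead : Q.coeff m ≠ 0 := by
    rw [← hQm, coeff_natDegree, leadingCoeff_ne_zero]
    rintro rfl
    simp at hQm
    omega
  -- For `m = p e`, subtracting `t x ^ e` from `y`, with `t ^ p` the top coefficient of `Q`,
  -- replaces the top term by one of degree `e < m`.
  by_cases hpm : p ∣ m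
  · obtain ⟨e, rfl⟩ := hpm
    have he : 0 < e := Nat.pos_of_mul_pos_left hm
    have hem : e < p * e := by nlinarith
    obtain ⟨t, ht⟩ := IsAlgClosed.exists_pow_nat_eq (Q.coeff (p * e)) hp.pos
    let Q' : k[X] := Q.erase (p * e) + C t * X ^ e
    have hQ'deg : Q'.natDegree < p * e := by
      refine natDegree_lt_of_coeff_eq_zero hm.ne' fun j hj => ?_
      rw [coeff_add, coeff_erase, coeff_C_mul, coeff_X_pow, if_neg (show j ≠ e by omega), mul_zero,
        add_zero]
      split_ifs with h
      · rfl
      · exact coeff_eq_zero_of_natDegree_lt (by omega)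
    have hQQ : Q' = Q - (C t * X ^ e) ^ p + C t * X ^ e := by
      have h1 := monomial_add_erase Q (p * e)
      simp only [Q']
      rw [mul_pow, ← C_pow, ht, ← pow_mul, mul_comm e p,
        C_mul_X_pow_eq_monomial (n := p * e)]
      linear_combination h1
    have h1 := ih _ hQ'deg (y - aeval x (C t * X ^ e))
      ((quasiAddSubmodule x).sub_mem hy (hx.quasiAdd_aeval _)) Q' rfl (by
        rw [sub_pow_char, hQQ, map_add, map_sub, ← hQ, map_pow]
        ring)
    have h2 := Subalgebra.add_mem _ h1 (AlgHom.mem_range_self (aeval x) (C t * X ^ e))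
    rwa [sub_add_cancel] at h2
  have hmk : (m : k) * Q.coeff m ≠ 0 := by
    refine mul_ne_zero ?_ hlead
    rwa [Ne, CharP.cast_eq_zero_iff k p]
  -- The translated equation reads `u ^ p - u = Q(x + s) - Q(x)` with `s = h x`. The right-hand side
  -- has degree at most `m - 1`, and its coefficient there is `m q s`, where `q` is the top
  -- coefficient of `Q`.
  have hu : ∀ (h : WithConv (A →ₐ[k] k)) (u : k[X]), rTrans h y = y + aeval x u →
      p * u.natDegree ≤ m - 1 ∧ (u ^ p - u).coeff (m - 1) = m * Q.coeff m * h x := by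
    intro h u hu
    have h1 := congrArg (rTrans h) hQ
    rw [map_sub, map_pow, hu, add_pow_char, hx.rTrans_aeval] at h1
    have h2 : u ^ p - u = taylor (h x) Q - Q := by
      apply hinj
      rw [map_sub, map_sub, map_pow, ← h1, ← hQ]
      ring
    constructor
    · rw [← natDegree_pow_char_sub_self p hp1, h2]
      refine Nat.le_sub_one_of_lt (natDegree_lt_of_coeff_eq_zero hm.ne' fun j hj => ?_)
      rcases hj.eq_or_lt with rfl | hj
      · have : (taylor (h x) Q).coeff m = (taylor (h x) Q).leadingCoeff := by
          rw [leadingCoeff, natDegree_taylor, hQm]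
        rw [coeff_sub, this, leadingCoeff_taylor, leadingCoeff, hQm, sub_self]
      · rw [coeff_sub, coeff_eq_zero_of_natDegree_lt, coeff_eq_zero_of_natDegree_lt, sub_zero]
        · omega
        · rw [natDegree_taylor]; omega
    · rw [h2, coeff_sub, coeff_taylor_pred _ _ hm.ne' hQm.le, add_sub_cancel_left]
  -- For `m = 1` every `u` is constant, so `y` is additive up to a constant and `x` is a polynomial
  -- in this additive function; maximality of `x` applies.
  rcases Nat.eq_or_lt_of_le (Nat.succ_le_of_lt hm) with hm1 | hm1
  · obtain rfl : m = 1 := hm1.symm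
    have h1 : ∀ h : WithConv (A →ₐ[k] k), rTrans h y - y ∈ Submodule.span k {(1 : A)} := by
      intro h
      obtain ⟨u, huy⟩ := hy h
      have h2 := (hu h u huy).1
      have h3 : u.natDegree = 0 := by
        by_contra hne
        have := Nat.mul_ne_zero hp.ne_zero hne
        omega
      rw [huy, add_sub_cancel_left, eq_C_of_natDegree_eq_zero h3, aeval_C,
        Algebra.algebraMap_eq_smul_one]
      exact Submodule.smul_mem _ _ (Submodule.mem_span_singleton_self _)
    have hw := isAddFun_sub_counit h1
    set c := (1 : WithConv (A →ₐ[k] k)) y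
    set w := y - algebraMap k A c with hwdef
    have hQ1 := eq_X_add_C_of_natDegree_le_one hQm.le
    have h2 : y ^ p - y = algebraMap k A (Q.coeff 1) * x + algebraMap k A (Q.coeff 0) := by
      rw [hQ]
      conv_lhs => rw [hQ1]
      simp
    have h3 : x = aeval w (C (Q.coeff 1)⁻¹ * (X ^ p - X + C (c ^ p - c) - C (Q.coeff 0))) := by
      have h4 : aeval w (X ^ p - X + C (c ^ p - c) - C (Q.coeff 0)) =
          algebraMap k A (Q.coeff 1) * x := by
        simp only [map_add, map_sub, map_pow, aeval_X, aeval_C, hwdef, sub_pow_char]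
        linear_combination h2
      rw [map_mul, h4, aeval_C, ← mul_assoc, ← map_mul, inv_mul_cancel₀ hlead, map_one, one_mul]
    have h5 := hmax w hw ⟨_, h3.symm⟩
    have h6 := Subalgebra.add_mem _ h5 (Subalgebra.algebraMap_mem _ c)
    rwa [hwdef, sub_add_cancel] at h6
  · exfalso
    -- If `m - 1 = p e`, the coefficient of `u` at `e` is a regular function whose `p`-th power is a
    -- nonzero multiple of `x`, against maximality. If not, `u ^ p - u`, whose degree is a multiple
    -- of `p`, has no term of degree `m - 1`, and `x` vanishes at every point.
    by_cases hpm1 : p ∣ m - 1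
    · obtain ⟨e, he⟩ := hpm1
      obtain ⟨w, hw⟩ := QuasiAdd.exists_coeff (y := y) hx hx0 e
      refine hmax.pow_char_ne p hx hx0 hmk w (eq_of_forall_pt (k := k) fun g => ?_)
      obtain ⟨u, huy⟩ := hy (toConv g)
      obtain ⟨h1, h2⟩ := hu _ u huy
      have h3 : g w = u.coeff e := hw _ u huy
      have h4 : u.coeff (m - 1) = 0 := by
        refine coeff_eq_zero_of_natDegree_lt ?_
        by_contra! hcon
        have h5 : 0 < u.natDegree := by omega
        nlinarith
      rw [coeff_sub, h4, sub_zero, he, mul_comm, coeff_pow_char] at h2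
      rw [map_pow, h3, h2, map_smul, smul_eq_mul]
    · apply hx0
      refine eq_zero_of_forall_pt (k := k) _ fun g => ?_
      obtain ⟨u, huy⟩ := hy (toConv g)
      obtain ⟨h1, h2⟩ := hu _ u huy
      rw [coeff_eq_zero_of_natDegree_lt] at h2
      · exact (mul_eq_zero.1 h2.symm).resolve_left hmk
      · rw [natDegree_pow_char_sub_self p hp1]
        refine lt_of_le_of_ne h1 fun h => hpm1 ⟨_, h.symm⟩

/-- Factoring the `p`-polynomial shows by induction that `y ^ p - β ^ (p - 1) y` lies in `k[x]`. For
`β = 0` this is a `p`-th root problem; for `β ≠ 0`, the rescaled `β⁻¹ y` satisfies an Artin–Schreier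
equation. -/
lemma QuasiAdd.mem_range_of_pPolynomial (p : ℕ) [Fact p.Prime] [CharP k p] {x : A}
    (hmax : IsMaxAdd (k := k) x) (hx : IsAddFun k x) (hx0 : x ≠ 0) (r : ℕ) :
    ∀ (y : A) (_ : QuasiAdd (k := k) x y) (c : ℕ → k) (_ : c r = 1)
      (_ : aeval y (∑ i ∈ Finset.range (r + 1), C (c i) * X ^ p ^ i) ∈
        (aeval x : k[X] →ₐ[k] A).range), y ∈ (aeval x : k[X] →ₐ[k] A).range := by
  have : CharP A p := charP_of_injective_algebraMap (algebraMap k A).injective p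
  have hp : p.Prime := Fact.out
  induction r with
  | zero =>
    intro y _ c hc h
    simpa [hc] using h
  | succ r ih =>
    intro y hy c hc h
    obtain ⟨c', β, hc', hfac⟩ := exists_pPolynomial_factor p r c hc
    have hy' : QuasiAdd (k := k) x (y ^ p - β ^ (p - 1) • y) :=
      (quasiAddSubmodule x).sub_mem (hy.pow_char p) ((quasiAddSubmodule x).smul_mem _ hy)
    have h1 := ih _ hy' c' hc' (by
      rw [hfac] at h
      convert h using 1
      rw [map_sum, map_sum]
      refine Finset.sum_congr rfl fun i _ => ?_
      simp [Algebra.smul_def])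
    by_cases hβ : β = 0
    · rw [hβ, zero_pow (by have := hp.two_le; omega), zero_smul, sub_zero] at h1
      exact hy.mem_range_of_pow_char p hmax hx hx0 h1
    · obtain ⟨Q, hQ⟩ := Subalgebra.smul_mem _ h1 ((β⁻¹) ^ p)
      have h2 := QuasiAdd.mem_range_of_artinSchreier p hmax hx hx0 _ (β⁻¹ • y)
        ((quasiAddSubmodule x).smul_mem _ hy) Q rfl (by
          refine Eq.trans ?_ hQ.symm
          rw [smul_sub, _root_.smul_pow, smul_smul]
          congr 2
          obtain ⟨q, rfl⟩ := Nat.exists_eq_succ_of_ne_zero hp.ne_zero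
          rw [Nat.succ_sub_one, pow_succ, mul_right_comm, ← mul_pow, inv_mul_cancel₀ hβ, one_pow,
            one_mul])
      have h3 := Subalgebra.smul_mem _ h2 β
      rwa [smul_smul, mul_inv_cancel₀ hβ, one_smul] at h3

end Additive

/-! ### The fraction field as a finite extension of `k(x)` -/

section FunctionField

open IntermediateField

variable {k : Type*} {A : Type*} [Field k] [IsAlgClosed k] [CommRing A] [IsDomain A]
  [Algebra k A]

lemma AlgDep.isAlgebraic (hdep : AlgDep k A) {x : A} (hx : x ∉ (algebraMap k A).range) (y : A) :
    IsAlgebraic k⟮algebraMap A (FractionRing A) x⟯ (algebraMap A (FractionRing A) y) := by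
  have hinj := aeval_injective_of_notMem_range (k := k) hx
  obtain ⟨P, hP0, hP⟩ := hdep x y
  set K := FractionRing A
  let F := k⟮algebraMap A K x⟯
  let φ : k[X] →ₐ[k] F := aeval (AdjoinSimple.gen k (algebraMap A K x))
  have hφ : ∀ q : k[X], algebraMap F K (φ q) = algebraMap A K (aeval x q) := by
    intro q
    rw [← aeval_algebraMap_apply, ← aeval_algebraMap_apply]
    rfl
  have hφinj : Function.Injective φ := by
    rw [injective_iff_map_eq_zero]
    intro q hq
    have h1 := hφ q
    rw [hq, map_zero] at h1
    exact hinj (((IsFractionRing.injective A K) (h1.symm.trans (map_zero _).symm)).trans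
      (map_zero _).symm)
  refine ⟨P.map φ.toRingHom, ?_, ?_⟩
  · rwa [Ne, Polynomial.map_eq_zero_iff hφinj]
  · rw [aeval_def, eval₂_map]
    have h1 := congrArg (algebraMap A K) hP
    rw [hom_eval₂, map_zero] at h1
    have h2 : (algebraMap F K).comp φ.toRingHom = (algebraMap A K).comp (aeval x).toRingHom :=
      RingHom.ext hφ
    exact (congrArg (fun ψ => eval₂ ψ (algebraMap A K y) P) h2).trans h1

lemma AlgDep.finiteDimensional [Algebra.FiniteType k A] (hdep : AlgDep k A) {x : A}
    (hx : x ∉ (algebraMap k A).range) :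
    FiniteDimensional k⟮algebraMap A (FractionRing A) x⟯ (FractionRing A) := by
  set K := FractionRing A
  let F := k⟮algebraMap A K x⟯
  obtain ⟨S, hS⟩ := Algebra.FiniteType.out (R := k) (A := A)
  have hfin : FiniteDimensional F (adjoin F ((algebraMap A K) '' (S : Set A))) := by
    have : Finite ((algebraMap A K) '' (S : Set A)) := (S.finite_toSet.image _).to_subtype
    refine finiteDimensional_adjoin ?_
    rintro _ ⟨s, -, rfl⟩
    exact (hdep.isAlgebraic hx s).isIntegral
  have htop : adjoin F ((algebraMap A K) '' (S : Set A)) = ⊤ := by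
    rw [eq_top_iff]
    have hA : ∀ a : A, algebraMap A K a ∈ adjoin F ((algebraMap A K) '' (S : Set A)) := by
      intro a
      have ha : a ∈ Algebra.adjoin k (S : Set A) := by rw [hS]; trivial
      induction ha using Algebra.adjoin_induction with
      | mem s hs => exact subset_adjoin _ _ ⟨s, hs, rfl⟩
      | algebraMap c =>
        have h1 : algebraMap A K (algebraMap k A c) = algebraMap F K (algebraMap k F c) := rfl
        rw [h1]
        exact (adjoin F _).algebraMap_mem _
      | add a b _ _ ha hb => rw [map_add]; exact add_mem ha hb
      | mul a b _ _ ha hb => rw [map_mul]; exact mul_mem ha hb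
    intro z _
    obtain ⟨a, b, -, rfl⟩ := IsFractionRing.div_surjective (A := A) z
    exact div_mem (hA a) (hA b)
  rw [htop] at hfin
  exact Module.Finite.equiv (topEquiv (F := F) (E := K)).toLinearEquiv

lemma exists_of_mem_adjoin {x : A} (hx : x ∉ (algebraMap k A).range) {z : FractionRing A}
    (hz : z ∈ k⟮algebraMap A (FractionRing A) x⟯) :
    ∃ a b : k[X], b ≠ 0 ∧ algebraMap A _ (aeval x b) * z = algebraMap A _ (aeval x a) := by
  have hinj := aeval_injective_of_notMem_range (k := k) hx
  obtain ⟨r, s, rfl⟩ := (mem_adjoin_simple_iff k _).1 hz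
  rw [aeval_algebraMap_apply, aeval_algebraMap_apply]
  by_cases hs : s = 0
  · refine ⟨0, 1, one_ne_zero, ?_⟩
    simp [hs]
  · refine ⟨r, s, hs, mul_div_cancel₀ _ ?_⟩
    rw [Ne, map_eq_zero_iff _ (IsFractionRing.injective A (FractionRing A)),
      map_eq_zero_iff _ hinj]
    exact hs

/-- A sequence of elements is linearly dependent over `k[x]`. -/
lemma AlgDep.exists_linear_relation [Algebra.FiniteType k A] (hdep : AlgDep k A) {x : A}
    (hx : x ∉ (algebraMap k A).range) (f : ℕ → A) : ∃ (r : ℕ) (b : ℕ → k[X]), b r ≠ 0 ∧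
      ∑ i ∈ Finset.range (r + 1), aeval x (b i) * f i = 0 := by
  classical
  set K := FractionRing A
  let F := k⟮algebraMap A K x⟯
  have := hdep.finiteDimensional hx
  have hli : ¬ LinearIndependent F fun i : ℕ => algebraMap A K (f i) := fun h =>
    not_finite_iff_infinite.2 inferInstance h.finite
  rw [not_linearIndependent_iff] at hli
  obtain ⟨s, c, hsum, j, hj, hcj⟩ := hli
  choose a b hb hab using fun i => exists_of_mem_adjoin hx (c i).2
  let t := s.filter fun i => c i ≠ 0
  have htn : t.Nonempty := ⟨j, Finset.mem_filter.2 ⟨hj, hcj⟩⟩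
  let r := t.max' htn
  have hr : c r ≠ 0 := (Finset.mem_filter.1 (t.max'_mem htn)).2
  -- Denominators are cleared by their product over `s`. The index `r` is the last one with a
  -- nonzero coefficient, so that the top coefficient of the cleared relation is nonzero.
  let d : ℕ → k[X] := fun i => if i ∈ t then a i * ∏ j ∈ s.erase i, b j else 0
  have hinj := aeval_injective_of_notMem_range (k := k) hx
  have hKinj := IsFractionRing.injective A K
  refine ⟨r, d, ?_, ?_⟩
  · have hrt : r ∈ t := t.max'_mem htn
    simp only [d, if_pos hrt]
    refine mul_ne_zero ?_ (Finset.prod_ne_zero_iff.2 fun i _ => hb i)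
    intro ha
    have h1 := hab r
    rw [ha, map_zero, map_zero, mul_eq_zero, map_eq_zero_iff _ hKinj, map_eq_zero_iff _ hinj] at h1
    exact h1.elim (hb r) fun h => hr (Subtype.ext h)
  · have hsub : t ⊆ Finset.range (r + 1) := fun i hi =>
      Finset.mem_range.2 (Nat.lt_succ_of_le (t.le_max' i hi))
    rw [← Finset.sum_subset hsub fun i _ hi => by simp only [d, if_neg hi, map_zero, zero_mul]]
    apply hKinj
    rw [map_zero, map_sum]
    have h2 : ∀ i ∈ t, algebraMap A K (aeval x (d i) * f i) =
        algebraMap A K (aeval x (∏ j ∈ s, b j)) * (c i • algebraMap A K (f i)) := by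
      intro i hi
      have h3 : s = insert i (s.erase i) := (Finset.insert_erase (Finset.mem_filter.1 hi).1).symm
      have h4 : ∏ j ∈ s, b j = b i * ∏ j ∈ s.erase i, b j := by
        conv_lhs => rw [h3]
        rw [Finset.prod_insert (Finset.notMem_erase i s)]
      simp only [d, if_pos hi]
      rw [h4, map_mul, map_mul, map_mul, ← hab, map_mul, map_mul]
      change _ = _ * ((c i : K) * _)
      ring
    rw [Finset.sum_congr rfl h2, ← Finset.mul_sum]
    have h5 : ∑ i ∈ t, c i • algebraMap A K (f i) = ∑ i ∈ s, c i • algebraMap A K (f i) := by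
      refine Finset.sum_subset (Finset.filter_subset _ _) fun i hi hit => ?_
      have : c i = 0 := by
        by_contra hne
        exact hit (Finset.mem_filter.2 ⟨hi, hne⟩)
      rw [this, zero_smul]
    rw [h5, hsum, mul_zero]

end FunctionField

/-! ### Choice of a maximal additive function and reduction to `p`-polynomials -/

section Additive

open IntermediateField

variable {k : Type*} {A : Type*} [Field k] [IsAlgClosed k] [CommRing A] [IsDedekindDomain A]
  [HopfAlgebra k A] [Algebra.FiniteType k A]

/-- Choose `x` with the degree of the fraction field over `k(x)` minimal. If `x` lies in `k[w]`,
then `k(x) ⊆ k(w)` are equal by minimality, so `w` is rational in `x`; being additive, it is a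
polynomial in `x`. -/
lemma exists_isMaxAdd (hdep : AlgDep k A) {x₀ : A} (hx₀ : IsAddFun k x₀) (h0 : x₀ ≠ 0) :
    ∃ x : A, IsAddFun k x ∧ x ≠ 0 ∧ IsMaxAdd (k := k) x := by
  classical
  set K := FractionRing A
  let S : Set A := {x | IsAddFun k x ∧ x ≠ 0}
  let deg : A → ℕ := fun x => Module.finrank k⟮algebraMap A K x⟯ K
  obtain ⟨x, ⟨hx, hx0⟩, hmin⟩ : ∃ x ∈ S, ∀ w ∈ S, deg x ≤ deg w := by
    obtain ⟨x, hx, hm⟩ := exists_minimalFor_of_wellFoundedLT (fun w => w ∈ S) deg ⟨x₀, hx₀, h0⟩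
    exact ⟨x, hx, fun w hw => (le_total (deg x) (deg w)).elim id fun h => hm hw h⟩
  refine ⟨x, hx, hx0, fun w hw hxw => ?_⟩
  have hw0 : w ≠ 0 := by
    rintro rfl
    obtain ⟨q, hq⟩ := hxw
    refine hx.notMem_range hx0 ⟨q.coeff 0, ?_⟩
    rw [← hq]
    change _ = aeval 0 q
    rw [← coeff_zero_eq_aeval_zero']
  have hfx := hdep.finiteDimensional (hx.notMem_range hx0)
  have hfw := hdep.finiteDimensional (hw.notMem_range hw0)
  have hle : k⟮algebraMap A K x⟯ ≤ k⟮algebraMap A K w⟯ := by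
    rw [adjoin_simple_le_iff]
    obtain ⟨q, rfl⟩ := hxw
    change algebraMap A K (aeval w q) ∈ _
    rw [← aeval_algebraMap_apply]
    exact algebra_adjoin_le_adjoin k _ (aeval_mem_adjoin_singleton k _)
  have heq := eq_of_le_of_finrank_le' hle (hmin w ⟨hw, hw0⟩)
  have hwx : algebraMap A K w ∈ k⟮algebraMap A K x⟯ := by
    rw [heq]
    exact mem_adjoin_simple_self k _
  obtain ⟨a, b, hb, hab⟩ := exists_of_mem_adjoin (hx.notMem_range hx0) hwx
  refine (hw.quasiAdd x).mem_range_of_mul hx hx0 hb (a := a) ?_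
  rw [← map_mul] at hab
  exact IsFractionRing.injective A K hab

/-- The powers `y ^ p ^ i` are linearly dependent over `k(x)`. In a shortest relation modulo `k[x]`
the ratios `b i / b r` are invariant under translation, hence constants `c i`. The resulting
`p`-polynomial in `y` is quasi-additive and rational in `x`, so it is a polynomial in `x`. -/
lemma QuasiAdd.exists_pPolynomial (p : ℕ) [Fact p.Prime] [CharP k p] (hdep : AlgDep k A) {x y : A}
    (hx : IsAddFun k x) (hx0 : x ≠ 0) (hy : QuasiAdd (k := k) x y) :
    ∃ (r : ℕ) (c : ℕ → k), c r = 1 ∧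
      aeval y (∑ i ∈ Finset.range (r + 1), C (c i) * X ^ p ^ i) ∈
        (aeval x : k[X] →ₐ[k] A).range := by
  classical
  have : CharP A p := charP_of_injective_algebraMap (algebraMap k A).injective p
  have hxr := hx.notMem_range hx0
  let good : ℕ → Prop := fun r => ∃ b : ℕ → k[X], b r ≠ 0 ∧
    ∑ i ∈ Finset.range (r + 1), aeval x (b i) * y ^ p ^ i ∈ (aeval x : k[X] →ₐ[k] A).range
  have hex : ∃ r, good r := by
    obtain ⟨r, b, hb, h⟩ := hdep.exists_linear_relation hxr fun i => y ^ p ^ i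
    exact ⟨r, b, hb, by rw [h]; exact zero_mem _⟩
  let r := Nat.find hex
  obtain ⟨b, hbr, a, ha⟩ : good r := Nat.find_spec hex
  change aeval x a = _ at ha
  -- Minimality of `r`: a relation whose coefficient at `r` vanishes is trivial.
  have hmin : ∀ (d : ℕ → k[X]), ∑ i ∈ Finset.range (r + 1), aeval x (d i) * y ^ p ^ i ∈
      (aeval x : k[X] →ₐ[k] A).range → d r = 0 → ∀ i ∈ Finset.range (r + 1), d i = 0 := by
    intro d hd hdr
    by_contra! hcon
    let t := (Finset.range (r + 1)).filter fun i => d i ≠ 0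
    have htn : t.Nonempty := by
      obtain ⟨i, hi, hdi⟩ := hcon
      exact ⟨i, Finset.mem_filter.2 ⟨hi, hdi⟩⟩
    have hm := Finset.mem_filter.1 (t.max'_mem htn)
    set m := t.max' htn
    have hmr : m < r := by
      refine lt_of_le_of_ne (Nat.lt_succ_iff.1 (Finset.mem_range.1 hm.1)) fun h => ?_
      exact hm.2 (by rw [h, hdr])
    refine Nat.find_min hex hmr ⟨d, hm.2, ?_⟩
    convert hd using 1
    refine Finset.sum_subset (Finset.range_subset_range.2 (by omega)) fun i hi hit => ?_
    have : d i = 0 := by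
      by_contra hne
      have := t.le_max' i (Finset.mem_filter.2 ⟨hi, hne⟩)
      exact hit (Finset.mem_range.2 (Nat.lt_succ_of_le this))
    rw [this, map_zero, zero_mul]
  have hshift : ∀ (h : WithConv (A →ₐ[k] k)), ∀ i ∈ Finset.range (r + 1),
      b r * taylor (h x) (b i) = taylor (h x) (b r) * b i := by
    intro h i hi
    obtain ⟨u, hu⟩ := hy h
    have h1 := congrArg (rTrans h) ha
    rw [hx.rTrans_aeval, map_sum] at h1
    have h2 : ∀ i, rTrans h (aeval x (b i) * y ^ p ^ i) =
        aeval x (taylor (h x) (b i)) * y ^ p ^ i + aeval x (taylor (h x) (b i) * u ^ p ^ i) := by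
      intro i
      rw [map_mul, hx.rTrans_aeval, map_pow, hu, add_pow_char_pow, mul_add, map_mul, map_pow]
    simp only [h2, Finset.sum_add_distrib] at h1
    rw [← map_sum] at h1
    have h3 := hmin (fun i => b r * taylor (h x) (b i) - taylor (h x) (b r) * b i) ?_ (by ring) i hi
    · exact sub_eq_zero.1 h3
    · refine ⟨b r * (taylor (h x) a - ∑ i ∈ Finset.range (r + 1), taylor (h x) (b i) * u ^ p ^ i) -
        taylor (h x) (b r) * a, ?_⟩
      change aeval x _ = _
      rw [map_sub, map_mul, map_mul, map_sub, h1, ha, add_sub_cancel_right, Finset.mul_sum,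
        Finset.mul_sum, ← Finset.sum_sub_distrib]
      refine Finset.sum_congr rfl fun i _ => ?_
      rw [map_sub, map_mul, map_mul]
      ring
  obtain ⟨g, hg⟩ : ∃ g : WithConv (A →ₐ[k] k), (b r).eval (g x) ≠ 0 := by
    by_contra! hcon
    exact hbr (eq_zero_of_forall_eval hxr _ hcon)
  let c : ℕ → k := fun i => (b i).eval (g x) / (b r).eval (g x)
  have hbc : ∀ i ∈ Finset.range (r + 1), b i = C (c i) * b r := by
    intro i hi
    rw [← sub_eq_zero]
    refine eq_zero_of_forall_eval hxr _ fun q => ?_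
    have h1 := congrArg (eval (g x)) (hshift (g⁻¹ * q) i hi)
    have h3 : q x = g x + (g⁻¹ * q) x := by
      rw [← hx, mul_inv_cancel_left]
    rw [eval_mul, eval_mul, taylor_eval, taylor_eval, ← h3] at h1
    simp only [eval_sub, eval_mul, eval_C, c]
    field_simp
    linear_combination h1
  refine ⟨r, c, div_self hg, ?_⟩
  have hq : QuasiAdd (k := k) x (aeval y (∑ i ∈ Finset.range (r + 1), C (c i) * X ^ p ^ i)) := by
    rw [map_sum]
    refine (quasiAddSubmodule x).sum_mem fun i _ => ?_
    rw [map_mul, aeval_C, map_pow, aeval_X, ← Algebra.smul_def]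
    exact (quasiAddSubmodule x).smul_mem _ (hy.pow_char_pow p i)
  refine hq.mem_range_of_mul hx hx0 hbr (a := a) ?_
  rw [ha, map_sum, Finset.mul_sum]
  refine Finset.sum_congr rfl fun i hi => ?_
  rw [hbc i hi, map_mul, map_mul, map_pow, aeval_X, aeval_C, aeval_C]
  ring

/-- The coordinate ring of a commutative unipotent group of dimension one. -/
lemma exists_bijective_aeval (hcomm : ∀ g h : WithConv (A →ₐ[k] k), g * h = h * g)
    (hdep : AlgDep k A) (hmult : ∀ y : A, IsMultFun k y → y = 1) {z₀ : A}
    (hz₀ : z₀ ∉ (algebraMap k A).range) :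
    ∃ x : A, IsAddFun k x ∧ Function.Bijective (aeval x : k[X] →ₐ[k] A) := by
  -- Without nontrivial characters, a semi-invariant modulo `U` is invariant modulo `U`. This is
  -- used for `U = k`, which gives an additive function, and for `U = k[x]`.
  have hsemi : ∀ U : Submodule k A, (∀ h : WithConv (A →ₐ[k] k), ∀ a ∈ U, rTrans h a ∈ U) →
      U ≠ ⊤ → ∃ a ∉ U, ∀ h : WithConv (A →ₐ[k] k), rTrans h a - a ∈ U := by
    intro U hU hne
    obtain ⟨a, ha, γ, hγ, h⟩ := exists_semiinvariant hcomm U hU hne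
    refine ⟨a, ha, fun g => ?_⟩
    have h1 := h g
    have h2 : g γ = 1 := by rw [hmult γ hγ]; exact map_one g.ofConv
    rwa [h2, one_smul] at h1
  obtain ⟨a, ha, hspan⟩ := hsemi (Submodule.span k {1}) (by
    intro h a ha
    obtain ⟨c, rfl⟩ := Submodule.mem_span_singleton.1 ha
    rw [map_smul, map_one]
    exact ha) (by
    intro htop
    apply hz₀
    have : z₀ ∈ Submodule.span k {(1 : A)} := by rw [htop]; trivial
    obtain ⟨c, rfl⟩ := Submodule.mem_span_singleton.1 this
    exact ⟨c, Algebra.algebraMap_eq_smul_one c⟩)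
  have hx₀ := isAddFun_sub_counit hspan
  have hne : a - algebraMap k A ((1 : WithConv (A →ₐ[k] k)) a) ≠ 0 := by
    intro h
    apply ha
    rw [sub_eq_zero.1 h, Algebra.algebraMap_eq_smul_one]
    exact Submodule.smul_mem _ _ (Submodule.mem_span_singleton_self _)
  have main : ∃ x : A, IsAddFun k x ∧ x ≠ 0 ∧ ∀ y, QuasiAdd (k := k) x y →
      y ∈ (aeval x : k[X] →ₐ[k] A).range := by
    obtain ⟨p, hp⟩ := CharP.exists k
    rcases CharP.char_is_prime_or_zero k p with hpp | rfl
    · have : Fact p.Prime := ⟨hpp⟩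
      obtain ⟨x, hx, hx0, hmax⟩ := exists_isMaxAdd hdep hx₀ hne
      refine ⟨x, hx, hx0, fun y hy => ?_⟩
      obtain ⟨r, c, hc, h⟩ := hy.exists_pPolynomial p hdep hx hx0
      exact QuasiAdd.mem_range_of_pPolynomial p hmax hx hx0 r y hy c hc h
    · have : CharZero k := CharP.charP_to_charZero k
      exact ⟨_, hx₀, hne, fun y hy => hy.mem_range_of_charZero hdep hx₀ hne⟩
  obtain ⟨x, hx, hx0, hall⟩ := main
  refine ⟨x, hx, aeval_injective_of_notMem_range (k := k) (hx.notMem_range hx0), ?_⟩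
  by_contra hns
  -- If `k[x]` were proper, an element outside it that is invariant modulo `k[x]` would be
  -- quasi-additive, hence in `k[x]`.
  obtain ⟨y, hy, h⟩ := hsemi (Subalgebra.toSubmodule (aeval x : k[X] →ₐ[k] A).range) (by
    rintro h _ ⟨q, rfl⟩
    exact ⟨_, (hx.rTrans_aeval h q).symm⟩) (by
    intro htop
    apply hns
    intro b
    have : b ∈ Subalgebra.toSubmodule (aeval x : k[X] →ₐ[k] A).range := by rw [htop]; trivial
    exact this)
  refine hy (hall y fun g => ?_)
  obtain ⟨u, hu⟩ := h g
  exact ⟨u, by change aeval x u = _ at hu; rw [hu]; ring⟩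

/-- Commutative affine Hopf algebras that are Dedekind domains, over an algebraically closed
field. -/
theorem exists_polynomial_or_laurent (hdep : AlgDep k A) {z₀ : A}
    (hz₀ : z₀ ∉ (algebraMap k A).range) :
    (∃ x : A, IsAddFun k x ∧ Function.Bijective (aeval x : k[X] →ₐ[k] A)) ∨
    ∃ y : Aˣ, IsGroupLikeElem k (y : A) ∧ Function.Bijective (laurentHom (k := k) y) := by
  have hcomm := pt_mul_comm z₀ hz₀
  by_cases hmult : ∀ y : A, IsMultFun k y → y = 1
  · exact .inl (exists_bijective_aeval hcomm hdep hmult hz₀)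
  · push Not at hmult
    obtain ⟨y₀, hy₀, hy₀1⟩ := hmult
    exact .inr (exists_laurent_of_isMultFun hcomm hdep hy₀ hy₀1)

end Additive

/-! ### Eigenspaces of an automorphism of finite order -/

section Eigen

variable {k : Type*} {H : Type*} [Field k] [Ring H] [Algebra k H]

/-- The eigenspace of `σ` for the eigenvalue `ζ ^ i`. -/
def comp (σ : H →ₐ[k] H) (ζ : k) (i : ℤ) : Submodule k H where
  carrier := {h | σ h = ζ ^ i • h}
  zero_mem' := by simp
  add_mem' {a b} ha hb := by
    rw [Set.mem_ofPred_eq] at ha hb ⊢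
    rw [map_add, ha, hb, smul_add]
  smul_mem' c a ha := by
    rw [Set.mem_ofPred_eq] at ha ⊢
    rw [map_smul, ha, smul_comm]

lemma mem_comp {σ : H →ₐ[k] H} {ζ : k} {i : ℤ} {h : H} : h ∈ comp σ ζ i ↔ σ h = ζ ^ i • h :=
  Iff.rfl

lemma mem_comp_zero {σ : H →ₐ[k] H} {ζ : k} {h : H} : h ∈ comp σ ζ 0 ↔ σ h = h := by
  rw [mem_comp, zpow_zero, one_smul]

lemma one_mem_comp {σ : H →ₐ[k] H} {ζ : k} : (1 : H) ∈ comp σ ζ 0 := by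
  rw [mem_comp_zero, map_one]

lemma mul_mem_comp {σ : H →ₐ[k] H} {ζ : k} (hζ : ζ ≠ 0) {i j : ℤ} {a b : H} (ha : a ∈ comp σ ζ i)
    (hb : b ∈ comp σ ζ j) : a * b ∈ comp σ ζ (i + j) := by
  rw [mem_comp] at *
  rw [map_mul, ha, hb, zpow_add₀ hζ, smul_mul_smul_comm]

lemma pow_apply_of_mem_comp {σ : H →ₐ[k] H} {ζ : k} {i : ℤ} {a : H} (ha : a ∈ comp σ ζ i)
    (j : ℕ) : (σ ^ j) a = (ζ ^ i) ^ j • a := by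
  induction j with
  | zero => simp
  | succ j ih => rw [pow_succ, AlgHom.mul_apply, mem_comp.1 ha, map_smul, ih, smul_smul, pow_succ']

/-- The projection to the eigenspace of `σ` for the eigenvalue `ζ ^ i`. -/
def proj (σ : H →ₐ[k] H) (ζ : k) (n : ℕ) (i : ℤ) : H →ₗ[k] H :=
  (n : k)⁻¹ • ∑ j ∈ Finset.range n, (ζ ^ (-i)) ^ j • (σ ^ j).toLinearMap

lemma proj_apply (σ : H →ₐ[k] H) (ζ : k) (n : ℕ) (i : ℤ) (h : H) :
    proj σ ζ n i h = (n : k)⁻¹ • ∑ j ∈ Finset.range n, (ζ ^ (-i)) ^ j • (σ ^ j) h := by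
  simp [proj]

section

variable {σ : H →ₐ[k] H} {ζ : k} {n : ℕ} [NeZero n] (hζ : IsPrimitiveRoot ζ n) (hσ : σ ^ n = 1)
include hζ

lemma zeta_ne_zero : ζ ≠ 0 := hζ.ne_zero (NeZero.ne n)

lemma natCast_ne_zero_of_isPrimitiveRoot : (n : k) ≠ 0 := hζ.neZero'.out

lemma zpow_pow_eq_one (i : ℤ) : (ζ ^ i) ^ n = 1 := by
  rw [← zpow_natCast, ← zpow_mul, mul_comm, zpow_mul, zpow_natCast, hζ.pow_eq_one, one_zpow]

lemma geom_sum_zpow_eq_zero {i : ℤ} (hi : ¬ (n : ℤ) ∣ i) : ∑ j ∈ Finset.range n, (ζ ^ i) ^ j = 0 := by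
  have h1 : ζ ^ i ≠ 1 := fun h => hi ((hζ.zpow_eq_one_iff_dvd i).1 h)
  have h2 := mul_geom_sum (ζ ^ i) n
  rw [zpow_pow_eq_one hζ, sub_self] at h2
  exact (mul_eq_zero.1 h2).resolve_left (sub_ne_zero.2 h1)

lemma proj_eq_self {i : ℤ} {h : H} (hh : h ∈ comp σ ζ i) : proj σ ζ n i h = h := by
  rw [proj_apply, Finset.sum_congr rfl fun j _ => by
    rw [pow_apply_of_mem_comp hh, smul_smul, ← mul_pow, zpow_neg,
      inv_mul_cancel₀ (zpow_ne_zero i (zeta_ne_zero hζ)), one_pow, one_smul]]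
  rw [Finset.sum_const, Finset.card_range, ← Nat.cast_smul_eq_nsmul k, smul_smul,
    inv_mul_cancel₀ (natCast_ne_zero_of_isPrimitiveRoot hζ), one_smul]

lemma proj_eq_zero {i j : ℤ} (hij : ¬ (n : ℤ) ∣ i - j) {h : H} (hh : h ∈ comp σ ζ i) :
    proj σ ζ n j h = 0 := by
  rw [proj_apply, Finset.sum_congr rfl fun m _ => by
    rw [pow_apply_of_mem_comp hh, smul_smul, ← mul_pow, ← zpow_add₀ (zeta_ne_zero hζ), neg_add_eq_sub]]
  rw [← Finset.sum_smul, geom_sum_zpow_eq_zero hζ hij, zero_smul, smul_zero]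

include hσ

lemma proj_mem (i : ℤ) (h : H) : proj σ ζ n i h ∈ comp σ ζ i := by
  rw [mem_comp, proj_apply, map_smul, smul_comm (ζ ^ i)]
  congr 1
  have hne := zpow_ne_zero i (zeta_ne_zero hζ)
  let f : ℕ → H := fun j => (ζ ^ (-i)) ^ j • (σ ^ j) h
  have h0 : f n = f 0 := by simp only [f]; rw [zpow_pow_eq_one hζ, hσ, pow_zero, pow_zero]
  have hs : ∀ j, σ (f j) = ζ ^ i • f (j + 1) := by
    intro j
    simp only [f]
    rw [map_smul, smul_smul, pow_succ', ← mul_assoc, zpow_neg, mul_inv_cancel₀ hne, one_mul,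
      pow_succ', AlgHom.mul_apply]
  change σ (∑ j ∈ Finset.range n, f j) = ζ ^ i • ∑ j ∈ Finset.range n, f j
  rw [map_sum, Finset.sum_congr rfl fun j _ => hs j, ← Finset.smul_sum]
  congr 1
  have h1 := Finset.sum_range_succ f n
  rw [Finset.sum_range_succ', h0] at h1
  exact add_right_cancel h1

omit hσ in
lemma sum_proj (h : H) : ∑ i ∈ Finset.range n, proj σ ζ n i h = h := by
  simp only [proj_apply]
  rw [← Finset.smul_sum, Finset.sum_comm]
  have h1 : ∀ j ∈ Finset.range n, ∑ i ∈ Finset.range n, (ζ ^ (-(i : ℤ))) ^ j • (σ ^ j) h =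
      if j = 0 then (n : k) • h else 0 := by
    intro j hj
    rw [← Finset.sum_smul]
    split_ifs with h0
    · simp [h0]
    · rw [Finset.sum_congr rfl fun (i : ℕ) _ => show (ζ ^ (-(i : ℤ))) ^ j = (ζ ^ (-(j : ℤ))) ^ i by
        rw [← zpow_natCast, ← zpow_natCast, ← zpow_mul, ← zpow_mul]; congr 1; ring,
        geom_sum_zpow_eq_zero hζ, zero_smul]
      rw [dvd_neg, Int.natCast_dvd_natCast]
      exact fun hd => absurd (Nat.le_of_dvd (by omega) hd) (by have := Finset.mem_range.1 hj; omega)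
  rw [Finset.sum_congr rfl h1, Finset.sum_ite_eq' , if_pos (Finset.mem_range.2 (NeZero.pos n)),
    smul_smul, inv_mul_cancel₀ (natCast_ne_zero_of_isPrimitiveRoot hζ), one_smul]

lemma proj_mul {i : ℤ} {b : H} (hb : b ∈ comp σ ζ i) (j : ℤ) (a : H) :
    proj σ ζ n j (a * b) = proj σ ζ n (j - i) a * b := by
  have hne := zeta_ne_zero hζ
  rw [proj_apply, proj_apply, smul_mul_assoc, Finset.sum_mul]
  congr 1
  refine Finset.sum_congr rfl fun m _ => ?_
  rw [map_mul, pow_apply_of_mem_comp hb, mul_smul_comm, smul_smul, smul_mul_assoc, ← mul_pow,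
    ← zpow_add₀ hne]
  congr 3
  ring

lemma proj_mul_left {i : ℤ} {a : H} (ha : a ∈ comp σ ζ i) (j : ℤ) (b : H) :
    proj σ ζ n j (a * b) = a * proj σ ζ n (j - i) b := by
  have hne := zeta_ne_zero hζ
  rw [proj_apply, proj_apply, mul_smul_comm, Finset.mul_sum]
  congr 1
  refine Finset.sum_congr rfl fun m _ => ?_
  rw [map_mul, pow_apply_of_mem_comp ha, smul_mul_assoc, smul_smul, mul_smul_comm, ← mul_pow,
    ← zpow_add₀ hne]
  congr 3
  ring

/-- Every element is a sum of homogeneous ones. -/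
lemma mem_of_forall_comp_le {N : Submodule k H} (hN : ∀ i : ℕ, comp σ ζ (i : ℤ) ≤ N) (h : H) :
    h ∈ N := by
  rw [← sum_proj (σ := σ) hζ h]
  exact Submodule.sum_mem _ fun i _ => hN i (proj_mem hζ hσ i h)

omit hσ in
lemma eq_zero_of_forall_proj {h : H} (hh : ∀ i < n, proj σ ζ n (i : ℤ) h = 0) : h = 0 := by
  rw [← sum_proj (σ := σ) hζ h]
  exact Finset.sum_eq_zero fun i hi => hh i (Finset.mem_range.1 hi)

end

end Eigen

lemma exists_sum_of_mem_mul {k : Type*} {H : Type*} [Field k] [Ring H] [Algebra k H]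
    {P Q : Submodule k H} {w : H} (hw : w ∈ P * Q) :
    ∃ (s : ℕ) (p q : Fin s → H), (∀ e, p e ∈ P) ∧ (∀ e, q e ∈ Q) ∧ w = ∑ e, p e * q e := by
  induction hw using Submodule.mul_induction_on' with
  | mem_mul_mem a ha b hb => exact ⟨1, fun _ => a, fun _ => b, fun _ => ha, fun _ => hb, by simp⟩
  | add x _ y _ hx hy =>
    obtain ⟨s, p, q, hp, hq, rfl⟩ := hx
    obtain ⟨s', p', q', hp', hq', rfl⟩ := hy
    refine ⟨s + s', Fin.append p p', Fin.append q q', fun e => ?_, fun e => ?_, ?_⟩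
    · refine Fin.addCases (fun i => ?_) (fun i => ?_) e
      · rw [Fin.append_left]; exact hp i
      · rw [Fin.append_right]; exact hp' i
    · refine Fin.addCases (fun i => ?_) (fun i => ?_) e
      · rw [Fin.append_left]; exact hq i
      · rw [Fin.append_right]; exact hq' i
    · rw [Fin.sum_univ_add]
      simp

/-! ### The grading of `H` defined by a winding automorphism -/

section Grading

variable {k : Type*} {H : Type*} [Field k] [Ring H] [HopfAlgebra k H]

/-- `σ` is an automorphism of order `n` that is a left and a right winding automorphism, and `ζ` is
a primitive `n`-th root of unity. -/
structure IsBiwinding (σ : H →ₐ[k] H) (n : ℕ) (ζ : k) : Prop where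
  prim : IsPrimitiveRoot ζ n
  pow_eq : σ ^ n = 1
  comul_left : ∀ h, Coalgebra.comul (R := k) (σ h) =
    σ.toLinearMap.rTensor H (Coalgebra.comul (R := k) h)
  comul_right : ∀ h, Coalgebra.comul (R := k) (σ h) =
    σ.toLinearMap.lTensor H (Coalgebra.comul (R := k) h)
  counit_inj : ∀ i < n, ∀ j < n,
    (∀ h, Coalgebra.counit (R := k) ((σ ^ i) h) = Coalgebra.counit (R := k) ((σ ^ j) h)) → i = j

namespace IsBiwinding

variable {σ : H →ₐ[k] H} {n : ℕ} {ζ : k} [NeZero n] (hb : IsBiwinding σ n ζ)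
include hb

lemma comul_pow_left (j : ℕ) (h : H) : Coalgebra.comul (R := k) ((σ ^ j) h) =
    (σ ^ j).toLinearMap.rTensor H (Coalgebra.comul (R := k) h) := by
  induction j generalizing h with
  | zero => exact (LinearMap.rTensor_id_apply H H _).symm
  | succ j ih =>
    rw [pow_succ, AlgHom.mul_apply, ih, hb.comul_left, ← LinearMap.rTensor_comp_apply]
    rfl

lemma comul_pow_right (j : ℕ) (h : H) : Coalgebra.comul (R := k) ((σ ^ j) h) =
    (σ ^ j).toLinearMap.lTensor H (Coalgebra.comul (R := k) h) := by
  induction j generalizing h with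
  | zero => exact (LinearMap.lTensor_id_apply H H _).symm
  | succ j ih =>
    rw [pow_succ, AlgHom.mul_apply, ih, hb.comul_right, ← LinearMap.lTensor_comp_apply]
    rfl

lemma comul_proj_left (i : ℤ) (h : H) : Coalgebra.comul (R := k) (proj σ ζ n i h) =
    (proj σ ζ n i).rTensor H (Coalgebra.comul (R := k) h) := by
  rw [proj_apply, proj, LinearMap.rTensor_smul, map_smul, map_sum, LinearMap.smul_apply]
  simp only [map_smul, hb.comul_pow_left]
  congr 1
  have : (∑ j ∈ Finset.range n, (ζ ^ (-i)) ^ j • (σ ^ j).toLinearMap).rTensor H =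
      ∑ j ∈ Finset.range n, (ζ ^ (-i)) ^ j • (σ ^ j).toLinearMap.rTensor H := by
    refine (map_sum (LinearMap.rTensorHom (R := k) (P := H) (N := H) H) _ _).trans
      (Finset.sum_congr rfl fun j _ => ?_)
    exact LinearMap.rTensor_smul _ _ _
  rw [this]
  simp

lemma comul_proj_right (i : ℤ) (h : H) : Coalgebra.comul (R := k) (proj σ ζ n i h) =
    (proj σ ζ n i).lTensor H (Coalgebra.comul (R := k) h) := by
  rw [proj_apply, proj, LinearMap.lTensor_smul, map_smul, map_sum, LinearMap.smul_apply]
  simp only [map_smul, hb.comul_pow_right]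
  congr 1
  have : (∑ j ∈ Finset.range n, (ζ ^ (-i)) ^ j • (σ ^ j).toLinearMap).lTensor H =
      ∑ j ∈ Finset.range n, (ζ ^ (-i)) ^ j • (σ ^ j).toLinearMap.lTensor H := by
    refine (map_sum (LinearMap.lTensorHom (R := k) (P := H) (N := H) H) _ _).trans
      (Finset.sum_congr rfl fun j _ => ?_)
    exact LinearMap.lTensor_smul _ _ _
  rw [this]
  simp

/-- The eigenprojection can be moved through `Δ` onto either leg. Hence `Δ` maps each component
`H_i` into `H_i ⊗ H_i`. -/
lemma comul_eq_map_proj {i : ℤ} {h : H} (hh : h ∈ comp σ ζ i) : Coalgebra.comul (R := k) h =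
    TensorProduct.map (proj σ ζ n i) (proj σ ζ n i) (Coalgebra.comul (R := k) h) := by
  conv_lhs => rw [← proj_eq_self hb.prim hh, ← proj_eq_self hb.prim hh]
  rw [hb.comul_proj_left, hb.comul_proj_right, ← LinearMap.comp_apply, LinearMap.rTensor_comp_lTensor]

/-- Up to a nonzero factor, `ε ∘ proj` is a combination of the characters `ε ∘ σ ^ j`, `j < n`, with
nonzero coefficients. These characters are distinct, so by Dedekind's independence theorem it does
not vanish. -/
lemma exists_counit_eq_one (i : ℤ) : ∃ v ∈ comp σ ζ i, Coalgebra.counit (R := k) v = 1 := by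
  suffices h : ∃ h : H, Coalgebra.counit (R := k) (proj σ ζ n i h) ≠ 0 by
    obtain ⟨h, hh⟩ := h
    refine ⟨(Coalgebra.counit (R := k) (proj σ ζ n i h))⁻¹ • proj σ ζ n i h,
      Submodule.smul_mem _ _ (proj_mem hb.prim hb.pow_eq i h), ?_⟩
    rw [map_smul, smul_eq_mul, inv_mul_cancel₀ hh]
  by_contra! hcon
  let χ : Fin n → H →* k := fun j =>
    (((Bialgebra.counitAlgHom k H).comp (σ ^ (j : ℕ)) : H →ₐ[k] k) : H →* k)
  have hχ : Function.Injective χ := by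
    intro j j' h
    apply Fin.ext
    exact hb.counit_inj j j.2 j' j'.2 fun a => DFunLike.congr_fun h a
  have hli := (linearIndependent_monoidHom H k).comp χ hχ
  rw [Fintype.linearIndependent_iff] at hli
  have h0 := hli (fun j => (ζ ^ (-i)) ^ (j : ℕ)) (by
    ext a
    have h1 := hcon a
    rw [proj_apply, map_smul, smul_eq_mul, mul_eq_zero, map_sum] at h1
    have h2 := h1.resolve_left (inv_ne_zero (natCast_ne_zero_of_isPrimitiveRoot hb.prim))
    rw [Finset.sum_apply]
    rw [Finset.sum_range] at h2
    simp only [map_smul] at h2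
    exact h2) ⟨0, NeZero.pos n⟩
  simp at h0

/-- The grading is strong. -/
lemma one_mem_comp_mul_comp (i : ℤ) : (1 : H) ∈ comp σ ζ (-i) * comp σ ζ i := by
  obtain ⟨v, hv, hv1⟩ := hb.exists_counit_eq_one i
  -- In `∑ S(v₁) v₂ = ε(v) = 1` the factor `v₂` has degree `i`, so the part of degree `0` retains
  -- only the part of `S(v₁)` of degree `-i`.
  have h1 := HopfAlgebra.mul_antipode_rTensor_comul_apply (R := k) v
  rw [hv1, map_one, hb.comul_eq_map_proj hv] at h1
  have key : ∀ t : H ⊗[k] H, proj σ ζ n 0 (LinearMap.mul' k H ((HopfAlgebra.antipode k).rTensor H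
      (TensorProduct.map (proj σ ζ n i) (proj σ ζ n i) t))) ∈ comp σ ζ (-i) * comp σ ζ i := by
    intro t
    induction t with
    | zero => simp
    | add a b ha hb => simp only [map_add]; exact Submodule.add_mem _ ha hb
    | tmul a b =>
      have hm := proj_mem hb.prim hb.pow_eq i b
      rw [TensorProduct.map_tmul, LinearMap.rTensor_tmul, LinearMap.mul'_apply,
        proj_mul hb.prim hb.pow_eq hm, zero_sub]
      exact Submodule.mul_mem_mul (proj_mem hb.prim hb.pow_eq _ _) hm
  have h2 := key (Coalgebra.comul (R := k) v)
  rwa [h1, proj_eq_self hb.prim one_mem_comp] at h2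

lemma one_mem_comp_mul_comp' (i : ℤ) : (1 : H) ∈ comp σ ζ i * comp σ ζ (-i) := by
  have := hb.one_mem_comp_mul_comp (-i)
  rwa [neg_neg] at this

lemma exists_mul_ne_zero (i : ℤ) {h : H} (hh : h ≠ 0) : ∃ w ∈ comp σ ζ i, w * h ≠ 0 := by
  by_contra! hcon
  have key : ∀ t ∈ comp σ ζ (-i) * comp σ ζ i, t * h = 0 := by
    intro t ht
    induction ht using Submodule.mul_induction_on' with
    | mem_mul_mem a _ b hb => rw [mul_assoc, hcon b hb, mul_zero]
    | add a _ b _ ha hb => rw [add_mul, ha, hb, add_zero]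
  apply hh
  rw [← one_mul h, key 1 (hb.one_mem_comp_mul_comp i)]

lemma exists_mul_ne_zero' (i : ℤ) {h : H} (hh : h ≠ 0) : ∃ w ∈ comp σ ζ i, h * w ≠ 0 := by
  by_contra! hcon
  have key : ∀ t ∈ comp σ ζ i * comp σ ζ (-i), h * t = 0 := by
    intro t ht
    induction ht using Submodule.mul_induction_on' with
    | mem_mul_mem a ha b _ => rw [← mul_assoc, hcon a ha, zero_mul]
    | add a _ b _ ha hb => rw [mul_add, ha, hb, add_zero]
  apply hh
  rw [← mul_one h, key 1 (hb.one_mem_comp_mul_comp' i)]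

section Component

variable {D : Type*} [CommRing D] [Algebra k D] {ι : D →ₐ[k] H}
  (hι : Function.Injective ι) (hr : ∀ h, h ∈ comp σ ζ 0 ↔ h ∈ ι.range)
include hι hr

lemma map_mem_comp (d : D) : ι d ∈ comp σ ζ 0 := (hr _).2 ⟨d, rfl⟩

/-- By strongness, nonzero `a` and `b` can be multiplied, on the outer sides, to nonzero elements of
the domain `D`; their product would still contain `a * b`. -/
lemma eq_zero_or_eq_zero_of_mul_eq_zero [IsDomain D] {i j : ℤ} {a b : H} (ha : a ∈ comp σ ζ i)
    (hbj : b ∈ comp σ ζ j) (hab : a * b = 0) : a = 0 ∨ b = 0 := by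
  have hne := zeta_ne_zero hb.prim
  by_contra! hcon
  obtain ⟨w, hw, hwa⟩ := hb.exists_mul_ne_zero (-i) hcon.1
  obtain ⟨w', hw', hbw⟩ := hb.exists_mul_ne_zero' (-j) hcon.2
  have h1 := mul_mem_comp hne hw ha
  have h2 := mul_mem_comp hne hbj hw'
  rw [neg_add_cancel] at h1
  rw [add_neg_cancel] at h2
  obtain ⟨c, hc⟩ := (hr _).1 h1
  obtain ⟨d, hd⟩ := (hr _).1 h2
  have h3 : c * d = 0 := by
    apply hι
    rw [map_zero, map_mul]
    change ι.toRingHom c * ι.toRingHom d = 0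
    rw [hc, hd, mul_assoc, ← mul_assoc a, hab, zero_mul, mul_zero]
  rcases mul_eq_zero.1 h3 with rfl | rfl
  · exact hwa (by rw [← hc, map_zero])
  · exact hbw (by rw [← hd, map_zero])

lemma exists_mul_eq_of_mem_comp {i : ℤ} {u : Hˣ} (hu : (u : H) ∈ comp σ ζ i) {h : H}
    (hh : h ∈ comp σ ζ i) : ∃ d, h = u * ι d := by
  have hne := zeta_ne_zero hb.prim
  have h1 : (↑u⁻¹ * h : H) ∈ comp σ ζ 0 := by
    rw [mem_comp_zero]
    apply u.isUnit.mul_left_cancel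
    rw [Units.mul_inv_cancel_left]
    have h2 : σ (↑u * (↑u⁻¹ * h)) = ζ ^ i • h := by
      rw [Units.mul_inv_cancel_left]; exact hh
    rw [map_mul, mem_comp.1 hu, smul_mul_assoc] at h2
    exact smul_right_injective H (zpow_ne_zero i hne) h2
  obtain ⟨d, hd⟩ := (hr _).1 h1
  exact ⟨d, (Units.inv_mul_eq_iff_eq_mul u).1 hd.symm⟩

/-- If the component of degree `0` is a principal ideal domain, then the component of degree `1`
contains a unit. -/
lemma exists_unit_mem_comp [IsDomain D] [IsPrincipalIdealRing D] :
    ∃ u : Hˣ, (u : H) ∈ comp σ ζ 1 := by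
  have hne := zeta_ne_zero hb.prim
  have hone : (1 : H) ≠ 0 := by
    rw [← map_one ι, Ne, map_eq_zero_iff ι hι]
    exact one_ne_zero
  have reg : ∀ {i j : ℤ} {a b : H}, a ∈ comp σ ζ i → b ∈ comp σ ζ j → a * b = 0 → a = 0 ∨ b = 0 :=
    fun ha hbj hab => hb.eq_zero_or_eq_zero_of_mul_eq_zero hι hr ha hbj hab
  obtain ⟨u₀, hu₀, hu₀1⟩ := hb.exists_mul_ne_zero (-1) hone
  rw [mul_one] at hu₀1
  -- The ideal `u₀ H_1` of `D` is a copy of the right `D`-module `H_1`, as left multiplication by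
  -- `u₀` is injective there. A generator `u₀ h₀` therefore yields `H_1 = h₀ D`.
  let I : Ideal D :=
    { carrier := {d | ∃ h ∈ comp σ ζ 1, ι d = u₀ * h}
      zero_mem' := ⟨0, Submodule.zero_mem _, by simp⟩
      add_mem' := by
        rintro a b ⟨h, hh, ha⟩ ⟨h', hh', hb⟩
        exact ⟨h + h', Submodule.add_mem _ hh hh', by rw [map_add, ha, hb, mul_add]⟩
      smul_mem' := by
        rintro c d ⟨h, hh, hd⟩
        refine ⟨h * ι c, ?_, ?_⟩
        · have := mul_mem_comp hne hh (hb.map_mem_comp hι hr c)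
          rwa [add_zero] at this
        · rw [smul_eq_mul, mul_comm, map_mul, hd, mul_assoc] }
  obtain ⟨g, hg⟩ := (IsPrincipalIdealRing.principal I).principal
  obtain ⟨h₀, hh₀, hg₀⟩ : g ∈ I := by rw [hg]; exact Submodule.mem_span_singleton_self g
  have hgen : ∀ h ∈ comp σ ζ 1, ∃ c, h = h₀ * ι c := by
    intro h hh
    have h1 := mul_mem_comp hne hu₀ hh
    rw [neg_add_cancel] at h1
    obtain ⟨d, hd⟩ := (hr _).1 h1
    have hdI : d ∈ I := ⟨h, hh, hd⟩
    rw [hg] at hdI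
    obtain ⟨c, rfl⟩ := Submodule.mem_span_singleton.1 hdI
    refine ⟨c, ?_⟩
    have h2 : u₀ * (h - h₀ * ι c) = 0 := by
      rw [mul_sub, sub_eq_zero, ← mul_assoc, ← hg₀, ← map_mul, mul_comm g c]
      exact hd.symm
    have h3 : h - h₀ * ι c ∈ comp σ ζ 1 := by
      refine Submodule.sub_mem _ hh ?_
      have := mul_mem_comp hne hh₀ (hb.map_mem_comp hι hr c)
      rwa [add_zero] at this
    exact sub_eq_zero.1 ((reg hu₀ h3 h2).resolve_left hu₀1)
  -- Commutativity of `D` gives `a h₀ c = c a h₀`, so `H_{-1} H_1 = H_{-1} h₀`. As it contains `1`,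
  -- the element `h₀` has a left inverse, and cancellation makes it two-sided.
  have key : ∀ t ∈ comp σ ζ (-1) * comp σ ζ 1, ∃ w ∈ comp σ ζ (-1), t = w * h₀ := by
    intro t ht
    induction ht using Submodule.mul_induction_on' with
    | mem_mul_mem a ha b hbm =>
      obtain ⟨c, rfl⟩ := hgen b hbm
      have h1 := mul_mem_comp hne ha hh₀
      rw [neg_add_cancel] at h1
      obtain ⟨d, hd⟩ := (hr _).1 h1
      refine ⟨ι c * a, ?_, ?_⟩
      · have := mul_mem_comp hne (hb.map_mem_comp hι hr c) ha
        rwa [zero_add] at this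
      · change ι d = _ at hd
        rw [mul_assoc, ← mul_assoc a, ← hd, ← map_mul, ← map_mul, mul_comm]
    | add a _ b _ ha hb =>
      obtain ⟨w, hw, rfl⟩ := ha
      obtain ⟨w', hw', rfl⟩ := hb
      exact ⟨w + w', Submodule.add_mem _ hw hw', by rw [add_mul]⟩
  obtain ⟨w, hw, hw1⟩ := key 1 (hb.one_mem_comp_mul_comp 1)
  have hh₀ne : h₀ ≠ 0 := by
    rintro rfl
    exact hone (by rw [hw1, mul_zero])
  have h4 : h₀ * w = 1 := by
    have h5 : (h₀ * w - 1) * h₀ = 0 := by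
      rw [sub_mul, mul_assoc, ← hw1, mul_one, one_mul, sub_self]
    have h6 : h₀ * w - 1 ∈ comp σ ζ 0 := by
      have := mul_mem_comp hne hh₀ hw
      rw [add_neg_cancel] at this
      exact Submodule.sub_mem _ this one_mem_comp
    exact sub_eq_zero.1 ((reg h6 hh₀ h5).resolve_right hh₀ne)
  exact ⟨⟨h₀, w, h4, hw1.symm⟩, hh₀⟩

/-- The component of degree `0` is an affine algebra if `H` is. -/
lemma finiteType [Algebra.FiniteType k H] : Algebra.FiniteType k D := by
  classical
  have hne := zeta_ne_zero hb.prim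
  choose s v w hv hw hvw using fun i : ℕ =>
    exists_sum_of_mem_mul (hb.one_mem_comp_mul_comp' (i : ℤ))
  -- a finite set of homogeneous generators of `H` as a right module, `1` being the only one of
  -- degree `0`
  let J : Type := Option (Σ i : Fin n, Fin (s i))
  let deg : J → ℕ := fun c => c.elim 0 fun e => e.1
  let b : J → H := fun c => c.elim 1 fun e => if (e.1 : ℕ) = 0 then 0 else v e.1 e.2
  have hbdeg : ∀ c, b c ∈ comp σ ζ (deg c) := by
    rintro (_ | e)
    · exact one_mem_comp
    · simp only [b, deg, Option.elim]
      split_ifs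
      · exact Submodule.zero_mem _
      · exact hv _ _
  have hspan : ∀ h : H, ∃ a : J → D, h = ∑ c, b c * ι (a c) := by
    let N : Submodule k H :=
      { carrier := {h | ∃ a : J → D, h = ∑ c, b c * ι (a c)}
        zero_mem' := ⟨0, by simp⟩
        add_mem' := by
          rintro _ _ ⟨a, rfl⟩ ⟨a', rfl⟩
          exact ⟨a + a', by simp [mul_add, Finset.sum_add_distrib]⟩
        smul_mem' := by
          rintro c _ ⟨a, rfl⟩
          exact ⟨c • a, by simp [Finset.smul_sum]⟩ }
    intro h
    rw [← sum_proj (σ := σ) hb.prim h]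
    refine Submodule.sum_mem N fun i hi => ?_
    have hi' := Finset.mem_range.1 hi
    have hpi := proj_mem hb.prim hb.pow_eq i h
    rcases Nat.eq_zero_or_pos i with rfl | h0
    · obtain ⟨d, hd⟩ := (hr _).1 hpi
      refine ⟨fun c => c.elim d 0, ?_⟩
      rw [Fintype.sum_option]
      simp only [Option.elim, Pi.zero_apply, map_zero, mul_zero, Finset.sum_const_zero, add_zero,
        b, one_mul]
      exact hd.symm
    · have h1 : ∀ e, w i e * proj σ ζ n i h ∈ comp σ ζ 0 := by
        intro e
        have := mul_mem_comp hne (hw i e) hpi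
        rwa [neg_add_cancel] at this
      choose d hd using fun e => (hr _).1 (h1 e)
      have h2 : proj σ ζ n i h = ∑ e, v i e * ι (d e) := by
        conv_lhs => rw [← one_mul (proj σ ζ n i h), hvw i, Finset.sum_mul]
        refine Finset.sum_congr rfl fun e _ => ?_
        rw [mul_assoc]
        congr 1
        exact (hd e).symm
      rw [h2]
      refine Submodule.sum_mem N fun e _ => ?_
      refine ⟨Pi.single (some ⟨⟨i, hi'⟩, e⟩) (d e), ?_⟩
      rw [Finset.sum_eq_single (some ⟨⟨i, hi'⟩, e⟩)]
      · simp [b, h0.ne']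
      · intro c _ hc
        rw [Pi.single_eq_of_ne hc, map_zero, mul_zero]
      · simp
  obtain ⟨S, hS⟩ := Algebra.FiniteType.out (R := k) (A := H)
  choose a ha using fun (x : S) (c : J) => hspan (x * b c)
  -- As in the Artin–Tate lemma, `A₀` is generated by the finitely many structure coefficients. The
  -- right `A₀`-span `N` of the `b c` contains `1` and is stable under the generators of `H`, so it
  -- is all of `H`.
  let A₀ : Subalgebra k D := Algebra.adjoin k (Set.range fun e : S × J × J => a e.1 e.2.1 e.2.2)
  have hA₀ : ∀ x c d, a x c d ∈ A₀ := fun x c d => Algebra.subset_adjoin ⟨(x, c, d), rfl⟩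
  let N : Submodule k H :=
    { carrier := {h | ∃ a : J → D, (∀ c, a c ∈ A₀) ∧ h = ∑ c, b c * ι (a c)}
      zero_mem' := ⟨0, fun _ => zero_mem _, by simp⟩
      add_mem' := by
        rintro _ _ ⟨a, ha, rfl⟩ ⟨a', ha', rfl⟩
        exact ⟨a + a', fun c => add_mem (ha c) (ha' c), by simp [mul_add, Finset.sum_add_distrib]⟩
      smul_mem' := by
        rintro c _ ⟨a, ha, rfl⟩
        exact ⟨c • a, fun d => A₀.smul_mem (ha d) c, by simp [Finset.smul_sum]⟩ }
  have hN1 : (1 : H) ∈ N := by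
    refine ⟨fun c => c.elim 1 0, ?_, ?_⟩
    · rintro (_ | e)
      · exact one_mem _
      · exact zero_mem _
    · rw [Fintype.sum_option]
      simp [b]
  have hgenN : ∀ x : S, ∀ h ∈ N, (x : H) * h ∈ N := by
    rintro x _ ⟨f, hf, rfl⟩
    rw [Finset.mul_sum]
    refine Submodule.sum_mem N fun c _ => ?_
    rw [← mul_assoc, ha x c]
    refine ⟨fun d => a x c d * f c, fun d => mul_mem (hA₀ x c d) (hf c), ?_⟩
    rw [Finset.sum_mul]
    simp only [map_mul, mul_assoc]
  have hN : ∀ h g : H, g ∈ N → h * g ∈ N := by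
    intro h
    have hh : h ∈ Algebra.adjoin k (S : Set H) := by rw [hS]; trivial
    induction hh using Algebra.adjoin_induction with
    | mem x hx => exact fun g hg => hgenN ⟨x, hx⟩ g hg
    | algebraMap c => intro g hg; rw [← Algebra.smul_def]; exact N.smul_mem c hg
    | add p q _ _ hp hq => intro g hg; rw [add_mul]; exact N.add_mem (hp g hg) (hq g hg)
    | mul p q _ _ hp hq => intro g hg; rw [mul_assoc]; exact hp _ (hq g hg)
  refine ⟨?_⟩
  have htop : (⊤ : Subalgebra k D) = A₀ := by
    rw [eq_comm, eq_top_iff]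
    intro d _
    -- In degree `0` only the generator `1` survives, so `d` equals its coefficient, an element of
    -- `A₀`.
    obtain ⟨f, hf, hd⟩ := hN (ι d) 1 hN1
    rw [mul_one] at hd
    have h1 := congrArg (proj σ ζ n 0) hd
    rw [proj_eq_self hb.prim (hb.map_mem_comp hι hr d), map_sum, Fintype.sum_option,
      Finset.sum_eq_zero, add_zero] at h1
    · simp only [b, Option.elim, one_mul] at h1
      rw [proj_eq_self hb.prim (hb.map_mem_comp hι hr _)] at h1
      rw [hι h1]
      exact hf none
    · intro e _
      by_cases h0 : (e.1 : ℕ) = 0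
      · simp only [b, Option.elim, if_pos h0, zero_mul, map_zero]
      · refine proj_eq_zero hb.prim (i := (e.1 : ℕ)) ?_ ?_
        · rw [sub_zero, Int.natCast_dvd_natCast]
          exact fun hd => absurd (Nat.le_of_dvd (by omega) hd) (by have := e.1.2; omega)
        · have := mul_mem_comp hne (hbdeg (some e)) (hb.map_mem_comp hι hr (f (some e)))
          rwa [add_zero] at this
  rw [htop]
  exact Subalgebra.fg_def.2 ⟨_, Set.finite_range _, rfl⟩

end Component

end IsBiwinding

end Grading

/-! ### Consequences of Gelfand–Kirillov dimension one -/

section GKDim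

variable {k : Type*} {H : Type*} [Field k] [Ring H] [Algebra k H]

lemma gkDim_le_zero_of_finite [Module.Finite k H] : gkDim k H ≤ 0 := by
  refine iSup_le fun V => ?_
  set N := Module.finrank k H
  have h1 : Filter.Tendsto (fun m : ℕ => ((Real.log N / Real.log m : ℝ) : EReal)) Filter.atTop
      (nhds ((0 : ℝ) : EReal)) := by
    refine (continuous_coe_real_ereal.tendsto _).comp ?_
    exact Filter.Tendsto.const_div_atTop
      (Real.tendsto_log_atTop.comp tendsto_natCast_atTop_atTop) _
  rw [EReal.coe_zero] at h1
  rw [← h1.limsup_eq]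
  refine Filter.limsup_le_limsup (Filter.Eventually.of_forall fun m => ?_)
  rw [EReal.coe_le_coe_iff]
  have hlog : 0 ≤ Real.log m := Real.log_natCast_nonneg m
  refine div_le_div_of_nonneg_right ?_ hlog
  rcases Nat.eq_zero_or_pos (Module.finrank k ↥((1 ⊔ V.1) ^ m : Submodule k H)) with h0 | h0
  · rw [h0, Nat.cast_zero, Real.log_zero]
    exact Real.log_natCast_nonneg N
  · exact Real.log_le_log (Nat.cast_pos.2 h0) (Nat.cast_le.2 (Submodule.finrank_le _))

/-- If `a` and `b` were algebraically independent, the monomials `aⁱ bʲ` with `i, j ≤ m / 2` would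
make the growth quadratic. -/
lemma algDep_of_gkDim_eq_one (hgk : gkDim k H = 1) {D : Type*} [CommRing D] [Algebra k D]
    {ι : D →ₐ[k] H} (hι : Function.Injective ι) : AlgDep k D := by
  intro a b
  by_contra! hcon
  let E : k[X][X] →ₗ[k] H :=
    { toFun := fun P => ι (P.eval₂ (aeval a : k[X] →ₐ[k] D).toRingHom b)
      map_add' := fun P Q => by rw [eval₂_add, map_add]
      map_smul' := fun c P => by
        rw [RingHom.id_apply, ← map_smul]
        congr 1
        have h1 : c • P = C (C c) * P := by
          rw [Polynomial.C_mul', ← Polynomial.algebraMap_eq, algebraMap_smul]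
        rw [h1, eval₂_mul, eval₂_C, Algebra.smul_def]
        congr 1
        exact aeval_C a c }
  have hE : LinearMap.ker E = ⊥ := by
    rw [LinearMap.ker_eq_bot']
    intro P hP
    by_contra h0
    exact hcon P h0 (hι (hP.trans (map_zero ι).symm))
  have hli : LinearIndependent k fun ij : ℕ × ℕ => ι a ^ ij.1 * ι b ^ ij.2 := by
    have h1 := (((basisMonomials k).smulTower (basisMonomials k[X])).linearIndependent.map' E hE)
    have h2 : (fun ij : ℕ × ℕ => ι a ^ ij.1 * ι b ^ ij.2) =
        E ∘ ((basisMonomials k).smulTower (basisMonomials k[X])) := ?_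
    · rw [h2]; exact h1
    funext ij
    simp only [Function.comp_apply, Module.Basis.smulTower_apply, coe_basisMonomials, E,
      LinearMap.coe_mk, AddHom.coe_mk]
    rw [smul_monomial, smul_eq_mul, mul_one, eval₂_monomial, map_mul, map_pow]
    congr 1
    change _ = ι (aeval a (monomial ij.1 1))
    rw [aeval_monomial, map_one, one_mul, map_pow]
  let V : Submodule k H := Submodule.span k {ι a, ι b}
  have hV : V.FG := Submodule.fg_span (by simp)
  have ha : ι a ∈ (1 ⊔ V : Submodule k H) :=
    Submodule.mem_sup_right (Submodule.subset_span (by simp))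
  have hb : ι b ∈ (1 ⊔ V : Submodule k H) :=
    Submodule.mem_sup_right (Submodule.subset_span (by simp))
  have h1V : (1 : Submodule k H) ≤ 1 ⊔ V := le_sup_left
  have hdim : ∀ m : ℕ, (m / 2 + 1) * (m / 2 + 1) ≤
      Module.finrank k ↥((1 ⊔ V) ^ m : Submodule k H) := by
    intro m
    have hfg : ((1 ⊔ V) ^ m : Submodule k H).FG := by
      refine Submodule.FG.pow (Submodule.FG.sup ?_ hV) m
      rw [Submodule.one_eq_span]
      exact Submodule.fg_span_singleton 1
    have : Module.Finite k ↥((1 ⊔ V) ^ m : Submodule k H) := Module.Finite.iff_fg.2 hfg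
    have hmem : ∀ i j : Fin (m / 2 + 1),
        ι a ^ (i : ℕ) * ι b ^ (j : ℕ) ∈ ((1 ⊔ V) ^ m : Submodule k H) := by
      intro i j
      have h1 := Submodule.mul_mem_mul (Submodule.pow_mem_pow _ ha i) (Submodule.pow_mem_pow _ hb j)
      rw [← pow_add] at h1
      have hle : (i : ℕ) + j ≤ m := by have := i.2; have := j.2; omega
      exact (pow_le_pow_right' (show (1 : Submodule k H) ≤ 1 ⊔ V from h1V) hle) h1
    let f : Fin (m / 2 + 1) × Fin (m / 2 + 1) → ↥((1 ⊔ V) ^ m : Submodule k H) :=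
      fun ij => ⟨_, hmem ij.1 ij.2⟩
    have hf : LinearIndependent k f := by
      refine LinearIndependent.of_comp ((1 ⊔ V) ^ m : Submodule k H).subtype ?_
      refine hli.comp (fun ij : Fin (m / 2 + 1) × Fin (m / 2 + 1) => ((ij.1 : ℕ), (ij.2 : ℕ))) ?_
      rintro ⟨i, j⟩ ⟨i', j'⟩ h
      simp only [Prod.mk.injEq] at h
      exact Prod.ext (Fin.ext h.1) (Fin.ext h.2)
    simpa using hf.fintype_card_le_finrank
  -- The dimension is at least `(m / 2) ^ 2`. Any exponent between `1` and `2` would do; for `3 / 2`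
  -- one needs `2 log (m / 2) ≥ (3 / 2) log m`, that is, `m ≥ 16`.
  have hlim : (((3 / 2 : ℝ)) : EReal) ≤ Filter.limsup (fun m : ℕ =>
      ((Real.log (Module.finrank k ↥((1 ⊔ V) ^ m : Submodule k H)) / Real.log m : ℝ) : EReal))
      Filter.atTop := by
    refine le_trans (Filter.le_liminf_of_le (by isBoundedDefault) ?_) Filter.liminf_le_limsup
    filter_upwards [Filter.eventually_ge_atTop 16] with m hm
    rw [EReal.coe_le_coe_iff]
    have hm' : (16 : ℝ) ≤ m := by exact_mod_cast hm
    have hlog2 : 0 < Real.log 2 := Real.log_pos (by norm_num)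
    have hlogm : 4 * Real.log 2 ≤ Real.log m := by
      have h1 := Real.log_le_log (by norm_num) hm'
      have h2 : Real.log 16 = 4 * Real.log 2 := by
        rw [show (16 : ℝ) = 2 ^ 4 by norm_num, Real.log_pow]
        norm_num
      linarith
    rw [le_div_iff₀ (by linarith)]
    have h3 : ((m : ℝ) / 2) ^ 2 ≤ Module.finrank k ↥((1 ⊔ V) ^ m : Submodule k H) := by
      have h4 : (m : ℝ) / 2 ≤ ((m / 2 + 1 : ℕ) : ℝ) := by
        have : m ≤ 2 * (m / 2 + 1) := by omega
        have : (m : ℝ) ≤ 2 * ((m / 2 + 1 : ℕ) : ℝ) := by exact_mod_cast this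
        linarith
      have h5 : (((m / 2 + 1) * (m / 2 + 1) : ℕ) : ℝ) ≤
          Module.finrank k ↥((1 ⊔ V) ^ m : Submodule k H) := Nat.cast_le.2 (hdim m)
      rw [Nat.cast_mul] at h5
      have h6 : (0 : ℝ) ≤ m / 2 := by positivity
      nlinarith
    have h7 := Real.log_le_log (by positivity) h3
    rw [Real.log_pow, Real.log_div (by positivity) (by norm_num)] at h7
    push_cast at h7
    linarith
  have h8 := le_trans hlim (le_iSup (fun V : {V : Submodule k H // V.FG} =>
    Filter.limsup (fun m : ℕ =>
      ((Real.log (Module.finrank k ↥((1 ⊔ V.1) ^ m : Submodule k H)) / Real.log m : ℝ) : EReal))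
      Filter.atTop) ⟨V, hV⟩)
  change _ ≤ gkDim k H at h8
  rw [hgk, ← EReal.coe_one, EReal.coe_le_coe_iff] at h8
  norm_num at h8

end GKDim

/-! ### The component of degree `0` as a Hopf algebra -/

section Grading

variable {k : Type*} {H : Type*} [Field k] [Ring H] [HopfAlgebra k H]

namespace IsBiwinding

variable {σ : H →ₐ[k] H} {n : ℕ} {ζ : k} [NeZero n] (hb : IsBiwinding σ n ζ)
  {D : Type*} [CommRing D] [Algebra k D] {ι : D →ₐ[k] H}
  (hι : Function.Injective ι) (hr : ∀ h, h ∈ comp σ ζ 0 ↔ h ∈ ι.range)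

section
include hb hι hr

/-- If `D = k`, the strong grading makes every component, hence `H`, finite-dimensional, and the
Gelfand–Kirillov dimension is at most `0`. -/
lemma exists_notMem_range_of_gkDim_eq_one (hgk : gkDim k H = 1) :
    ∃ z : D, z ∉ (algebraMap k D).range := by
  by_contra! hcon
  have hne := zeta_ne_zero hb.prim
  choose s v w hv hw hvw using fun i : ℕ =>
    exists_sum_of_mem_mul (hb.one_mem_comp_mul_comp' (i : ℤ))
  have hfin : Module.Finite k H := by
    refine ⟨Submodule.fg_def.2 ⟨Set.range fun e : Σ i : Fin n, Fin (s i) => v e.1 e.2,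
      Set.finite_range _, ?_⟩⟩
    rw [eq_top_iff]
    intro h _
    rw [← sum_proj (σ := σ) hb.prim h]
    refine Submodule.sum_mem _ fun i hi => ?_
    have hpi := proj_mem hb.prim hb.pow_eq i h
    rw [← one_mul (proj σ ζ n i h), hvw i, Finset.sum_mul]
    refine Submodule.sum_mem _ fun e _ => ?_
    have h1 := mul_mem_comp hne (hw i e) hpi
    rw [neg_add_cancel] at h1
    obtain ⟨d, hd⟩ := (hr _).1 h1
    obtain ⟨c, rfl⟩ := hcon d
    have hd' : algebraMap k H c = w i e * proj σ ζ n i h := (ι.commutes c).symm.trans hd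
    rw [mul_assoc, ← hd', ← Algebra.commutes, ← Algebra.smul_def]
    exact Submodule.smul_mem _ _ (Submodule.subset_span ⟨⟨⟨i, Finset.mem_range.1 hi⟩, e⟩, rfl⟩)
  have := gkDim_le_zero_of_finite (k := k) (H := H)
  rw [hgk] at this
  exact absurd this (not_le.2 zero_lt_one)

lemma map_map_injective : Function.Injective (Algebra.TensorProduct.map ι ι) :=
  TensorProduct.map_injective_of_flat_flat ι.toLinearMap ι.toLinearMap hι hι

lemma map_map_map_injective :
    Function.Injective (Algebra.TensorProduct.map ι (Algebra.TensorProduct.map ι ι)) :=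
  TensorProduct.map_injective_of_flat_flat ι.toLinearMap
    (Algebra.TensorProduct.map ι ι).toLinearMap hι (hb.map_map_injective hι hr)

lemma comul_mem_range (d : D) :
    Bialgebra.comulAlgHom k H (ι d) ∈ (Algebra.TensorProduct.map ι ι).range := by
  change Coalgebra.comul (R := k) (ι d) ∈ _
  rw [hb.comul_eq_map_proj (hb.map_mem_comp hι hr d)]
  induction Coalgebra.comul (R := k) (ι d) with
  | zero => rw [map_zero]; exact zero_mem _
  | add a b ha hb => rw [map_add]; exact add_mem ha hb
  | tmul a b =>
    obtain ⟨c, hc⟩ := (hr _).1 (proj_mem hb.prim hb.pow_eq 0 a)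
    obtain ⟨d, hd⟩ := (hr _).1 (proj_mem hb.prim hb.pow_eq 0 b)
    refine ⟨c ⊗ₜ d, ?_⟩
    rw [TensorProduct.map_tmul, ← hc, ← hd]
    rfl

end

/-- The comultiplication of the component of degree `0`. -/
def comulHom : D →ₐ[k] D ⊗[k] D :=
  (AlgEquiv.ofInjective (Algebra.TensorProduct.map ι ι)
    (hb.map_map_injective hι hr)).symm.toAlgHom.comp
    (((Bialgebra.comulAlgHom k H).comp ι).codRestrict _ (hb.comul_mem_range hι hr))

lemma map_comulHom (d : D) : Algebra.TensorProduct.map ι ι (hb.comulHom hι hr d) =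
    Coalgebra.comul (R := k) (ι d) :=
  congrArg Subtype.val ((AlgEquiv.ofInjective (Algebra.TensorProduct.map ι ι)
    (hb.map_map_injective hι hr)).apply_symm_apply _)

/-- The bialgebra structure of the component of degree `0`. -/
@[reducible]
def bialgebra : Bialgebra k D :=
  Bialgebra.ofAlgHom (hb.comulHom hι hr) ((Bialgebra.counitAlgHom k H).comp ι)
    (by
      apply AlgHom.ext
      intro d
      apply hb.map_map_map_injective hι hr
      have h1 : ∀ (s : D ⊗[k] D) (b : D), Algebra.TensorProduct.map ι (Algebra.TensorProduct.map ι ι)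
          (Algebra.TensorProduct.assoc k k k D D D (s ⊗ₜ b)) =
          TensorProduct.assoc k H H H (Algebra.TensorProduct.map ι ι s ⊗ₜ ι b) := by
        intro s b
        induction s with
        | zero => simp
        | add x y hx hy => simp only [TensorProduct.add_tmul, map_add, hx, hy]
        | tmul x y => simp
      have h2 : ∀ t : D ⊗[k] D, Algebra.TensorProduct.map ι (Algebra.TensorProduct.map ι ι)
          (Algebra.TensorProduct.assoc k k k D D D
            (Algebra.TensorProduct.map (hb.comulHom hι hr) (.id k D) t)) =
          TensorProduct.assoc k H H H ((Coalgebra.comul (R := k)).rTensor H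
            (Algebra.TensorProduct.map ι ι t)) := by
        intro t
        induction t with
        | zero => simp
        | add x y hx hy => simp only [map_add, hx, hy]
        | tmul x y =>
          rw [Algebra.TensorProduct.map_tmul, h1, hb.map_comulHom]
          simp
      have h3 : ∀ t : D ⊗[k] D, Algebra.TensorProduct.map ι (Algebra.TensorProduct.map ι ι)
          (Algebra.TensorProduct.map (.id k D) (hb.comulHom hι hr) t) =
          (Coalgebra.comul (R := k)).lTensor H (Algebra.TensorProduct.map ι ι t) := by
        intro t
        induction t with
        | zero => simp
        | add x y hx hy => simp only [map_add, hx, hy]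
        | tmul x y =>
          rw [Algebra.TensorProduct.map_tmul, Algebra.TensorProduct.map_tmul, hb.map_comulHom]
          simp
      refine (h2 (hb.comulHom hι hr d)).trans (Eq.trans ?_ (h3 (hb.comulHom hι hr d)).symm)
      rw [hb.map_comulHom, Coalgebra.coassoc_apply])
    (by
      apply AlgHom.ext
      intro d
      have h1 : ∀ t : D ⊗[k] D, ι (TensorProduct.lid k D (Algebra.TensorProduct.map
          ((Bialgebra.counitAlgHom k H).comp ι) (.id k D) t)) = TensorProduct.lid k H
          ((Coalgebra.counit (R := k)).rTensor H (Algebra.TensorProduct.map ι ι t)) := by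
        intro t
        induction t with
        | zero => simp
        | add x y hx hy => simp only [map_add, hx, hy]
        | tmul x y => simp
      apply (TensorProduct.lid k D).injective
      apply hι
      refine (h1 (hb.comulHom hι hr d)).trans ?_
      rw [hb.map_comulHom, Coalgebra.rTensor_counit_comul]
      simp)
    (by
      apply AlgHom.ext
      intro d
      have h1 : ∀ t : D ⊗[k] D, ι (TensorProduct.rid k D (Algebra.TensorProduct.map (.id k D)
          ((Bialgebra.counitAlgHom k H).comp ι) t)) = TensorProduct.rid k H
          ((Coalgebra.counit (R := k)).lTensor H (Algebra.TensorProduct.map ι ι t)) := by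
        intro t
        induction t with
        | zero => simp
        | add x y hx hy => simp only [map_add, hx, hy]
        | tmul x y => simp
      apply (TensorProduct.rid k D).injective
      apply hι
      refine (h1 (hb.comulHom hι hr d)).trans ?_
      rw [hb.map_comulHom, Coalgebra.lTensor_counit_comul]
      simp)

/-- The linear projection of `H` to the component of degree `0`. -/
def retract : H →ₗ[k] D :=
  (LinearEquiv.ofInjective ι.toLinearMap hι).symm.toLinearMap ∘ₗ
    (proj σ ζ n 0).codRestrict (LinearMap.range ι.toLinearMap)
      fun h => (hr _).1 (proj_mem hb.prim hb.pow_eq 0 h)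

lemma map_retract (h : H) : ι (hb.retract hι hr h) = proj σ ζ n 0 h :=
  congrArg Subtype.val ((LinearEquiv.ofInjective ι.toLinearMap hι).apply_symm_apply _)

/-- The Hopf algebra structure of the component of degree `0`. -/
@[reducible]
def hopfAlgebra : HopfAlgebra k D :=
  { hb.bialgebra hι hr with
    -- It is not needed that `S` preserves `D`. Projection to degree `0` is `D`-linear on both
    -- sides, so the degree `0` part of `S` satisfies the antipode identities on `D`.
    antipode := hb.retract hι hr ∘ₗ HopfAlgebra.antipode k ∘ₗ ι.toLinearMap
    mul_antipode_rTensor_comul := by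
      apply LinearMap.ext
      intro d
      apply hι
      have h1 : ∀ t : D ⊗[k] D, ι (LinearMap.mul' k D ((hb.retract hι hr ∘ₗ
          HopfAlgebra.antipode k ∘ₗ ι.toLinearMap).rTensor D t)) = proj σ ζ n 0 (LinearMap.mul' k H
          ((HopfAlgebra.antipode k).rTensor H (Algebra.TensorProduct.map ι ι t))) := by
        intro t
        induction t with
        | zero => simp
        | add x y hx hy => simp only [map_add, hx, hy]
        | tmul x y =>
          simp only [LinearMap.rTensor_tmul, LinearMap.mul'_apply, map_mul,
            Algebra.TensorProduct.map_tmul, LinearMap.comp_apply, hb.map_retract]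
          rw [proj_mul hb.prim hb.pow_eq (hb.map_mem_comp hι hr y), sub_zero]
          rfl
      refine (h1 _).trans ?_
      have h2 := hb.map_comulHom hι hr d
      refine Eq.trans (congrArg (fun t => proj σ ζ n 0 (LinearMap.mul' k H
        ((HopfAlgebra.antipode k).rTensor H t))) h2) ?_
      rw [HopfAlgebra.mul_antipode_rTensor_comul_apply, ← ι.commutes,
        proj_eq_self hb.prim (hb.map_mem_comp hι hr _)]
      rfl
    mul_antipode_lTensor_comul := by
      apply LinearMap.ext
      intro d
      apply hι
      have h1 : ∀ t : D ⊗[k] D, ι (LinearMap.mul' k D ((hb.retract hι hr ∘ₗ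
          HopfAlgebra.antipode k ∘ₗ ι.toLinearMap).lTensor D t)) = proj σ ζ n 0 (LinearMap.mul' k H
          ((HopfAlgebra.antipode k).lTensor H (Algebra.TensorProduct.map ι ι t))) := by
        intro t
        induction t with
        | zero => simp
        | add x y hx hy => simp only [map_add, hx, hy]
        | tmul x y =>
          simp only [LinearMap.lTensor_tmul, LinearMap.mul'_apply, map_mul,
            Algebra.TensorProduct.map_tmul, LinearMap.comp_apply, hb.map_retract]
          rw [proj_mul_left hb.prim hb.pow_eq (hb.map_mem_comp hι hr x), sub_zero]
          rfl
      refine (h1 _).trans ?_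
      have h2 := hb.map_comulHom hι hr d
      refine Eq.trans (congrArg (fun t => proj σ ζ n 0 (LinearMap.mul' k H
        ((HopfAlgebra.antipode k).lTensor H t))) h2) ?_
      rw [HopfAlgebra.mul_antipode_lTensor_comul_apply, ← ι.commutes,
        proj_eq_self hb.prim (hb.map_mem_comp hι hr _)]
      rfl }

end IsBiwinding

end Grading

/-! ### Winding automorphisms -/

section Winding

variable {k : Type*} {H : Type*} [Field k] [Ring H] [HopfAlgebra k H]

lemma counit_leftWindingHom (π : H →ₐ[k] k) (h : H) :
    Coalgebra.counit (R := k) (leftWindingHom π h) = π h := by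
  have h1 : ∀ z : H ⊗[k] H, Coalgebra.counit (R := k) (TensorProduct.lid k H
      (TensorProduct.map π.toLinearMap LinearMap.id z)) =
      π (TensorProduct.rid k H ((Coalgebra.counit (R := k)).lTensor H z)) := by
    intro z
    induction z with
    | zero => simp
    | add x y hx hy => simp only [map_add, hx, hy]
    | tmul x y => simp [mul_comm]
  refine (h1 (Coalgebra.comul (R := k) h)).trans ?_
  rw [Coalgebra.lTensor_counit_comul]
  simp

lemma counit_rightWindingHom (π : H →ₐ[k] k) (h : H) :
    Coalgebra.counit (R := k) (rightWindingHom π h) = π h := by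
  have h1 : ∀ z : H ⊗[k] H, Coalgebra.counit (R := k) (TensorProduct.rid k H
      (TensorProduct.map LinearMap.id π.toLinearMap z)) =
      π (TensorProduct.lid k H ((Coalgebra.counit (R := k)).rTensor H z)) := by
    intro z
    induction z with
    | zero => simp
    | add x y hx hy => simp only [map_add, hx, hy]
    | tmul x y => simp [mul_comm]
  refine (h1 (Coalgebra.comul (R := k) h)).trans ?_
  rw [Coalgebra.rTensor_counit_comul]
  simp

lemma comul_leftWindingHom (π : H →ₐ[k] k) (h : H) :
    Coalgebra.comul (R := k) (leftWindingHom π h) =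
      (leftWindingHom π).toLinearMap.rTensor H (Coalgebra.comul (R := k) h) := by
  let G : H ⊗[k] (H ⊗[k] H) →ₗ[k] H ⊗[k] H :=
    (TensorProduct.lid k _).toLinearMap ∘ₗ TensorProduct.map π.toLinearMap LinearMap.id
  have h1 : ∀ z : H ⊗[k] H, Coalgebra.comul (R := k) (TensorProduct.lid k H
      (TensorProduct.map π.toLinearMap LinearMap.id z)) =
      G ((Coalgebra.comul (R := k)).lTensor H z) := by
    intro z
    induction z with
    | zero => simp
    | add x y hx hy => simp only [map_add, hx, hy]
    | tmul x y => simp [G]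
  have h3 : ∀ (z : H ⊗[k] H) (y : H), (TensorProduct.lid k H
      (TensorProduct.map π.toLinearMap LinearMap.id z)) ⊗ₜ[k] y =
      G (TensorProduct.assoc k H H H (z ⊗ₜ y)) := by
    intro z y
    induction z with
    | zero => simp
    | add p q hp hq => simp only [map_add, TensorProduct.add_tmul, hp, hq]
    | tmul p q => simp [G, TensorProduct.smul_tmul']
  have h2 : ∀ z : H ⊗[k] H, (leftWindingHom π).toLinearMap.rTensor H z =
      G (TensorProduct.assoc k H H H ((Coalgebra.comul (R := k)).rTensor H z)) := by
    intro z
    induction z with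
    | zero => simp
    | add x y hx hy => simp only [map_add, hx, hy]
    | tmul x y =>
      rw [LinearMap.rTensor_tmul, LinearMap.rTensor_tmul, ← h3]
      rfl
  refine (h1 (Coalgebra.comul (R := k) h)).trans ?_
  rw [h2, Coalgebra.coassoc_apply]

lemma comul_rightWindingHom (π : H →ₐ[k] k) (h : H) :
    Coalgebra.comul (R := k) (rightWindingHom π h) =
      (rightWindingHom π).toLinearMap.lTensor H (Coalgebra.comul (R := k) h) := by
  let G : H ⊗[k] (H ⊗[k] H) →ₗ[k] H ⊗[k] H :=
    LinearMap.lTensor H ((TensorProduct.rid k _).toLinearMap ∘ₗ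
      TensorProduct.map LinearMap.id π.toLinearMap)
  have h3 : ∀ (z : H ⊗[k] H) (y : H), π y • z = G (TensorProduct.assoc k H H H (z ⊗ₜ y)) := by
    intro z y
    induction z with
    | zero => simp
    | add p q hp hq => simp only [map_add, smul_add, TensorProduct.add_tmul, hp, hq]
    | tmul p q => simp [G]
  have h1 : ∀ z : H ⊗[k] H, Coalgebra.comul (R := k) (TensorProduct.rid k H
      (TensorProduct.map LinearMap.id π.toLinearMap z)) =
      G (TensorProduct.assoc k H H H ((Coalgebra.comul (R := k)).rTensor H z)) := by
    intro z
    induction z with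
    | zero => simp
    | add x y hx hy => simp only [map_add, hx, hy]
    | tmul x y => rw [LinearMap.rTensor_tmul, ← h3]; simp
  have h2 : ∀ z : H ⊗[k] H, (rightWindingHom π).toLinearMap.lTensor H z =
      G ((Coalgebra.comul (R := k)).lTensor H z) := by
    intro z
    induction z with
    | zero => simp
    | add x y hx hy => simp only [map_add, hx, hy]
    | tmul x y =>
      rw [LinearMap.lTensor_tmul, LinearMap.lTensor_tmul, LinearMap.lTensor_tmul]
      rfl
  refine (h1 (Coalgebra.comul (R := k) h)).trans ?_
  rw [h2, Coalgebra.coassoc_apply]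

lemma leftWindingHom_pow (π : H →ₐ[k] k) (j : ℕ) :
    leftWindingHom π ^ j = leftWindingHom (toConv π ^ j).ofConv := by
  induction j with
  | zero => rw [pow_zero, pow_zero, leftWindingHom_one]; rfl
  | succ j ih =>
    rw [pow_succ', ih, pow_succ]
    exact leftWindingHom_comp _ _

lemma exists_eq_rightWinding {π : H →ₐ[k] k} {f : H ≃ₐ[k] H} (hf : f ∈ rightGroup π) :
    ∃ ρ : H →ₐ[k] k, f = rightWinding ρ := by
  induction hf using Subgroup.closure_induction with
  | mem f hf => exact ⟨π, hf⟩
  | one => exact ⟨_, AlgEquiv.ext fun a => (DFunLike.congr_fun rightWindingHom_one a).symm⟩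
  | mul f g _ _ hf hg =>
    obtain ⟨ρ, rfl⟩ := hf
    obtain ⟨ρ', rfl⟩ := hg
    exact ⟨_, AlgEquiv.ext fun a => DFunLike.congr_fun (rightWindingHom_comp ρ ρ') a⟩
  | inv f _ hf =>
    obtain ⟨ρ, rfl⟩ := hf
    exact ⟨charInv ρ, AlgEquiv.ext fun a => rfl⟩

/-- Index one places the left winding automorphism in the right group, which consists of right
winding automorphisms. Composing with the counit recovers the character of a winding on either side,
so the two characters agree. -/
lemma leftWindingHom_eq_rightWindingHom {π : H →ₐ[k] k} (h : windingIndex π = 1) :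
    leftWindingHom π = rightWindingHom π := by
  obtain ⟨ρ, hρ⟩ := exists_eq_rightWinding
    (Subgroup.relIndex_eq_one.1 h (Subgroup.subset_closure rfl))
  have h3 : ∀ a, leftWindingHom π a = rightWindingHom ρ a := fun a =>
    DFunLike.congr_fun hρ a
  have h4 : π = ρ := by
    ext a
    rw [← counit_leftWindingHom, h3, counit_rightWindingHom]
  ext a
  rw [h3, ← h4]

lemma mem_invariants_closure {f : H ≃ₐ[k] H} {h : H} :
    h ∈ invariants (Subgroup.closure {f}) ↔ f h = h := by
  refine ⟨fun hh => hh f (Subgroup.subset_closure rfl), fun hf g hg => ?_⟩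
  induction hg using Subgroup.closure_induction with
  | mem g hg => rw [Set.mem_singleton_iff.1 hg]; exact hf
  | one => rfl
  | mul a b _ _ ha hb => rw [AlgEquiv.mul_apply, hb, ha]
  | inv a _ ha =>
    conv_lhs => rw [← ha]
    exact a.symm_apply_apply h

lemma mem_classicalComponent {π : H →ₐ[k] k} (heq : leftWindingHom π = rightWindingHom π) {h : H} :
    h ∈ classicalComponent π ↔ leftWindingHom π h = h := by
  have h1 : rightWinding π = leftWinding π := AlgEquiv.ext fun a => DFunLike.congr_fun heq.symm a
  rw [classicalComponent, rightGroup, h1, leftGroup, sup_idem, mem_invariants_closure]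
  rfl

lemma windingIndex_eq_one_of_isCocomm [Coalgebra.IsCocomm k H] (χ : H →ₐ[k] k) :
    windingIndex χ = 1 := by
  have h1 : rightWinding χ = leftWinding χ := by
    apply AlgEquiv.ext
    intro a
    have h2 : ∀ z : H ⊗[k] H, TensorProduct.rid k H (TensorProduct.map LinearMap.id χ.toLinearMap z)
        = TensorProduct.lid k H (TensorProduct.map χ.toLinearMap LinearMap.id
          (TensorProduct.comm k H H z)) := by
      intro z
      induction z with
      | zero => simp
      | add x y hx hy => simp only [map_add, hx, hy]
      | tmul x y => simp
    refine (h2 (Coalgebra.comul (R := k) a)).trans ?_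
    rw [Coalgebra.comm_comul]
    rfl
  rw [windingIndex, rightGroup, leftGroup, h1]
  exact Subgroup.relIndex_self _

lemma isBiwinding_leftWindingHom {π : H →ₐ[k] k} {n : ℕ} {ζ : k} (hζ : IsPrimitiveRoot ζ n)
    (hord : charOrder π = n) (heq : leftWindingHom π = rightWindingHom π) :
    IsBiwinding (leftWindingHom π) n ζ where
  prim := hζ
  pow_eq := by
    rw [leftWindingHom_pow, ← hord, charOrder, pow_orderOf_eq_one, leftWindingHom_one]
    rfl
  comul_left := comul_leftWindingHom π
  comul_right h := by rw [heq]; exact comul_rightWindingHom π h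
  counit_inj i hi j hj h := by
    simp only [leftWindingHom_pow, counit_leftWindingHom] at h
    have h1 : toConv π ^ i = toConv π ^ j := WithConv.ofConv_injective (AlgHom.ext h)
    rw [← hord] at hi hj
    exact pow_injOn_Iio_orderOf hi hj h1

end Winding

/-! ### Embedding into matrices -/

section PIDegree

universe u v

variable {k : Type u} {H : Type v} [Field k] [Ring H] [Algebra k H]

/-- A ring graded by a cyclic group of order `d` with a unit of degree `1` embeds into the matrices
over its component of degree `0`, if that is commutative. -/
lemma exists_matrix_embedding {τ : H →ₐ[k] H} {η : k} {d : ℕ} [NeZero d]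
    (hη : IsPrimitiveRoot η d) (hτ : τ ^ d = 1) {u : Hˣ} (hu : (u : H) ∈ comp τ η 1)
    (hcomm : ∀ a b : H, τ a = a → τ b = b → a * b = b * a) :
    ∃ (C : Type v) (_ : CommRing C) (f : H →+* Matrix (Fin d) (Fin d) C),
      Function.Injective f := by
  have hne := zeta_ne_zero hη
  let R : Subring H :=
    { carrier := {h | τ h = h}
      mul_mem' := fun {a b} ha hb => by
        change τ (a * b) = a * b
        rw [map_mul, show τ a = a from ha, show τ b = b from hb]
      one_mem' := map_one τ
      add_mem' := fun {a b} ha hb => by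
        change τ (a + b) = a + b
        rw [map_add, show τ a = a from ha, show τ b = b from hb]
      zero_mem' := map_zero τ
      neg_mem' := fun {a} ha => by
        change τ (-a) = -a
        rw [map_neg, show τ a = a from ha] }
  let _ : CommRing R :=
    { (inferInstance : Ring R) with mul_comm := fun a b => Subtype.ext (hcomm a b a.2 b.2) }
  have hupow : ∀ i : ℕ, ((u ^ i : Hˣ) : H) ∈ comp τ η i := by
    intro i
    induction i with
    | zero => simpa using one_mem_comp
    | succ i ih =>
      rw [pow_succ, Units.val_mul, Nat.cast_succ]
      exact mul_mem_comp hne ih hu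
  have hcoef : ∀ (i : ℕ) (h : H), τ (↑(u ^ i)⁻¹ * proj τ η d i h) = ↑(u ^ i)⁻¹ * proj τ η d i h := by
    intro i h
    apply (u ^ i).isUnit.mul_left_cancel
    rw [Units.mul_inv_cancel_left]
    have h2 : τ (↑(u ^ i) * (↑(u ^ i)⁻¹ * proj τ η d i h)) = η ^ (i : ℤ) • proj τ η d i h := by
      rw [Units.mul_inv_cancel_left]; exact proj_mem hη hτ i h
    rw [map_mul, mem_comp.1 (hupow i), smul_mul_assoc] at h2
    exact smul_right_injective H (zpow_ne_zero _ hne) h2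
  -- `H` is free as a right `R`-module on the `u ^ i`, `i < d`, with these coordinates. The
  -- embedding is the matrix of left multiplication in this basis.
  let c : ℕ → H → R := fun i h => ⟨↑(u ^ i)⁻¹ * proj τ η d i h, hcoef i h⟩
  have hc : ∀ i h, ((u ^ i : Hˣ) : H) * (c i h : H) = proj τ η d i h := fun i h =>
    Units.mul_inv_cancel_left _ _
  have hcadd : ∀ i g h, c i (g + h) = c i g + c i h := fun i g h => Subtype.ext (by
    change _ = (c i g : H) + (c i h : H)
    simp only [c, map_add, mul_add])
  have hcmul : ∀ i h (r : R), c i (h * r) = c i h * r := fun i h r => Subtype.ext (by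
    change _ = (c i h : H) * (r : H)
    simp only [c]
    rw [proj_mul hη hτ (mem_comp_zero.2 r.2), sub_zero, mul_assoc])
  have hcsum : ∀ h, h = ∑ i ∈ Finset.range d, ((u ^ i : Hˣ) : H) * (c i h : H) := fun h => by
    simp only [hc]
    exact (sum_proj (σ := τ) hη h).symm
  have hczero : ∀ i, c i 0 = 0 := fun i => Subtype.ext (by
    change _ = (0 : H)
    simp only [c, map_zero, mul_zero])
  have hcfin : ∀ (i : ℕ) (s : Finset ℕ) (f : ℕ → H), c i (∑ j ∈ s, f j) = ∑ j ∈ s, c i (f j) := by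
    intro i s f
    exact map_sum (AddMonoidHom.mk' (c i) (hcadd i)) f s
  let M : H → Matrix (Fin d) (Fin d) R := fun h => Matrix.of fun i j => c i (h * (u ^ (j : ℕ) : Hˣ))
  have hM1 : M 1 = 1 := by
    ext i j
    rw [Matrix.one_apply]
    simp only [M, Matrix.of_apply, one_mul, c]
    split_ifs with hij
    · subst hij
      rw [proj_eq_self hη (hupow _), Units.inv_mul]
      rfl
    · rw [proj_eq_zero hη _ (hupow j), mul_zero]
      · rfl
      · intro hdvd
        apply hij
        apply Fin.ext
        have h1 := i.2
        have h2 := j.2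
        obtain ⟨q, hq⟩ := hdvd
        have : q = 0 := by nlinarith
        subst this
        omega
  have hMmul : ∀ g h, M (g * h) = M g * M h := by
    intro g h
    apply Matrix.ext
    intro i j
    rw [Matrix.mul_apply]
    simp only [M, Matrix.of_apply]
    rw [mul_assoc]
    conv_lhs => rw [hcsum (h * (u ^ (j : ℕ) : Hˣ)), Finset.mul_sum, hcfin]
    rw [Finset.sum_range]
    refine Finset.sum_congr rfl fun l _ => ?_
    rw [← mul_assoc, hcmul]
  have hM0 : M 0 = 0 := by
    ext i j
    simp [M, hczero]
  have hMadd : ∀ g h, M (g + h) = M g + M h := by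
    intro g h
    ext i j
    simp only [M, Matrix.of_apply, Matrix.add_apply, add_mul, hcadd]
  refine ⟨R, inferInstance, RingHom.mk ⟨⟨M, hM1⟩, hMmul⟩ hM0 hMadd, ?_⟩
  rw [injective_iff_map_eq_zero]
  intro h hh
  refine eq_zero_of_forall_proj (σ := τ) hη fun i hi => ?_
  -- Column `0` of the matrix contains the coordinates of `h * 1`, so it determines `h`.
  have h1 := congrFun (congrFun hh ⟨i, hi⟩) ⟨0, NeZero.pos d⟩
  rw [← hc]
  have h2 : c i h = 0 := by
    have h3 : c i (h * (u ^ 0 : Hˣ)) = 0 := h1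
    rwa [pow_zero, Units.val_one, mul_one] at h3
  rw [h2]
  exact mul_zero _

end PIDegree

/-! ### The unit of degree one -/

section UnitComponent

universe u v

variable {k : Type u} {H : Type v} [Field k] [Ring H] [HopfAlgebra k H]

namespace IsBiwinding

variable {σ : H →ₐ[k] H} {n : ℕ} {ζ : k} [NeZero n] (hb : IsBiwinding σ n ζ)
  {D : Type*} [CommRing D] [Algebra k D] {ι : D →ₐ[k] H}
  (hι : Function.Injective ι) (hr : ∀ h, h ∈ comp σ ζ 0 ↔ h ∈ ι.range)
  {u : Hˣ} (hu : (u : H) ∈ comp σ ζ 1)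
include hb hι hr hu

omit hι hr in
lemma pow_mem_comp (i : ℕ) : ((u ^ i : Hˣ) : H) ∈ comp σ ζ i := by
  induction i with
  | zero => simpa using one_mem_comp
  | succ i ih =>
    rw [pow_succ, Units.val_mul, Nat.cast_succ]
    exact mul_mem_comp (zeta_ne_zero hb.prim) ih hu

lemma exists_eq_pow_mul {i : ℕ} {h : H} (hh : h ∈ comp σ ζ i) :
    ∃ d, h = ((u ^ i : Hˣ) : H) * ι d :=
  hb.exists_mul_eq_of_mem_comp hι hr (hb.pow_mem_comp hu i) hh

omit hι hr in
lemma inv_mem_comp : ((u⁻¹ : Hˣ) : H) ∈ comp σ ζ (-1) := by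
  have h1 := map_mul σ (u : H) (↑u⁻¹ : H)
  rw [Units.mul_inv, map_one, mem_comp.1 hu, zpow_one, smul_mul_assoc] at h1
  have hne := zeta_ne_zero hb.prim
  rw [mem_comp, zpow_neg, zpow_one]
  apply u.isUnit.mul_left_cancel
  rw [mul_smul_comm, Units.mul_inv, h1, smul_smul, inv_mul_cancel₀ hne, one_smul]

lemma exists_conj (d : D) : ∃ d', ((u⁻¹ : Hˣ) : H) * ι d * u = ι d' := by
  have hne := zeta_ne_zero hb.prim
  have h1 := mul_mem_comp hne (mul_mem_comp hne (hb.inv_mem_comp hu) (hb.map_mem_comp hι hr d)) hu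
  rw [add_zero, neg_add_cancel] at h1
  obtain ⟨d', hd'⟩ := (hr _).1 h1
  exact ⟨d', hd'.symm⟩

lemma exists_conj' (d : D) : ∃ d', (u : H) * ι d * ((u⁻¹ : Hˣ) : H) = ι d' := by
  have hne := zeta_ne_zero hb.prim
  have h1 := mul_mem_comp hne (mul_mem_comp hne hu (hb.map_mem_comp hι hr d)) (hb.inv_mem_comp hu)
  rw [add_zero, add_neg_cancel] at h1
  obtain ⟨d', hd'⟩ := (hr _).1 h1
  exact ⟨d', hd'.symm⟩

lemma exists_pow_eq : ∃ c : D, IsUnit c ∧ ((u ^ n : Hˣ) : H) = ι c := by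
  have h1 : ∀ w : Hˣ, (w : H) ∈ comp σ ζ 1 ∨ (w : H) ∈ comp σ ζ (-1) →
      ((w ^ n : Hˣ) : H) ∈ comp σ ζ 0 := by
    rintro w hw
    rw [mem_comp_zero, Units.val_pow_eq_pow_val, map_pow]
    rcases hw with hw | hw <;>
    rw [mem_comp.1 hw, _root_.smul_pow, zpow_pow_eq_one hb.prim, one_smul]
  obtain ⟨c, hc⟩ := (hr _).1 (h1 u (.inl hu))
  obtain ⟨d, hd⟩ := (hr _).1 (h1 u⁻¹ (.inr (hb.inv_mem_comp hu)))
  change ι c = _ at hc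
  change ι d = _ at hd
  refine ⟨c, IsUnit.of_mul_eq_one d (hι ?_), hc.symm⟩
  rw [map_mul, hc, hd, map_one, inv_pow, Units.mul_inv]

/-- A subspace that contains the component of degree `0` and is closed under left multiplication by
`u` is everything. -/
lemma mem_of_unit_mul_mem {N : Submodule k H} (h0 : ∀ d, ι d ∈ N) (hN : ∀ h ∈ N, (u : H) * h ∈ N)
    (h : H) : h ∈ N := by
  refine mem_of_forall_comp_le hb.prim hb.pow_eq (fun i h hh => ?_) h
  obtain ⟨d, rfl⟩ := hb.exists_eq_pow_mul hι hr hu hh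
  clear hh
  induction i with
  | zero => simpa using h0 d
  | succ i ih => rw [pow_succ', Units.val_mul, mul_assoc]; exact hN _ ih

/-- If a power of the unit of degree `1` centralizes the component of degree `0`, the PI-degree is
bounded by the exponent. -/
lemma le_of_hasPIDegree (hpi : HasPIDegree H n) {d : ℕ} (hdn : d ∣ n)
    (hcent : ∀ c : D, ((u ^ d : Hˣ) : H) * ι c = ι c * ((u ^ d : Hˣ) : H)) : n ≤ d := by
  obtain ⟨m, hm⟩ := hdn
  have hn : 0 < n := NeZero.pos n
  have hd : 0 < d := Nat.pos_of_ne_zero (by rintro rfl; omega)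
  have hmpos : 0 < m := Nat.pos_of_ne_zero (by rintro rfl; omega)
  have : NeZero d := ⟨hd.ne'⟩
  -- With `n = d m`, the automorphism `σ ^ m` has `d`-th power `1` and `u` has degree `1` for it.
  -- Its fixed ring is spanned by the `u ^ (d j) D`, which commute by hypothesis.
  have hη : IsPrimitiveRoot (ζ ^ m) d := hb.prim.pow hn (by rw [hm, mul_comm])
  have hτ : (σ ^ m) ^ d = 1 := by rw [← pow_mul, mul_comm, ← hm, hb.pow_eq]
  refine hpi.2 (exists_matrix_embedding hη hτ (u := u) ?_ ?_)
  · rw [mem_comp, pow_apply_of_mem_comp hu, zpow_one, zpow_one]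
  · have key : ∀ a : H, (σ ^ m) a = a → a ∈ Submodule.span k
        {b | ∃ (j : ℕ) (c : D), b = ((u ^ d : Hˣ) : H) ^ j * ι c} := by
      intro a ha
      rw [← sum_proj (σ := σ) hb.prim a]
      refine Submodule.sum_mem _ fun i _ => ?_
      have hp := proj_mem hb.prim hb.pow_eq i a
      by_cases hdi : d ∣ i
      · obtain ⟨j, rfl⟩ := hdi
        obtain ⟨c, hc⟩ := hb.exists_eq_pow_mul hι hr hu hp
        refine Submodule.subset_span ⟨j, c, ?_⟩
        rw [hc, pow_mul, Units.val_pow_eq_pow_val (u ^ d)]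
      · have h1 : (σ ^ m) (proj σ ζ n i a) = proj σ ζ n i a := by
          rw [proj_apply, map_smul, map_sum]
          congr 1
          refine Finset.sum_congr rfl fun j _ => ?_
          rw [map_smul, ← AlgHom.mul_apply, ← pow_add, add_comm, pow_add, AlgHom.mul_apply, ha]
        rw [pow_apply_of_mem_comp hp] at h1
        have h2 : ((ζ ^ (i : ℤ)) ^ m - 1) • proj σ ζ n i a = 0 := by
          rw [sub_smul, h1, one_smul, sub_self]
        rcases smul_eq_zero.1 h2 with h3 | h3
        · exfalso
          apply hdi
          rw [sub_eq_zero, zpow_natCast, ← pow_mul, hb.prim.pow_eq_one_iff_dvd, hm] at h3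
          exact Nat.dvd_of_mul_dvd_mul_right hmpos h3
        · rw [h3]; exact Submodule.zero_mem _
    intro a b ha hb'
    have hcomm : ∀ c : D, Commute ((u ^ d : Hˣ) : H) (ι c) := hcent
    have h1 := key a ha
    have h2 := key b hb'
    clear ha hb'
    change Commute a b
    induction h1 using Submodule.span_induction with
    | zero => exact Commute.zero_left _
    | add x y _ _ hx hy => exact hx.add_left hy
    | smul c x _ hx => exact hx.smul_left c
    | mem x hx =>
      obtain ⟨j, c, rfl⟩ := hx
      induction h2 using Submodule.span_induction with
      | zero => exact Commute.zero_right _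
      | add x y _ _ hx hy => exact hx.add_right hy
      | smul c x _ hx => exact hx.smul_right c
      | mem x hx =>
        obtain ⟨j', c', rfl⟩ := hx
        refine Commute.mul_left (Commute.mul_right ?_ ?_) (Commute.mul_right ?_ ?_)
        · exact ((Commute.refl _).pow_left j).pow_right j'
        · exact (hcomm c').pow_left j
        · exact ((hcomm c).pow_left j').symm
        · change ι c * ι c' = ι c' * ι c
          rw [← map_mul, mul_comm, map_mul]

/-- `Δ(u)` lies in `H_1 ⊗ H_1 = (u ⊗ u)(D ⊗ D)`. The same for `u⁻¹`, with `u⁻¹ ⊗ u⁻¹` on the right,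
provides the inverse of `w`. -/
lemma exists_comul_unit : ∃ w : D ⊗[k] D, IsUnit w ∧ Coalgebra.comul (R := k) (u : H) =
    ((u : H) ⊗ₜ[k] (u : H)) * Algebra.TensorProduct.map ι ι w := by
  have h1 : ∀ t : H ⊗[k] H, ∃ w : D ⊗[k] D, TensorProduct.map (proj σ ζ n 1) (proj σ ζ n 1) t =
      ((u : H) ⊗ₜ[k] (u : H)) * Algebra.TensorProduct.map ι ι w := by
    intro t
    induction t with
    | zero => exact ⟨0, by simp⟩
    | add x y hx hy =>
      obtain ⟨w, hw⟩ := hx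
      obtain ⟨w', hw'⟩ := hy
      exact ⟨w + w', by rw [map_add, map_add, mul_add, hw, hw']⟩
    | tmul x y =>
      obtain ⟨c, hc⟩ := hb.exists_mul_eq_of_mem_comp hι hr hu (proj_mem hb.prim hb.pow_eq 1 x)
      obtain ⟨d, hd⟩ := hb.exists_mul_eq_of_mem_comp hι hr hu (proj_mem hb.prim hb.pow_eq 1 y)
      refine ⟨c ⊗ₜ d, ?_⟩
      rw [TensorProduct.map_tmul, hc, hd, Algebra.TensorProduct.map_tmul,
        Algebra.TensorProduct.tmul_mul_tmul]
  have hright : ∀ h ∈ comp σ ζ (-1), ∃ d, h = ι d * ((u⁻¹ : Hˣ) : H) := by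
    intro h hh
    have h2 := mul_mem_comp (zeta_ne_zero hb.prim) hh hu
    rw [neg_add_cancel] at h2
    obtain ⟨d, hd⟩ := (hr _).1 h2
    exact ⟨d, (Units.eq_mul_inv_iff_mul_eq u).2 hd.symm⟩
  have h2 : ∀ t : H ⊗[k] H, ∃ w : D ⊗[k] D,
      TensorProduct.map (proj σ ζ n (-1)) (proj σ ζ n (-1)) t =
      Algebra.TensorProduct.map ι ι w * (((u⁻¹ : Hˣ) : H) ⊗ₜ[k] ((u⁻¹ : Hˣ) : H)) := by
    intro t
    induction t with
    | zero => exact ⟨0, by simp⟩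
    | add x y hx hy =>
      obtain ⟨w, hw⟩ := hx
      obtain ⟨w', hw'⟩ := hy
      exact ⟨w + w', by rw [map_add, map_add, add_mul, hw, hw']⟩
    | tmul x y =>
      obtain ⟨c, hc⟩ := hright _ (proj_mem hb.prim hb.pow_eq (-1) x)
      obtain ⟨d, hd⟩ := hright _ (proj_mem hb.prim hb.pow_eq (-1) y)
      refine ⟨c ⊗ₜ d, ?_⟩
      rw [TensorProduct.map_tmul, hc, hd, Algebra.TensorProduct.map_tmul,
        Algebra.TensorProduct.tmul_mul_tmul]
  obtain ⟨w, hw⟩ := h1 (Coalgebra.comul (R := k) (u : H))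
  obtain ⟨w', hw'⟩ := h2 (Coalgebra.comul (R := k) ((u⁻¹ : Hˣ) : H))
  rw [← hb.comul_eq_map_proj hu] at hw
  rw [← hb.comul_eq_map_proj (hb.inv_mem_comp hu)] at hw'
  refine ⟨w, IsUnit.of_mul_eq_one w' (hb.map_map_injective hι hr ?_), hw⟩
  have h3 : Coalgebra.comul (R := k) ((u⁻¹ : Hˣ) : H) * Coalgebra.comul (R := k) (u : H) = 1 := by
    rw [← Bialgebra.comul_mul, Units.inv_mul, Bialgebra.comul_one]
  rw [hw, hw', mul_assoc, ← mul_assoc (((u⁻¹ : Hˣ) : H) ⊗ₜ[k] ((u⁻¹ : Hˣ) : H)),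
    Algebra.TensorProduct.tmul_mul_tmul, Units.inv_mul, ← Algebra.TensorProduct.one_def, one_mul,
    ← map_mul, mul_comm] at h3
  rw [h3, map_one]

/-- The slices of `w` are units of `D` of counit `1`, hence group-like by `hunits`. Distinct
group-like elements are linearly independent, so a family of them parametrised by the points of a
domain is constant; it equals `1` at the identity. -/
lemma comul_unit [IsAlgClosed k] [IsDomain D] [Algebra.FiniteType k D]
    (hε : Coalgebra.counit (R := k) (u : H) = 1)
    (hunits : ∀ a : D, IsUnit a → Coalgebra.counit (R := k) (ι a) = 1 → IsGroupLikeElem k (ι a)) :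
    Coalgebra.comul (R := k) (u : H) = (u : H) ⊗ₜ[k] (u : H) := by
  obtain ⟨w, hw, hΔ⟩ := hb.exists_comul_unit hι hr hu
  let ε : D →ₐ[k] k := (Bialgebra.counitAlgHom k H).comp ι
  have hs1 : slice ε w = 1 := by
    have h1 : ∀ t : D ⊗[k] D, TensorProduct.rid k H ((Coalgebra.counit (R := k)).lTensor H
        (((u : H) ⊗ₜ[k] (u : H)) * Algebra.TensorProduct.map ι ι t)) = u * ι (slice ε t) := by
      intro t
      induction t with
      | zero => simp
      | add x y hx hy => simp only [map_add, mul_add, hx, hy]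
      | tmul x y => simp [hε, ε]
    have h2 := h1 w
    rw [← hΔ, Coalgebra.lTensor_counit_comul, TensorProduct.rid_tmul, one_smul] at h2
    apply hι
    apply u.isUnit.mul_left_cancel
    rw [← h2, map_one, mul_one]
  have hs2 : ∀ g : D →ₐ[k] k, Coalgebra.counit (R := k) (ι (slice g w)) = 1 := by
    intro g
    let s' : D ⊗[k] D →ₗ[k] D :=
      (TensorProduct.lid k D).toLinearMap ∘ₗ ε.toLinearMap.rTensor D
    have h1 : ∀ t : D ⊗[k] D, TensorProduct.lid k H ((Coalgebra.counit (R := k)).rTensor H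
        (((u : H) ⊗ₜ[k] (u : H)) * Algebra.TensorProduct.map ι ι t)) = u * ι (s' t) := by
      intro t
      induction t with
      | zero => simp
      | add x y hx hy => simp only [map_add, mul_add, hx, hy]
      | tmul x y => simp [hε, ε, s']
    have h2 := h1 w
    rw [← hΔ, Coalgebra.rTensor_counit_comul, TensorProduct.lid_tmul, one_smul] at h2
    have h3 : s' w = 1 := by
      apply hι
      apply u.isUnit.mul_left_cancel
      rw [← h2, map_one, mul_one]
    have h4 : ∀ t : D ⊗[k] D, Coalgebra.counit (R := k) (ι (slice g t)) = g (s' t) := by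
      intro t
      induction t with
      | zero => simp
      | add x y hx hy => simp only [map_add, hx, hy]
      | tmul x y => simp [ε, s', mul_comm]
    rw [h4, h3, map_one]
  have hgl : ∀ g : D →ₐ[k] k, IsGroupLikeElem k (ι (slice g w)) := fun g =>
    hunits _ (hw.map (slice g)) (hs2 g)
  have hconst : ∀ g : D →ₐ[k] k, slice g w = 1 := by
    intro g₀
    by_contra hne
    have hne' : ι (slice g₀ w) ≠ 1 := fun h => hne (hι (h.trans (map_one ι).symm))
    have hli := (linearIndepOn_isGroupLikeElem (R := k) (A := H)).notMem_span (hgl g₀)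
    obtain ⟨l, hl, hker⟩ := Submodule.exists_le_ker_of_notMem hli
    have hl0 : ∀ a, IsGroupLikeElem k a → a ≠ ι (slice g₀ w) → l a = 0 := fun a ha hne =>
      hker (Submodule.subset_span ⟨a, ⟨ha, hne⟩, rfl⟩)
    -- `l` kills every group-like element except the slice at `g₀`. So the function `z` takes only
    -- the values `0` and `c`, and in a domain it is one of these constants; but it is `0` at the
    -- identity and `c ≠ 0` at `g₀`.
    obtain ⟨z, hz⟩ := exists_eval_eq_slice (l ∘ₗ ι.toLinearMap) w
    set c := l (ι (slice g₀ w))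
    have hz2 : z * (z - algebraMap k D c) = 0 := by
      refine eq_zero_of_forall_pt (k := k) _ fun g => ?_
      rw [map_mul, map_sub, AlgHom.commutes, hz]
      change l (ι (slice g w)) * (l (ι (slice g w)) - c) = 0
      by_cases h : ι (slice g w) = ι (slice g₀ w)
      · rw [h, sub_self, mul_zero]
      · rw [hl0 _ (hgl g) h, zero_mul]
    have hε0 : ε z = 0 := by
      rw [hz]
      change l (ι (slice ε w)) = 0
      rw [hs1, map_one]
      exact hl0 1 .one hne'.symm
    have hg0 : g₀ z = c := hz g₀
    rcases mul_eq_zero.1 hz2 with h | h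
    · rw [h, map_zero] at hg0
      exact hl hg0.symm
    · rw [sub_eq_zero.1 h, AlgHom.commutes] at hε0
      exact hl hε0
  have hw1 : w = 1 := by
    rw [← sub_eq_zero]
    refine tensor_eq_zero_of_forall_slice (k := k) _ fun g => ?_
    rw [map_sub, hconst, map_one, sub_self]
  rw [hΔ, hw1, map_one, mul_one]

end IsBiwinding

end UnitComponent

/-! ### Laurent polynomials -/

section Laurent

variable {k : Type*} [Field k]

lemma isPrincipalIdealRing_laurentPolynomial : IsPrincipalIdealRing (LaurentPolynomial k) := by
  refine ⟨fun I => ?_⟩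
  have h1 := IsLocalization.map_under (Submonoid.powers (X : k[X])) (LaurentPolynomial k) I
  obtain ⟨g, hg⟩ := (IsPrincipalIdealRing.principal
    (I.under k[X])).principal
  refine ⟨algebraMap k[X] (LaurentPolynomial k) g, ?_⟩
  rw [← h1, hg]
  change Ideal.map _ (Ideal.span {g}) = Ideal.span _
  rw [Ideal.map_span, Set.image_singleton]

/-- After clearing powers of `T`, a unit becomes a divisor of a power of the prime `X` in `k[X]`. -/
lemma exists_eq_C_mul_T_of_isUnit {a : LaurentPolynomial k} (ha : IsUnit a) :
    ∃ (c : k) (m : ℤ), a = LaurentPolynomial.C c * LaurentPolynomial.T m := by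
  obtain ⟨b, hab⟩ := ha.exists_right_inv
  obtain ⟨n, p, hp⟩ := LaurentPolynomial.exists_T_pow a
  obtain ⟨m, q, hq⟩ := LaurentPolynomial.exists_T_pow b
  have h1 : p * q = X ^ (n + m) := by
    apply toLaurent_injective
    rw [map_mul, hp, hq, toLaurent_X_pow, Nat.cast_add, LaurentPolynomial.T_add]
    linear_combination (LaurentPolynomial.T n * LaurentPolynomial.T m : LaurentPolynomial k) * hab
  obtain ⟨i, -, hi⟩ := (dvd_prime_pow prime_X (n + m)).1 ⟨q, h1.symm⟩
  obtain ⟨w, hw⟩ := hi.symm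
  obtain ⟨c, -, hc⟩ := Polynomial.isUnit_iff.1 w.isUnit
  refine ⟨c, (i : ℤ) - n, ?_⟩
  have h2 : (LaurentPolynomial.T (n : ℤ) * LaurentPolynomial.T (-(n : ℤ)) :
      LaurentPolynomial k) = 1 := by
    rw [← LaurentPolynomial.T_add, add_neg_cancel, LaurentPolynomial.T_zero]
  have h3 : a = toLaurent p * LaurentPolynomial.T (-(n : ℤ)) := by
    rw [hp, mul_assoc, h2, mul_one]
  rw [h3, ← hw, ← hc, map_mul, toLaurent_X_pow, toLaurent_C, sub_eq_add_neg,
    LaurentPolynomial.T_add]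
  ring

end Laurent

/-! ### The action of the unit on the component of degree `0`, in both cases -/

section Cases

universe u v

variable {k : Type u} {H : Type v} [Field k] [IsAlgClosed k] [Ring H] [HopfAlgebra k H]

omit [IsAlgClosed k] in
lemma isGroupLikeElem_zpow {Y : Hˣ} (hY : IsGroupLikeElem k (Y : H)) (m : ℤ) :
    IsGroupLikeElem k ((Y ^ m : Hˣ) : H) := by
  cases m with
  | ofNat m =>
    rw [Int.ofNat_eq_natCast, zpow_natCast, Units.val_pow_eq_pow_val]
    exact hY.pow
  | negSucc m =>
    rw [zpow_negSucc]
    refine IsGroupLikeElem.of_mul_eq_one (Units.mul_inv (Y ^ (m + 1))) (Units.inv_mul _) ?_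
    rw [Units.val_pow_eq_pow_val]
    exact hY.pow

namespace IsBiwinding

variable {σ : H →ₐ[k] H} {n : ℕ} {ζ : k} [NeZero n] (hb : IsBiwinding σ n ζ)
  {D : Type*} [CommRing D] [IsDedekindDomain D] [Algebra k D] {ι : D →ₐ[k] H}
  (hι : Function.Injective ι) (hr : ∀ h, h ∈ comp σ ζ 0 ↔ h ∈ ι.range)
include hb hι hr

/-- The component of degree `0` is a polynomial or a Laurent polynomial ring. -/
lemma exists_polynomial_or_laurent [Algebra.FiniteType k H] (hgk : gkDim k H = 1) :
    (∃ x : D, Coalgebra.comul (R := k) (ι x) = ι x ⊗ₜ[k] 1 + 1 ⊗ₜ[k] ι x ∧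
      Function.Bijective (aeval x : k[X] →ₐ[k] D)) ∨
    ∃ y : Dˣ, IsGroupLikeElem k (ι y) ∧ Function.Bijective (laurentHom (k := k) y) := by
  have hft : Algebra.FiniteType k D := hb.finiteType hι hr
  have hdep : AlgDep k D := algDep_of_gkDim_eq_one hgk hι
  obtain ⟨z₀, hz₀⟩ := hb.exists_notMem_range_of_gkDim_eq_one hι hr hgk
  let _ : HopfAlgebra k D := hb.hopfAlgebra hι hr
  have hmap : ∀ d : D, Algebra.TensorProduct.map ι ι (Coalgebra.comul (R := k) d) =
      Coalgebra.comul (R := k) (ι d) := hb.map_comulHom hι hr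
  rcases HopfGK.exists_polynomial_or_laurent hdep hz₀ with ⟨x, hx, hbij⟩ | ⟨y, hy, hbij⟩
  · refine .inl ⟨x, ?_, hbij⟩
    rw [← hmap, hx.comul_eq]
    simp
  · refine .inr ⟨y, ⟨?_, ?_⟩, hbij⟩
    · exact hy.counit_eq_one
    · rw [← hmap, hy.comul_eq_tmul_self]
      simp

omit [IsAlgClosed k] [IsDedekindDomain D] hι hr in
lemma exists_unit_counit_eq_one {u : Hˣ} (hu : (u : H) ∈ comp σ ζ 1) :
    ∃ u : Hˣ, (u : H) ∈ comp σ ζ 1 ∧ Coalgebra.counit (R := k) (u : H) = 1 := by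
  have h1 : IsUnit (Coalgebra.counit (R := k) (u : H)) :=
    u.isUnit.map (Bialgebra.counitAlgHom k H)
  let c : kˣ := h1.unit
  let w : Hˣ := Units.map (algebraMap k H : k →* H) c⁻¹ * u
  have hw : (w : H) = ((c⁻¹ : kˣ) : k) • (u : H) := by
    rw [Algebra.smul_def]; rfl
  refine ⟨w, ?_, ?_⟩
  · rw [hw]; exact Submodule.smul_mem _ _ hu
  · rw [hw, map_smul, smul_eq_mul]
    exact c.inv_mul

omit [IsAlgClosed k] [IsDedekindDomain D] in
lemma counit_conj {u : Hˣ} (hε : Coalgebra.counit (R := k) (u : H) = 1) (h : H) :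
    Coalgebra.counit (R := k) (((u⁻¹ : Hˣ) : H) * h * u) = Coalgebra.counit (R := k) h := by
  have h1 : Coalgebra.counit (R := k) ((u⁻¹ : Hˣ) : H) = 1 := by
    have := Bialgebra.counit_mul (R := k) (u : H) ((u⁻¹ : Hˣ) : H)
    rw [Units.mul_inv, Bialgebra.counit_one, hε, one_mul] at this
    exact this.symm
  rw [Bialgebra.counit_mul, Bialgebra.counit_mul, h1, hε, one_mul, mul_one]

/-- The primitive case. -/
lemma exists_of_polynomial (hpi : HasPIDegree H n) [Algebra.FiniteType k D] {x : D}
    (hΔ : Coalgebra.comul (R := k) (ι x) = ι x ⊗ₜ[k] 1 + 1 ⊗ₜ[k] ι x)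
    (hx : Function.Bijective (aeval x : k[X] →ₐ[k] D)) :
    ∃ (u : Hˣ) (ξ : k), (u : H) ∈ comp σ ζ 1 ∧
      Coalgebra.comul (R := k) (u : H) = (u : H) ⊗ₜ[k] (u : H) ∧
      Coalgebra.counit (R := k) (u : H) = 1 ∧ u ^ n = 1 ∧ IsPrimitiveRoot ξ n ∧
      ι x * u = ξ • (u * ι x) ∧ Coalgebra.counit (R := k) (ι x) = 0 := by
  have : IsPrincipalIdealRing D :=
    IsPrincipalIdealRing.of_surjective (aeval x : k[X] →ₐ[k] D).toRingHom hx.2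
  obtain ⟨u₀, hu₀⟩ := hb.exists_unit_mem_comp hι hr
  obtain ⟨u, hu, hε⟩ := hb.exists_unit_counit_eq_one hu₀
  have hunits : ∀ a : D, IsUnit a → Coalgebra.counit (R := k) (ι a) = 1 → a = 1 := by
    intro a ha h1
    obtain ⟨p, rfl⟩ := hx.2 a
    have hp : IsUnit p := (MulEquiv.isUnit_map (MulEquiv.ofBijective (aeval x : k[X] →ₐ[k] D) hx)).1 ha
    obtain ⟨c, -, rfl⟩ := Polynomial.isUnit_iff.1 hp
    rw [aeval_C, AlgHom.commutes, Bialgebra.counit_algebraMap] at h1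
    rw [h1, C_1, map_one]
  have hΔu := hb.comul_unit hι hr hu hε fun a ha h1 => by
    rw [hunits a ha h1, map_one]; exact .one
  have hun : u ^ n = 1 := by
    obtain ⟨c, hc, hcu⟩ := hb.exists_pow_eq hι hr hu
    have h1 : Coalgebra.counit (R := k) (ι c) = 1 := by
      rw [← hcu, Units.val_pow_eq_pow_val, Bialgebra.counit_pow, hε, one_pow]
    rw [hunits c hc h1, map_one] at hcu
    exact Units.ext hcu
  have hεx : Coalgebra.counit (R := k) (ι x) = 0 := by
    have h1 := Coalgebra.rTensor_counit_comul (R := k) (ι x)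
    rw [hΔ, map_add, LinearMap.rTensor_tmul, LinearMap.rTensor_tmul, Bialgebra.counit_one] at h1
    have h2 := congrArg (fun t => Coalgebra.counit (R := k) (TensorProduct.lid k H t)) h1
    simpa using h2
  let f : k[X] →ₐ[k] H := ι.comp (aeval x)
  have hf : Function.Injective f := hι.comp hx.1
  have hfX : f X = ι x := by simp [f]
  have hfr : ∀ d : D, ∃ p, ι d = f p := by
    intro d
    obtain ⟨p, rfl⟩ := hx.2 d
    exact ⟨p, rfl⟩
  obtain ⟨q, hq⟩ : ∃ q, ((u⁻¹ : Hˣ) : H) * ι x * u = f q := by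
    obtain ⟨d, hd⟩ := hb.exists_conj hι hr hu x
    obtain ⟨q, hq⟩ := hfr d
    exact ⟨q, hd.trans hq⟩
  obtain ⟨q', hq'⟩ : ∃ q, (u : H) * ι x * ((u⁻¹ : Hˣ) : H) = f q := by
    obtain ⟨d, hd⟩ := hb.exists_conj' hι hr hu x
    obtain ⟨q, hq⟩ := hfr d
    exact ⟨q, hd.trans hq⟩
  have hconj : ∀ p : k[X], ((u⁻¹ : Hˣ) : H) * f p * u = f (p.comp q) := by
    intro p
    induction p using Polynomial.induction_on' with
    | add a b ha hb => rw [map_add, mul_add, add_mul, ha, hb, add_comp, map_add]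
    | monomial i c =>
      have h1 : (((u⁻¹ : Hˣ) : H) * ι x * u) ^ i = ((u⁻¹ : Hˣ) : H) * ι x ^ i * u :=
        Units.conj_pow' u (ι x) i
      rw [← C_mul_X_pow_eq_monomial, map_mul, map_pow, hfX, mul_comp, pow_comp, X_comp, C_comp,
        map_mul, map_pow, ← hq, h1, ← algebraMap_eq, AlgHom.commutes, ← Algebra.smul_def,
        ← Algebra.smul_def, mul_smul_comm, smul_mul_assoc]
  -- Conjugation by `u` and by its inverse are inverse substitutions, so `q` is linear. It has no
  -- constant term because conjugation preserves the counit.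
  have hcomp : q'.comp q = X := by
    apply hf
    rw [← hconj, ← hq', hfX]
    simp only [mul_assoc, Units.inv_mul, mul_one]
    rw [← mul_assoc, Units.inv_mul, one_mul]
  have hdeg : q.natDegree = 1 := by
    have h1 := congrArg natDegree hcomp
    rw [natDegree_comp, natDegree_X] at h1
    exact Nat.eq_one_of_mul_eq_one_left h1
  have hq0 : q.coeff 0 = 0 := by
    have h1 := hb.counit_conj hι hr hε (ι x)
    rw [hq, hεx] at h1
    have h2 : ∀ p : k[X], Coalgebra.counit (R := k) (f p) = p.eval 0 := by
      intro p
      have h3 := aeval_algHom_apply (Bialgebra.counitAlgHom k H) (ι x) p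
      have h4 : (Bialgebra.counitAlgHom k H) (ι x) = 0 := hεx
      rw [h4, coe_aeval_eq_eval, aeval_algHom_apply] at h3
      exact h3.symm
    rw [h2, ← coeff_zero_eq_eval_zero] at h1
    exact h1
  have hqX : q = C (q.coeff 1) * X := by
    have h1 := eq_X_add_C_of_natDegree_le_one hdeg.le
    rw [hq0, C_0, add_zero] at h1
    exact h1
  set ξ := q.coeff 1
  have hrel : ι x * u = ξ • (u * ι x) := by
    rw [hqX, map_mul, hfX, ← algebraMap_eq, AlgHom.commutes, ← Algebra.smul_def, mul_assoc] at hq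
    rw [← mul_smul_comm, ← hq, Units.mul_inv_cancel_left]
  have hrelp : ∀ i : ℕ, ι x * ((u ^ i : Hˣ) : H) = ξ ^ i • (((u ^ i : Hˣ) : H) * ι x) := by
    intro i
    induction i with
    | zero => simp
    | succ i ih =>
      rw [pow_succ, Units.val_mul, ← mul_assoc, ih, smul_mul_assoc, mul_assoc, hrel, mul_smul_comm,
        smul_smul, pow_succ, mul_assoc]
  have hx0 : ι x ≠ 0 := by
    rw [← hfX, Ne, map_eq_zero_iff f hf]
    exact X_ne_zero
  have hξn : ξ ^ n = 1 := by
    have h1 := hrelp n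
    rw [hun, Units.val_one, mul_one, one_mul] at h1
    have h2 : (ξ ^ n - 1) • ι x = 0 := by rw [sub_smul, ← h1, one_smul, sub_self]
    exact sub_eq_zero.1 ((smul_eq_zero.1 h2).resolve_right hx0)
  have hcomm : ∀ c : D, ((u ^ orderOf ξ : Hˣ) : H) * ι c = ι c * ((u ^ orderOf ξ : Hˣ) : H) := by
    intro c
    obtain ⟨p, hp⟩ := hfr c
    rw [hp]
    have h1 : Commute ((u ^ orderOf ξ : Hˣ) : H) (ι x) := by
      have := hrelp (orderOf ξ)
      rw [pow_orderOf_eq_one, one_smul] at this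
      exact this.symm
    change Commute _ _
    induction p using Polynomial.induction_on' generalizing c with
    | add a b ha hb =>
      rw [map_add]
      exact (ha _ rfl).add_right (hb _ rfl)
    | monomial i e =>
      rw [← C_mul_X_pow_eq_monomial, map_mul, map_pow, hfX, ← algebraMap_eq, AlgHom.commutes]
      exact (Algebra.commute_algebraMap_right _ _).mul_right (h1.pow_right i)
  -- `ξ ^ n = 1` because `u ^ n = 1`. Conversely `u ^ orderOf ξ` centralises `D`, so the PI-degree
  -- is at most the order of `ξ`.
  have hord : orderOf ξ = n :=
    le_antisymm (Nat.le_of_dvd (NeZero.pos n) (orderOf_dvd_of_pow_eq_one hξn))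
      (hb.le_of_hasPIDegree hι hr hu hpi (orderOf_dvd_of_pow_eq_one hξn) hcomm)
  refine ⟨u, ξ, hu, hΔu, hε, hun, ?_, hrel, hεx⟩
  rw [← hord]
  exact IsPrimitiveRoot.orderOf ξ

/-- The group-like case. -/
lemma exists_of_laurent (hpi : HasPIDegree H n) (hn : 1 < n) [Algebra.FiniteType k D] {y : Dˣ}
    (hΔ : IsGroupLikeElem k (ι y)) (hy : Function.Bijective (laurentHom (k := k) y)) :
    n = 2 ∧ ∃ u : Hˣ, (u : H) ∈ comp σ ζ 1 ∧
      Coalgebra.comul (R := k) (u : H) = (u : H) ⊗ₜ[k] (u : H) ∧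
      Coalgebra.counit (R := k) (u : H) = 1 ∧ u ^ n = 1 ∧
      ι y * u = u * ι ((y⁻¹ : Dˣ) : D) := by
  have := isPrincipalIdealRing_laurentPolynomial (k := k)
  have : IsPrincipalIdealRing D :=
    IsPrincipalIdealRing.of_surjective (laurentHom (k := k) y).toRingHom hy.2
  obtain ⟨u₀, hu₀⟩ := hb.exists_unit_mem_comp hι hr
  obtain ⟨u, hu, hε⟩ := hb.exists_unit_counit_eq_one hu₀
  let Y : Hˣ := Units.map (ι : D →* H) y
  have hYpow : ∀ m : ℤ, ι ((y ^ m : Dˣ) : D) = ((Y ^ m : Hˣ) : H) := by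
    intro m
    rw [← map_zpow]
    rfl
  have hΔm : ∀ m : ℤ, IsGroupLikeElem k ((Y ^ m : Hˣ) : H) :=
    isGroupLikeElem_zpow (Y := Y) hΔ
  have hεm : ∀ m : ℤ, Coalgebra.counit (R := k) ((Y ^ m : Hˣ) : H) = 1 := fun m =>
    (hΔm m).counit_eq_one
  have hinj : ∀ m m' : ℤ, Y ^ m = Y ^ m' → m = m' := by
    intro m m' h
    have h1 : laurentHom (k := k) y (LaurentPolynomial.T m) =
        laurentHom (k := k) y (LaurentPolynomial.T m') := by
      apply hι
      rw [laurentHom_T, laurentHom_T, hYpow, hYpow, h]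
    have h2 : (LaurentPolynomial.T m : LaurentPolynomial k) = LaurentPolynomial.T m' := hy.1 h1
    by_contra hne
    have h3 := congrArg LaurentPolynomial.degree h2
    rw [LaurentPolynomial.degree_T, LaurentPolynomial.degree_T] at h3
    exact hne (by exact_mod_cast h3)
  have hunits : ∀ a : D, IsUnit a → Coalgebra.counit (R := k) (ι a) = 1 →
      ∃ m : ℤ, ι a = ((Y ^ m : Hˣ) : H) := by
    intro a ha h1
    obtain ⟨p, rfl⟩ := hy.2 a
    have hp : IsUnit p := (MulEquiv.isUnit_map (MulEquiv.ofBijective (laurentHom (k := k) y) hy)).1 ha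
    obtain ⟨c, m, rfl⟩ := exists_eq_C_mul_T_of_isUnit hp
    refine ⟨m, ?_⟩
    rw [map_mul, laurentHom_T, map_mul, hYpow, Bialgebra.counit_mul, hεm, mul_one] at h1
    have h2 : laurentHom y (LaurentPolynomial.C c) = algebraMap k D c :=
      (laurentHom (k := k) y).commutes c
    rw [h2, AlgHom.commutes, Bialgebra.counit_algebraMap] at h1
    rw [map_mul, laurentHom_T, h2, h1, map_one, one_mul, hYpow]
  have hΔu := hb.comul_unit hι hr hu hε fun a ha h1 => by
    obtain ⟨m, hm⟩ := hunits a ha h1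
    rw [hm]
    exact hΔm m
  -- The conjugate is a unit of `D` of counit `1`, hence a power of `Y`. The exponents of the two
  -- conjugations multiply to `1`, so they are `±1`.
  have hconj : ∃ m : ℤ, u⁻¹ * Y * u = Y ^ m := by
    obtain ⟨d, hd⟩ := hb.exists_conj hι hr hu y
    obtain ⟨d', hd'⟩ := hb.exists_conj hι hr hu ((y⁻¹ : Dˣ) : D)
    have hunit : IsUnit d := by
      refine IsUnit.of_mul_eq_one d' (hι ?_)
      rw [map_mul, ← hd, ← hd', map_one]
      have h1 : ι (y : D) * ι ((y⁻¹ : Dˣ) : D) = 1 := by rw [← map_mul, Units.mul_inv, map_one]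
      simp only [mul_assoc, Units.mul_inv_cancel_left]
      rw [← mul_assoc (ι (y : D)), h1, one_mul, Units.inv_mul]
    obtain ⟨m, hm⟩ := hunits d hunit (by rw [← hd, hb.counit_conj hι hr hε, hΔ.counit_eq_one])
    exact ⟨m, Units.ext (hd.trans hm)⟩
  have hconj' : ∃ m : ℤ, u * Y * u⁻¹ = Y ^ m := by
    obtain ⟨d, hd⟩ := hb.exists_conj' hι hr hu y
    obtain ⟨d', hd'⟩ := hb.exists_conj' hι hr hu ((y⁻¹ : Dˣ) : D)
    have hunit : IsUnit d := by
      refine IsUnit.of_mul_eq_one d' (hι ?_)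
      rw [map_mul, ← hd, ← hd', map_one]
      have h1 : ι (y : D) * ι ((y⁻¹ : Dˣ) : D) = 1 := by rw [← map_mul, Units.mul_inv, map_one]
      simp only [mul_assoc, Units.inv_mul_cancel_left]
      rw [← mul_assoc (ι (y : D)), h1, one_mul, Units.mul_inv]
    obtain ⟨m, hm⟩ := hunits d hunit (by
      have h1 := hb.counit_conj hι hr hε ((u : H) * ι y * ((u⁻¹ : Hˣ) : H))
      simp only [mul_assoc, Units.inv_mul, mul_one, Units.inv_mul_cancel_left] at h1
      rw [hΔ.counit_eq_one] at h1
      rw [← hd, mul_assoc]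
      exact h1.symm)
    exact ⟨m, Units.ext (hd.trans hm)⟩
  obtain ⟨m, hm⟩ := hconj
  obtain ⟨m', hm'⟩ := hconj'
  have hconjz : ∀ j : ℤ, u⁻¹ * Y ^ j * u = Y ^ (m * j) := by
    intro j
    have h1 : u⁻¹ * Y ^ j * u = (u⁻¹ * Y * u) ^ j := by
      have := (conj_zpow (i := j) (a := u⁻¹) (b := Y)).symm
      rwa [inv_inv] at this
    rw [h1, hm, zpow_mul]
  have hmm : m * m' = 1 := by
    apply hinj
    rw [← hconjz, ← hm']
    group
  have hcent : ∀ d : ℕ, Commute (u ^ d) Y →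
      ∀ c : D, ((u ^ d : Hˣ) : H) * ι c = ι c * ((u ^ d : Hˣ) : H) := by
    intro d hd c
    obtain ⟨p, rfl⟩ := hy.2 c
    change Commute _ _
    induction p using LaurentPolynomial.induction_on' with
    | add p q hp hq => rw [map_add, map_add]; exact hp.add_right hq
    | C_mul_T j e =>
      have h2 : laurentHom y (LaurentPolynomial.C e) = algebraMap k D e :=
        (laurentHom (k := k) y).commutes e
      rw [map_mul, map_mul, h2, AlgHom.commutes, laurentHom_T, hYpow]
      refine (Algebra.commute_algebraMap_right _ _).mul_right ?_
      exact congrArg Units.val (hd.zpow_right j)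
  obtain ⟨c, hc, hcu⟩ := hb.exists_pow_eq hι hr hu
  obtain ⟨j, hj⟩ := hunits c hc (by
    rw [← hcu, Units.val_pow_eq_pow_val, Bialgebra.counit_pow, hε, one_pow])
  have hun : u ^ n = Y ^ j := Units.ext (hcu.trans hj)
  -- Exponent `1` makes `u` central on `D`, so the PI-degree would be at most `1`.
  rcases Int.isUnit_iff.1 (IsUnit.of_mul_eq_one _ hmm) with rfl | rfl
  · exfalso
    have h1 := hb.le_of_hasPIDegree hι hr hu hpi (one_dvd n) (hcent 1 (by
      rw [pow_one, Commute, SemiconjBy, ← mul_left_cancel_iff (a := u⁻¹), ← mul_assoc u⁻¹ Y, hm]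
      simp))
    omega
  · have hYu : Y * u = u * Y⁻¹ := by
      rw [zpow_neg, zpow_one] at hm
      rw [← hm]
      group
    have hYu' : Y⁻¹ * u = u * Y := by
      have h1 := hconjz (-1)
      simp only [zpow_neg, zpow_one, neg_mul, one_mul, inv_inv] at h1
      rw [← mul_left_cancel_iff (a := u⁻¹), ← mul_assoc, h1]
      group
    have h2comm : Commute (u ^ 2) Y := by
      change u ^ 2 * Y = Y * u ^ 2
      rw [pow_two, mul_assoc, ← hYu', ← mul_assoc, ← hYu, mul_assoc]
    -- `u ^ n` is a power of `Y`, hence commutes with `Y`, as `u ^ 2` does. For odd `n` so would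
    -- `u`, and then `Y = Y⁻¹`.
    have heven : 2 ∣ n := by
      by_contra hodd
      obtain ⟨q, hq⟩ : ∃ q, n = 2 * q + 1 := ⟨n / 2, by omega⟩
      have h1 : Commute (u ^ n) Y := by rw [hun]; exact (Commute.refl Y).zpow_left j
      have h2 : Commute (u ^ (2 * q)) Y := by rw [pow_mul]; exact h2comm.pow_left q
      rw [hq, pow_succ] at h1
      have h3 : u ^ (2 * q) * (u * Y) = u ^ (2 * q) * (Y * u) := by
        rw [← mul_assoc, ← mul_assoc, h2.eq, mul_assoc Y]
        exact h1.eq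
      have h4 : u * Y ^ (1 : ℤ) = u * Y ^ (-1 : ℤ) := by
        rw [zpow_neg, zpow_one, ← hYu]
        exact mul_left_cancel h3
      have := hinj _ _ (mul_left_cancel h4)
      omega
    have hn2 : n = 2 := le_antisymm
      (hb.le_of_hasPIDegree hι hr hu hpi heven (hcent 2 h2comm)) hn
    refine ⟨hn2, u, hu, hΔu, hε, ?_, ?_⟩
    -- `u ^ n = Y ^ j` commutes with `u`, while conjugation by `u` inverts it; so `j = 0`.
    · have h1 := hconjz j
      have h2 : u⁻¹ * Y ^ j * u = Y ^ j := by
        rw [← hun, mul_assoc, ← pow_succ, pow_succ', inv_mul_cancel_left]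
      rw [h2] at h1
      have := hinj _ _ h1
      have hj0 : j = 0 := by omega
      rw [hun, hj0, zpow_zero]
    · have h3 := congrArg Units.val hYu
      have h4 : ι ((y⁻¹ : Dˣ) : D) = ((Y⁻¹ : Hˣ) : H) := by
        have := hYpow (-1)
        simpa using this
      rw [h4]
      exact h3

end IsBiwinding

end Cases

/-! ### Isomorphisms with Taft algebras and the infinite dihedral group algebra -/

section Isomorphisms

universe u v

variable {k : Type u} {H : Type v} [Field k] [Ring H] [HopfAlgebra k H]

lemma isCocomm_of_bialgEquiv {B : Type*} [Ring B] [Bialgebra k B] [Coalgebra.IsCocomm k B]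
    (e : H ≃ₐc[k] B) : Coalgebra.IsCocomm k H := by
  refine ⟨LinearMap.ext fun h => ?_⟩
  obtain ⟨b, rfl⟩ := e.symm.surjective h
  have h1 := CoalgHomClass.map_comp_comul_apply e.symm b
  change TensorProduct.comm k H H (Coalgebra.comul (e.symm b)) = Coalgebra.comul (e.symm b)
  rw [← h1, ← TensorProduct.map_comm, Coalgebra.comm_comul]

instance Taft.isCocomm (n : ℕ) (ξ : k) : Coalgebra.IsCocomm k (Taft k n 0 ξ) := by
  have h : (Algebra.TensorProduct.comm k (Taft k n 0 ξ) (Taft k n 0 ξ)).toAlgHom.comp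
      (Taft.comulHom k n 0 ξ) = Taft.comulHom k n 0 ξ := by
    apply Taft.hom_ext
    · simp [Taft.comulHom]
    · simp [Taft.comulHom, add_comm]
  exact ⟨LinearMap.ext fun a => DFunLike.congr_fun h a⟩

/-- The elements `gⁱ p(x)` with `i < n` span the Taft algebra. -/
lemma Taft.exists_eq_sum {n : ℕ} [NeZero n] {t : ℕ} {ξ : k} (a : Taft k n t ξ) :
    ∃ p : Fin n → k[X], a = ∑ i : Fin n, Taft.g k n t ξ ^ (i : ℕ) * aeval (Taft.x k n t ξ) (p i) := by
  let L : (Fin n → k[X]) →ₗ[k] Taft k n t ξ := ∑ i : Fin n,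
    (LinearMap.mulLeft k (Taft.g k n t ξ ^ (i : ℕ))) ∘ₗ (aeval (Taft.x k n t ξ)).toLinearMap ∘ₗ
      LinearMap.proj i
  have hL : ∀ p, L p = ∑ i : Fin n, Taft.g k n t ξ ^ (i : ℕ) * aeval (Taft.x k n t ξ) (p i) := by
    intro p
    simp [L]
  have hmem : ∀ (i : ℕ) (p : k[X]),
      Taft.g k n t ξ ^ i * aeval (Taft.x k n t ξ) p ∈ LinearMap.range L := by
    intro i p
    refine ⟨Pi.single ⟨i % n, Nat.mod_lt _ (NeZero.pos n)⟩ p, ?_⟩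
    rw [hL, Finset.sum_eq_single ⟨i % n, Nat.mod_lt _ (NeZero.pos n)⟩]
    · rw [Pi.single_eq_same]
      congr 1
      conv_rhs => rw [← Nat.mod_add_div i n, pow_add, pow_mul, Taft.g_pow, one_pow, mul_one]
    · intro j _ hj
      rw [Pi.single_eq_of_ne hj, map_zero, mul_zero]
    · simp
  have hxg : ∀ i : ℕ, Taft.x k n t ξ * Taft.g k n t ξ ^ i =
      ξ ^ i • (Taft.g k n t ξ ^ i * Taft.x k n t ξ) := by
    intro i
    induction i with
    | zero => simp
    | succ i ih =>
      rw [pow_succ, ← mul_assoc, ih, smul_mul_assoc, mul_assoc, Taft.x_mul_g, mul_smul_comm,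
        smul_smul, mul_assoc, pow_succ]
  have key : ∀ b ∈ LinearMap.range L, a * b ∈ LinearMap.range L := by
    induction a using Taft.induction with
    | hc c =>
      intro b hb
      rw [← Algebra.smul_def]
      exact Submodule.smul_mem _ _ hb
    | hg =>
      rintro _ ⟨p, rfl⟩
      rw [hL, Finset.mul_sum]
      refine Submodule.sum_mem _ fun i _ => ?_
      rw [← mul_assoc, ← pow_succ']
      exact hmem _ _
    | hx =>
      rintro _ ⟨p, rfl⟩
      rw [hL, Finset.mul_sum]
      refine Submodule.sum_mem _ fun i _ => ?_
      have h1 : Taft.x k n t ξ * aeval (Taft.x k n t ξ) (p i) =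
          aeval (Taft.x k n t ξ) (X * p i) := by rw [map_mul, aeval_X]
      rw [← mul_assoc, hxg, smul_mul_assoc, mul_assoc, h1]
      exact Submodule.smul_mem _ _ (hmem _ _)
    | hmul a b ha hb =>
      intro c hc
      rw [mul_assoc]
      exact ha _ (hb _ hc)
    | hadd a b ha hb =>
      intro c hc
      rw [add_mul]
      exact Submodule.add_mem _ (ha _ hc) (hb _ hc)
  obtain ⟨p, hp⟩ := key 1 (by simpa using hmem 0 1)
  exact ⟨p, by rw [← hL, hp, mul_one]⟩

/-- The inclusion of the group algebra of the rotations. -/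
def rotationHom (k : Type*) [Field k] :
    LaurentPolynomial k →ₐ[k] MonoidAlgebra k (DihedralGroup 0) :=
  laurentHom ((MonoidAlgebra.of k (DihedralGroup 0)).toHomUnits (DihedralGroup.r 1))

lemma DihedralGroup.r_one_zpow_zero (m : ℤ) :
    (DihedralGroup.r 1 : DihedralGroup 0) ^ m = DihedralGroup.r m := by
  rw [DihedralGroup.r_zpow, one_mul]
  rfl

lemma rotationHom_T (m : ℤ) : rotationHom k (LaurentPolynomial.T m) =
    MonoidAlgebra.of k (DihedralGroup 0) (DihedralGroup.r m) := by
  rw [rotationHom, laurentHom_T, ← map_zpow, DihedralGroup.r_one_zpow_zero]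
  rfl

lemma exists_eq_sum_rotationHom (a : MonoidAlgebra k (DihedralGroup 0)) :
    ∃ p : Fin 2 → LaurentPolynomial k,
      a = ∑ i : Fin 2, MonoidAlgebra.of k _ (DihedralGroup.sr 0) ^ (i : ℕ) * rotationHom k (p i) := by
  have hrot : ∀ m : ℤ, ∃ p : Fin 2 → LaurentPolynomial k,
      MonoidAlgebra.of k (DihedralGroup 0) (DihedralGroup.r m) =
        ∑ i : Fin 2, MonoidAlgebra.of k _ (DihedralGroup.sr 0) ^ (i : ℕ) *
          rotationHom k (p i) := by
    intro m
    refine ⟨![LaurentPolynomial.T m, 0], ?_⟩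
    rw [Fin.sum_univ_two, Matrix.cons_val_zero, Matrix.cons_val_one, Matrix.cons_val_fin_one, rotationHom_T,
      map_zero,
      mul_zero, add_zero, Fin.val_zero, pow_zero, one_mul]
  have hrefl : ∀ m : ℤ, ∃ p : Fin 2 → LaurentPolynomial k,
      MonoidAlgebra.of k (DihedralGroup 0) (DihedralGroup.sr m) =
        ∑ i : Fin 2, MonoidAlgebra.of k _ (DihedralGroup.sr 0) ^ (i : ℕ) *
          rotationHom k (p i) := by
    intro m
    refine ⟨![0, LaurentPolynomial.T m], ?_⟩
    rw [Fin.sum_univ_two, Matrix.cons_val_zero, Matrix.cons_val_one, Matrix.cons_val_fin_one, rotationHom_T,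
      map_zero,
      mul_zero, zero_add, Fin.val_one, pow_one, ← map_mul]
    exact congrArg (MonoidAlgebra.of k (DihedralGroup 0))
      ((DihedralGroup.sr_mul_r (n := 0) 0 m).trans (congrArg _ (zero_add _))).symm
  induction a using MonoidAlgebra.induction_on with
  | of g =>
    cases g with
    | r m => exact hrot m
    | sr m => exact hrefl m
  | add f g hf hg =>
    obtain ⟨p, rfl⟩ := hf
    obtain ⟨q, rfl⟩ := hg
    refine ⟨p + q, ?_⟩
    simp only [Pi.add_apply, map_add, mul_add, Finset.sum_add_distrib]
  | smul c f hf =>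
    obtain ⟨p, rfl⟩ := hf
    refine ⟨c • p, ?_⟩
    simp only [Pi.smul_apply, map_smul, mul_smul_comm, Finset.smul_sum]

/-- The homomorphism from the infinite dihedral group defined by two units. -/
def dihedralHom {G : Type*} [Group G] (a b : G) (ha : a * a = 1) (hab : b * a = a * b⁻¹) :
    DihedralGroup 0 →* G where
  toFun
    | .r i => b ^ (show ℤ from i)
    | .sr i => a * b ^ (show ℤ from i)
  map_one' := zpow_zero b
  map_mul' := by
    have h1 : ∀ i : ℤ, b ^ i * a = a * b ^ (-i) := by
      intro i
      have h : SemiconjBy a b⁻¹ b := hab.symm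
      rw [zpow_neg, ← inv_zpow]
      exact (h.zpow_right i).symm
    have h2 : ∀ i j : ℤ, b ^ i * (a * b ^ j) = a * b ^ (j - i) := by
      intro i j
      rw [← mul_assoc, h1, mul_assoc, ← zpow_add, neg_add_eq_sub]
    rintro (i | i) (j | j)
    · exact zpow_add b (show ℤ from i) j
    · exact (h2 i j).symm
    · change a * b ^ ((show ℤ from i) + (show ℤ from j)) =
        a * b ^ (show ℤ from i) * b ^ (show ℤ from j)
      rw [mul_assoc, zpow_add]
    · change b ^ ((show ℤ from j) - (show ℤ from i)) =
        a * b ^ (show ℤ from i) * (a * b ^ (show ℤ from j))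
      rw [mul_assoc, h2, ← mul_assoc, ha, one_mul]

lemma isGroupLikeElem_dihedralHom {a b : Hˣ} {ha : a * a = 1} {hab : b * a = a * b⁻¹}
    (ha' : IsGroupLikeElem k (a : H)) (hb' : IsGroupLikeElem k (b : H)) (g : DihedralGroup 0) :
    IsGroupLikeElem k (dihedralHom a b ha hab g : H) := by
  cases g with
  | r i => exact isGroupLikeElem_zpow hb' _
  | sr i =>
    change IsGroupLikeElem k ((a * b ^ (show ℤ from i) : Hˣ) : H)
    rw [Units.val_mul]
    exact ha'.mul (isGroupLikeElem_zpow hb' _)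

namespace IsBiwinding

variable {σ : H →ₐ[k] H} {n : ℕ} {ζ : k} [NeZero n] (hb : IsBiwinding σ n ζ)
  {D : Type*} [CommRing D] [Algebra k D] {ι : D →ₐ[k] H}
  (hι : Function.Injective ι) (hr : ∀ h, h ∈ comp σ ζ 0 ↔ h ∈ ι.range)
  {u : Hˣ} (hu : (u : H) ∈ comp σ ζ 1)
include hb hι hr hu

lemma proj_sum (d : Fin n → D) (i : Fin n) :
    proj σ ζ n (i : ℕ) (∑ j : Fin n, (u : H) ^ (j : ℕ) * ι (d j)) = (u : H) ^ (i : ℕ) * ι (d i) := by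
  have h1 : ∀ j : Fin n, (u : H) ^ (j : ℕ) * ι (d j) ∈ comp σ ζ (j : ℕ) := by
    intro j
    have := mul_mem_comp (zeta_ne_zero hb.prim) (hb.pow_mem_comp hu j)
      (hb.map_mem_comp hι hr (d j))
    rwa [add_zero, Units.val_pow_eq_pow_val] at this
  rw [map_sum, Finset.sum_eq_single i]
  · exact proj_eq_self hb.prim (h1 i)
  · intro j _ hj
    refine proj_eq_zero hb.prim (fun hdvd => hj ?_) (h1 j)
    have h2 : ((j : ℕ) : ℤ) = (i : ℕ) := by
      have h4 := Int.emod_eq_emod_iff_emod_sub_eq_zero.2 (Int.emod_eq_zero_of_dvd hdvd)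
      rwa [Int.emod_eq_of_lt (by positivity) (by exact_mod_cast j.2),
        Int.emod_eq_of_lt (by positivity) (by exact_mod_cast i.2)] at h4
    exact Fin.ext (by exact_mod_cast h2)
  · simp

/-- An algebra spanned by `gⁱ P` with `i < n` is isomorphic to `H` if `P` is isomorphic to the
component of degree `0` and `g` is sent to `u`. -/
lemma bijective_of_exists_eq_sum {B P : Type*} [Ring B] [Algebra k B] [CommRing P] [Algebra k P]
    (l : P →ₐ[k] B) (g : B) (hspan : ∀ b, ∃ p : Fin n → P, b = ∑ i : Fin n, g ^ (i : ℕ) * l (p i))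
    (φ : B →ₐ[k] H) (hg : φ g = u) {θ : P →ₐ[k] D} (hθ : Function.Bijective θ)
    (hl : φ.comp l = ι.comp θ) : Function.Bijective φ := by
  have hl' : ∀ p, φ (l p) = ι (θ p) := fun p => DFunLike.congr_fun hl p
  constructor
  · rw [injective_iff_map_eq_zero]
    intro b hb0
    obtain ⟨p, rfl⟩ := hspan b
    have h1 : ∑ i : Fin n, (u : H) ^ (i : ℕ) * ι (θ (p i)) = 0 := by
      rw [← hb0, map_sum]
      exact Finset.sum_congr rfl fun i _ => by rw [map_mul, map_pow, hg, hl']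
    refine Finset.sum_eq_zero fun i _ => ?_
    -- The images of the summands lie in different degrees, so each of them vanishes separately; `u
    -- ^ i` is then cancelled.
    have h2 := hb.proj_sum hι hr hu (fun j => θ (p j)) i
    rw [h1, map_zero, ← Units.val_pow_eq_pow_val] at h2
    have h3 : ι (θ (p i)) = 0 := (u ^ (i : ℕ)).isUnit.mul_left_cancel (by rw [← h2, mul_zero])
    have h4 : p i = 0 := hθ.1 (hι (by rw [h3, map_zero, map_zero]))
    rw [h4, map_zero, mul_zero]
  · intro h
    refine hb.mem_of_unit_mul_mem hι hr hu (N := LinearMap.range φ.toLinearMap) ?_ ?_ h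
    · intro d
      obtain ⟨p, rfl⟩ := hθ.2 d
      exact ⟨l p, hl' p⟩
    · rintro _ ⟨b, rfl⟩
      exact ⟨g * b, by simp [hg]⟩

lemma nonempty_equiv_taft {x : D} (hΔx : Coalgebra.comul (R := k) (ι x) = ι x ⊗ₜ[k] 1 + 1 ⊗ₜ[k] ι x)
    (hx : Function.Bijective (aeval x : k[X] →ₐ[k] D)) {ξ : k}
    (hΔu : IsGroupLikeElem k (u : H)) (hun : u ^ n = 1)
    (hrel : ι x * u = ξ • (u * ι x)) (hεx : Coalgebra.counit (R := k) (ι x) = 0) :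
    Nonempty (H ≃ₐc[k] Taft k n 0 ξ) := by
  have hun' : (u : H) ^ n = 1 := by rw [← Units.val_pow_eq_pow_val, hun, Units.val_one]
  let φ : Taft k n 0 ξ →ₐ[k] H := Taft.lift (u : H) (ι x) hun' hrel
  have hφ : Function.Bijective φ :=
    hb.bijective_of_exists_eq_sum hι hr hu (aeval (Taft.x k n 0 ξ)) (Taft.g k n 0 ξ)
      Taft.exists_eq_sum φ (Taft.lift_g ..) hx (by ext; simp [φ])
  refine ⟨(BialgEquiv.ofAlgEquiv (AlgEquiv.ofBijective φ hφ) ?_ ?_).symm⟩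
  · apply Taft.hom_ext
    · change Coalgebra.counit (R := k) (φ (Taft.g k n 0 ξ)) = Taft.counitHom k n 0 ξ (Taft.g k n 0 ξ)
      simp [φ, Taft.counitHom, hΔu.counit_eq_one]
    · change Coalgebra.counit (R := k) (φ (Taft.x k n 0 ξ)) = Taft.counitHom k n 0 ξ (Taft.x k n 0 ξ)
      simp [φ, Taft.counitHom, hεx]
  · apply Taft.hom_ext
    · change Algebra.TensorProduct.map φ φ (Taft.comulHom k n 0 ξ (Taft.g k n 0 ξ)) =
        Coalgebra.comul (R := k) (φ (Taft.g k n 0 ξ))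
      simp [φ, Taft.comulHom, hΔu.comul_eq_tmul_self]
    · change Algebra.TensorProduct.map φ φ (Taft.comulHom k n 0 ξ (Taft.x k n 0 ξ)) =
        Coalgebra.comul (R := k) (φ (Taft.x k n 0 ξ))
      simp [φ, Taft.comulHom, hΔx]

lemma nonempty_equiv_dihedral (hn : n = 2) {y : Dˣ} (hΔy : IsGroupLikeElem k (ι y))
    (hy : Function.Bijective (laurentHom (k := k) y))
    (hΔu : IsGroupLikeElem k (u : H)) (hun : u ^ n = 1) (hrel : ι y * u = u * ι ((y⁻¹ : Dˣ) : D)) :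
    Nonempty (H ≃ₐc[k] MonoidAlgebra k (DihedralGroup 0)) := by
  subst hn
  let Y : Hˣ := Units.map (ι : D →* H) y
  have h1 : u * u = 1 := by rw [← pow_two, hun]
  have h2 : Y * u = u * Y⁻¹ := Units.ext hrel
  let φ : MonoidAlgebra k (DihedralGroup 0) →ₐ[k] H :=
    MonoidAlgebra.lift k H _ ((Units.coeHom H).comp (dihedralHom u Y h1 h2))
  have hφof : ∀ g, φ (MonoidAlgebra.of k _ g) = (dihedralHom u Y h1 h2 g : H) := fun g =>
    MonoidAlgebra.lift_of _ _
  have hφ : Function.Bijective φ := by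
    refine hb.bijective_of_exists_eq_sum hι hr hu (rotationHom k)
      (MonoidAlgebra.of k _ (DihedralGroup.sr 0)) exists_eq_sum_rotationHom φ ?_ hy ?_
    · rw [hφof]
      change ((u * Y ^ (0 : ℤ) : Hˣ) : H) = u
      rw [zpow_zero, mul_one]
    · refine AddMonoidAlgebra.algHom_ext (fun m => ?_) (Algebra.ext_id _ _ _)
      change φ (rotationHom k (LaurentPolynomial.T m)) =
        ι (laurentHom (k := k) y (LaurentPolynomial.T m))
      rw [rotationHom_T, hφof, laurentHom_T]
      change ((Y ^ m : Hˣ) : H) = _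
      rw [← map_zpow]
      rfl
  have hgl : ∀ g, IsGroupLikeElem k (dihedralHom u Y h1 h2 g : H) :=
    isGroupLikeElem_dihedralHom hΔu hΔy
  refine ⟨(BialgEquiv.ofAlgEquiv (AlgEquiv.ofBijective φ hφ) ?_ ?_).symm⟩
  · refine MonoidAlgebra.algHom_ext' (MonoidHom.ext fun g => ?_)
      (Algebra.ext_id _ _ _)
    change Coalgebra.counit (R := k) (φ (MonoidAlgebra.of k _ g)) =
      Coalgebra.counit (R := k) (MonoidAlgebra.of k _ g)
    rw [hφof, (hgl g).counit_eq_one, (MonoidAlgebra.isGroupLikeElem_of g).counit_eq_one]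
  · refine MonoidAlgebra.algHom_ext' (MonoidHom.ext fun g => ?_)
      (Algebra.ext_id _ _ _)
    change Algebra.TensorProduct.map φ φ (Coalgebra.comul (R := k) (MonoidAlgebra.of k _ g)) =
      Coalgebra.comul (R := k) (φ (MonoidAlgebra.of k _ g))
    rw [hφof, (hgl g).comul_eq_tmul_self, (MonoidAlgebra.isGroupLikeElem_of g).comul_eq_tmul_self,
      Algebra.TensorProduct.map_tmul, hφof]

end IsBiwinding

end Isomorphisms

/-! ### The left homological integral -/

section IntegralExt

open CategoryTheory

universe u v

variable (k : Type u) (H : Type v) [Field k] [Ring H] [HopfAlgebra k H]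

/-- The augmentation ideal as a left module. -/
abbrev augKer : Submodule H H := RingHom.ker (Bialgebra.counitAlgHom k H)

/-- The augmentation sequence `0 → ker ε → H → k → 0`. -/
abbrev augComplex : ShortComplex (ModuleCat.{v} H) where
  X₁ := ModuleCat.of H (augKer k H)
  X₂ := ModuleCat.of H H
  X₃ := trivialModule k H
  f := ModuleCat.ofHom (augKer k H).subtype
  g := ModuleCat.ofHom (augKer k H).mkQ
  zero := by
    ext a
    exact (Submodule.Quotient.mk_eq_zero _).2 a.2

lemma augComplex_shortExact : (augComplex k H).ShortExact := by
  refine ModuleCat.shortComplex_shortExact _ ?_ ?_ ?_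
  · exact LinearMap.exact_subtype_mkQ (augKer k H)
  · exact (augKer k H).subtype_injective
  · exact (augKer k H).mkQ_surjective

variable {k H}

/-- The class of the extension that a linear map on the augmentation ideal defines. -/
def LeftIntegral.ofHom (φ : augKer k H →ₗ[H] H) : LeftIntegral k H :=
  (augComplex_shortExact k H).extClass.comp
    (Abelian.Ext.mk₀ (X := (augComplex k H).X₁) (Y := ModuleCat.of H H) (ModuleCat.ofHom φ))
    (add_zero 1)

namespace LeftIntegral

/-- `H` is projective, so `Ext¹(H, H) = 0` and the connecting map of the augmentation sequence is
onto. -/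
lemma ofHom_surjective (α : LeftIntegral k H) : ∃ φ, α = ofHom φ := by
  have : Projective (augComplex k H).X₂ := inferInstanceAs (Projective (ModuleCat.of H H))
  obtain ⟨x, hx⟩ := Abelian.Ext.contravariant_sequence_exact₃ (augComplex_shortExact k H)
    (ModuleCat.of H H) α (Abelian.Ext.eq_zero_of_projective _) (add_zero 1)
  obtain ⟨f, rfl⟩ := (Abelian.Ext.mk₀_bijective _ _).2 x
  exact ⟨f.hom, hx.symm⟩

/-- By exactness the class vanishes precisely when the map extends to `H`, and the endomorphisms of
the left module `H` are the right multiplications. -/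
lemma ofHom_eq_zero_iff {φ : augKer k H →ₗ[H] H} :
    ofHom φ = 0 ↔ ∃ r : H, ∀ a, φ a = (a : H) * r := by
  constructor
  · intro h
    obtain ⟨x, hx⟩ := Abelian.Ext.contravariant_sequence_exact₁ (augComplex_shortExact k H)
      (ModuleCat.of H H) _ (add_zero 1) h
    obtain ⟨f, rfl⟩ := (Abelian.Ext.mk₀_bijective _ _).2 x
    rw [Abelian.Ext.mk₀_comp_mk₀] at hx
    have h2 := (Abelian.Ext.mk₀_bijective _ _).1 hx
    let f' : H →ₗ[H] H := f.hom
    refine ⟨f' 1, fun a => ?_⟩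
    have h3 : f' (a : H) = φ a := DFunLike.congr_fun (congrArg ModuleCat.Hom.hom h2) a
    rw [← h3, ← smul_eq_mul, ← map_smul, smul_eq_mul, mul_one]
  · rintro ⟨r, hr⟩
    have h1 : (ModuleCat.ofHom φ : (augComplex k H).X₁ ⟶ ModuleCat.of H H) =
        (augComplex k H).f ≫ ModuleCat.ofHom (LinearMap.toSpanSingleton H H r) := by
      ext a
      exact hr a
    rw [ofHom, h1, ← Abelian.Ext.mk₀_comp_mk₀]
    exact (augComplex_shortExact k H).extClass_comp_assoc _

lemma ofHom_sub (φ ψ : augKer k H →ₗ[H] H) : ofHom (φ - ψ) = ofHom φ - ofHom ψ := by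
  rw [eq_sub_iff_add_eq, ofHom, ofHom, ofHom, ← Abelian.Ext.comp_add, ← Abelian.Ext.mk₀_add]
  congr 2
  ext a
  exact sub_add_cancel (φ a) (ψ a)

lemma ofHom_act (φ : augKer k H →ₗ[H] H) (h : H) :
    (ofHom φ).act h = ofHom (LinearMap.toSpanSingleton H H h ∘ₗ φ) := by
  rw [act, ofHom, ofHom, Abelian.Ext.comp_assoc_of_third_deg_zero, Abelian.Ext.mk₀_comp_mk₀]
  rfl

lemma act_act (α : LeftIntegral k H) (a b : H) : (α.act a).act b = α.act (a * b) := by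
  obtain ⟨φ, rfl⟩ := ofHom_surjective α
  rw [ofHom_act, ofHom_act, ofHom_act]
  congr 1
  ext κ
  simp [mul_assoc]

lemma act_one (α : LeftIntegral k H) : α.act 1 = α := by
  obtain ⟨φ, rfl⟩ := ofHom_surjective α
  rw [ofHom_act]
  congr 1
  ext κ
  simp

lemma act_sub (α : LeftIntegral k H) (a b : H) : α.act (a - b) = α.act a - α.act b := by
  obtain ⟨φ, rfl⟩ := ofHom_surjective α
  rw [ofHom_act, ofHom_act, ofHom_act, ← ofHom_sub]
  congr 1
  ext κ
  simp [mul_sub]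

lemma act_add (α : LeftIntegral k H) (a b : H) : α.act (a + b) = α.act a + α.act b := by
  have := act_sub α (a + b) b
  rw [add_sub_cancel_right] at this
  rw [this, sub_add_cancel]

lemma zero_act (a : H) : (0 : LeftIntegral k H).act a = 0 := by
  rw [act, Abelian.Ext.zero_comp]

lemma act_algebraMap_injective {α : LeftIntegral k H} (hα : α ≠ 0) :
    Function.Injective fun c : k => α.act (algebraMap k H c) := by
  intro c d h
  by_contra hne
  have h1 : α.act (algebraMap k H (c - d)) = 0 := by rw [map_sub, act_sub, sub_eq_zero]; exact h
  have h2 := congrArg (fun β : LeftIntegral k H => β.act (algebraMap k H (c - d)⁻¹)) h1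
  simp only [zero_act, act_act, ← map_mul] at h2
  rw [mul_inv_cancel₀ (sub_ne_zero.2 hne), map_one, act_one] at h2
  exact hα h2

/-- A generator of the left integral on which `H` acts by scalars defines the integral
character. -/
lemma exists_isIntegralCharacter {α : LeftIntegral k H} (hα : α ≠ 0)
    (hgen : ∀ β : LeftIntegral k H, ∃ h, β = α.act h)
    (hscal : ∀ h : H, ∃ c : k, α.act h = α.act (algebraMap k H c)) :
    ∃ χ : H →ₐ[k] k, IsIntegralCharacter χ := by
  have hinj := act_algebraMap_injective hα
  choose χ hχ using hscal
  have hχ' : ∀ h (c : k), α.act h = α.act (algebraMap k H c) → χ h = c := fun h c hc =>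
    hinj ((hχ h).symm.trans hc)
  have halg : ∀ c : k, χ (algebraMap k H c) = c := fun c => hχ' _ _ rfl
  have hmul : ∀ a b, χ (a * b) = χ a * χ b := by
    intro a b
    apply hχ'
    rw [← act_act, hχ a, act_act, Algebra.commutes, ← act_act, hχ b, act_act, ← map_mul, mul_comm]
  let χ' : H →ₐ[k] k := AlgHom.mk
    { toFun := χ
      map_one' := by simpa using halg 1
      map_mul' := hmul
      map_zero' := by simpa using halg 0
      map_add' := fun a b => hχ' _ _ (by rw [act_add, hχ a, hχ b, map_add, act_add]) } halg
  refine ⟨χ', ⟨α, hα, fun β => ?_⟩, fun β h => ?_⟩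
  · obtain ⟨h, rfl⟩ := hgen β
    exact ⟨_, hχ h⟩
  · obtain ⟨a, rfl⟩ := hgen β
    change _ = (α.act a).act (algebraMap k H (χ h))
    rw [hχ a, act_act, act_act, Algebra.commutes, ← act_act, hχ h, act_act, ← map_mul, ← map_mul,
      mul_comm]

end LeftIntegral

end IntegralExt

/-! ### The integral character -/

section IntegralCharacter

universe u v

variable {k : Type u} {H : Type v} [Field k] [Ring H] [HopfAlgebra k H]

/-- The average of the first `n` powers of `w`. -/
def avgPow (k : Type*) {H : Type*} [Field k] [Ring H] [Algebra k H] (n : ℕ) (w : H) : H :=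
  (n : k)⁻¹ • ∑ i ∈ Finset.range n, w ^ i

section Average

variable {n : ℕ} {w : H} (hw : w ^ n = 1)
include hw

lemma sum_pow_succ_eq : ∑ i ∈ Finset.range n, w ^ (i + 1) = ∑ i ∈ Finset.range n, w ^ i := by
  have h1 := Finset.sum_range_succ (fun i => w ^ i) n
  rw [Finset.sum_range_succ', pow_zero, hw] at h1
  exact add_right_cancel h1

lemma mul_avgPow : w * avgPow k n w = avgPow k n w := by
  rw [avgPow, mul_smul_comm, Finset.mul_sum]
  simp only [← pow_succ']
  rw [sum_pow_succ_eq hw]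

lemma avgPow_mul : avgPow k n w * w = avgPow k n w := by
  rw [avgPow, smul_mul_assoc, Finset.sum_mul]
  simp only [← pow_succ]
  rw [sum_pow_succ_eq hw]

end Average

lemma counit_avgPow {n : ℕ} (hn : (n : k) ≠ 0) {w : H} (hw : Coalgebra.counit (R := k) w = 1) :
    Coalgebra.counit (R := k) (avgPow k n w) = 1 := by
  rw [avgPow, map_smul, map_sum]
  simp only [Bialgebra.counit_pow, hw, one_pow, Finset.sum_const, Finset.card_range, nsmul_eq_mul,
    mul_one, smul_eq_mul]
  exact inv_mul_cancel₀ hn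

lemma mul_avgPow_comm {n : ℕ} {a v w : H} (h : a * v = w * a) :
    a * avgPow k n v = avgPow k n w * a := by
  rw [avgPow, avgPow, mul_smul_comm, smul_mul_assoc, Finset.mul_sum, Finset.sum_mul]
  congr 1
  exact Finset.sum_congr rfl fun i _ => (SemiconjBy.pow_right (h : SemiconjBy a v w) i)

lemma mem_augKer {h : H} : h ∈ augKer k H ↔ Coalgebra.counit (R := k) h = 0 := Iff.rfl

namespace IsBiwinding

variable {σ : H →ₐ[k] H} {n : ℕ} {ζ : k} [NeZero n] (hb : IsBiwinding σ n ζ)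
  {D : Type*} [CommRing D] [IsDomain D] [Algebra k D] {ι : D →ₐ[k] H}
  (hι : Function.Injective ι) (hr : ∀ h, h ∈ comp σ ζ 0 ↔ h ∈ ι.range)
include hb hι hr

lemma eq_zero_of_mul_map_eq_zero {t : D} (ht : t ≠ 0) {h : H} (h0 : h * ι t = 0) : h = 0 := by
  refine eq_zero_of_forall_proj (σ := σ) hb.prim fun i _ => ?_
  have h1 := proj_mul hb.prim hb.pow_eq (hb.map_mem_comp hι hr t) i h
  rw [h0, map_zero, sub_zero] at h1
  refine (hb.eq_zero_or_eq_zero_of_mul_eq_zero hι hr (proj_mem hb.prim hb.pow_eq i h)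
    (hb.map_mem_comp hι hr t) h1.symm).resolve_right fun h2 => ht (hι ?_)
  rw [h2, map_zero]

lemma eq_zero_of_map_mul_eq_zero {t : D} (ht : t ≠ 0) {h : H} (h0 : ι t * h = 0) : h = 0 := by
  refine eq_zero_of_forall_proj (σ := σ) hb.prim fun i _ => ?_
  have h1 := proj_mul_left hb.prim hb.pow_eq (hb.map_mem_comp hι hr t) i h
  rw [h0, map_zero, sub_zero] at h1
  refine (hb.eq_zero_or_eq_zero_of_mul_eq_zero hι hr (hb.map_mem_comp hι hr t)
    (proj_mem hb.prim hb.pow_eq i h) h1.symm).resolve_left fun h2 => ht (hι ?_)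
  rw [h2, map_zero]

variable {u : Hˣ} (hu : (u : H) ∈ comp σ ζ 1)
include hu

/-- The average `e` absorbs `u` on the left and `u` normalises `D`, so `H e = D e`. -/
lemma exists_mul_avgPow (hun : u ^ n = 1) (h : H) :
    ∃ a, h * avgPow k n (u : H) = ι a * avgPow k n (u : H) := by
  have hue : (u : H) * avgPow k n (u : H) = avgPow k n (u : H) :=
    mul_avgPow (by rw [← Units.val_pow_eq_pow_val, hun, Units.val_one])
  refine hb.mem_of_unit_mul_mem hι hr hu (N := (LinearMap.range
    ((LinearMap.mulRight k (avgPow k n (u : H))) ∘ₗ ι.toLinearMap)).comap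
    (LinearMap.mulRight k (avgPow k n (u : H)))) (fun d => ⟨d, rfl⟩) ?_ h |>.imp
    fun a ha => ha.symm
  rintro h ⟨a, ha⟩
  change ι a * avgPow k n (u : H) = h * avgPow k n (u : H) at ha
  obtain ⟨c, hc⟩ := hb.exists_conj' hι hr hu a
  refine ⟨c, ?_⟩
  change ι c * avgPow k n (u : H) = (u * h) * avgPow k n (u : H)
  rw [mul_assoc, ← ha, ← hc, mul_assoc, mul_assoc]
  congr 2
  apply u.isUnit.mul_left_cancel
  rw [Units.mul_inv_cancel_left, hue]

lemma exists_avgPow_mul (hun : u ^ n = 1) (h : H) :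
    ∃ a, avgPow k n (u : H) * h = avgPow k n (u : H) * ι a := by
  have hue : avgPow k n (u : H) * (u : H) = avgPow k n (u : H) :=
    avgPow_mul (by rw [← Units.val_pow_eq_pow_val, hun, Units.val_one])
  refine hb.mem_of_unit_mul_mem hι hr hu (N := (LinearMap.range
    ((LinearMap.mulLeft k (avgPow k n (u : H))) ∘ₗ ι.toLinearMap)).comap
    (LinearMap.mulLeft k (avgPow k n (u : H)))) (fun d => ⟨d, rfl⟩) ?_ h |>.imp
    fun a ha => ha.symm
  rintro h ⟨a, ha⟩
  refine ⟨a, ha.trans ?_⟩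
  change avgPow k n (u : H) * h = avgPow k n (u : H) * (u * h)
  rw [← mul_assoc, hue]

/-- The left integral is one-dimensional, and the component of degree `0` acts on it by the
counit. -/
lemma exists_isIntegralCharacter (hε : Coalgebra.counit (R := k) (u : H) = 1) (hun : u ^ n = 1)
    {t b : D} (ht : t ≠ 0) (hεt : Coalgebra.counit (R := k) (ι t) = 0)
    (hgen : ∀ d, Coalgebra.counit (R := k) (ι d) = 0 → ∃ c, d = t * c)
    (hrel : ι t * u = u * ι b * ι t) :
    ∃ χ : H →ₐ[k] k, IsIntegralCharacter χ ∧ ∀ d, χ (ι d) = Coalgebra.counit (R := k) (ι d) := by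
  have hn : (n : k) ≠ 0 := natCast_ne_zero_of_isPrimitiveRoot hb.prim
  -- With `w = u b` one has `t u ^ n = w ^ n t`, and `t` can be cancelled. For the averages `e` of
  -- `u` and `e'` of `w` this yields `t e = e' t`.
  have hwn : ((u : H) * ι b) ^ n = 1 := by
    have h1 : SemiconjBy (ι t) (u : H) (u * ι b) := hrel
    have h2 := h1.pow_right n
    rw [← Units.val_pow_eq_pow_val, hun, Units.val_one] at h2
    rw [← sub_eq_zero]
    refine hb.eq_zero_of_mul_map_eq_zero hι hr ht ?_
    rw [sub_mul, ← h2.eq, mul_one, one_mul, sub_self]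
  let w : Hˣ := Units.ofPowEqOne _ n hwn (NeZero.ne n)
  have hw : (w : H) = u * ι b := rfl
  have hwc : (w : H) ∈ comp σ ζ 1 := by
    have := mul_mem_comp (zeta_ne_zero hb.prim) hu (hb.map_mem_comp hι hr b)
    rwa [add_zero] at this
  have hwn' : w ^ n = 1 := Units.ext (by rw [Units.val_pow_eq_pow_val]; exact hwn)
  let e : H := avgPow k n (u : H)
  let e' : H := avgPow k n (w : H)
  have hte : ι t * e = e' * ι t := mul_avgPow_comm (hrel.trans (by rw [hw]))
  have hεe : Coalgebra.counit (R := k) e = 1 := counit_avgPow hn hε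
  have hcan : ∀ a b : H, a * ι t = b * ι t → a = b := fun a b h => by
    rw [← sub_eq_zero]
    exact hb.eq_zero_of_mul_map_eq_zero hι hr ht (by rw [sub_mul, h, sub_self])
  -- For `a` of counit `0`, write `a e = d e` with `d` in `D`. Then `ε(d) = 0`, so `d = c t` and `a
  -- e = c t e = c e' t`. Cancelling `t` defines the map `φ`, with `φ(a) t = a e`.
  have hex : ∀ a : augKer k H, ∃ r c, r = ι c * e' ∧ r * ι t = (a : H) * e := by
    intro a
    obtain ⟨d, hd⟩ := hb.exists_mul_avgPow hι hr hu hun (a : H)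
    change (a : H) * e = ι d * e at hd
    have h1 := congrArg (Coalgebra.counit (R := k)) hd
    rw [Bialgebra.counit_mul, Bialgebra.counit_mul, hεe, mul_one, mul_one, mem_augKer.1 a.2] at h1
    obtain ⟨c, rfl⟩ := hgen d h1.symm
    exact ⟨_, c, rfl, by rw [hd, mul_assoc, ← hte, mul_comm t, map_mul, mul_assoc]⟩
  choose f c hfc hf using hex
  let φ : augKer k H →ₗ[H] H :=
    { toFun := f
      map_add' := fun a b => hcan _ _ (by rw [add_mul, hf, hf, hf, Submodule.coe_add, add_mul])
      map_smul' := fun s a => hcan _ _ (by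
        rw [RingHom.id_apply, smul_eq_mul, mul_assoc, hf, hf, Submodule.coe_smul, smul_eq_mul,
          mul_assoc]) }
  have hφ : ∀ a : augKer k H, φ a * ι t = (a : H) * e := hf
  have hφc : ∀ a : augKer k H, φ a = ι (c a) * e' := hfc
  let T : augKer k H := ⟨ι t, hεt⟩
  -- If `φ` were right multiplication by `r`, then `t r = φ(t) = e'` and so `t r t = e' t = t e`.
  -- Cancelling `t` on the left gives `r t = e`, although `ε(t) = 0` and `ε(e) = 1`.
  have hne : LeftIntegral.ofHom φ ≠ 0 := by
    rw [Ne, LeftIntegral.ofHom_eq_zero_iff]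
    rintro ⟨r, hr'⟩
    have h1 : φ T = e' := hcan _ _ (by rw [hφ, ← hte])
    have h2 : ι t * (e - r * ι t) = 0 := by
      rw [mul_sub, hte, ← h1, hr' T, mul_assoc, sub_self]
    have h3 := congrArg (Coalgebra.counit (R := k))
      (sub_eq_zero.1 (hb.eq_zero_of_map_mul_eq_zero hι hr ht h2))
    rw [hεe, Bialgebra.counit_mul, hεt, mul_zero] at h3
    exact one_ne_zero h3
  have hact : ∀ d, (LeftIntegral.ofHom φ).act (ι d) =
      (LeftIntegral.ofHom φ).act (algebraMap k H (Coalgebra.counit (R := k) (ι d))) := by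
    intro d
    -- With `d - ε(d) = t s`, the map `a ↦ φ(a) t s = a e s` is a right multiplication, so its class
    -- is zero.
    obtain ⟨s, hs⟩ := hgen (d - algebraMap k D (Coalgebra.counit (R := k) (ι d))) (by
      rw [map_sub, map_sub, AlgHom.commutes, Bialgebra.counit_algebraMap, sub_self])
    rw [← sub_eq_zero, ← LeftIntegral.act_sub, ← AlgHom.commutes ι, ← map_sub, hs,
      LeftIntegral.ofHom_act, LeftIntegral.ofHom_eq_zero_iff]
    refine ⟨e * ι s, fun a => ?_⟩
    change φ a * ι (t * s) = _
    rw [map_mul, ← mul_assoc, hφ, mul_assoc]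
  obtain ⟨χ, hχ⟩ := LeftIntegral.exists_isIntegralCharacter hne (fun β => by
      obtain ⟨ψ, rfl⟩ := LeftIntegral.ofHom_surjective β
      refine ⟨ψ T, ?_⟩
      rw [← sub_eq_zero, LeftIntegral.ofHom_act, ← LeftIntegral.ofHom_sub,
        LeftIntegral.ofHom_eq_zero_iff]
      -- The identity `a = φ(a) t + a (1 - e)` shows that `ψ` differs from `φ` followed by right
      -- multiplication by `ψ(t)` only by right multiplication by `ψ(1 - e)`.
      let E : augKer k H := ⟨1 - e, by
        rw [mem_augKer, map_sub, hεe, Bialgebra.counit_one, sub_self]⟩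
      refine ⟨ψ E, fun a => ?_⟩
      have h1 : a = φ a • T + (a : H) • E := by
        apply Subtype.ext
        change (a : H) = φ a * ι t + (a : H) * (1 - e)
        rw [hφ, mul_sub, mul_one, add_sub_cancel]
      have h2 := congrArg ψ h1
      rw [map_add, map_smul, map_smul] at h2
      change ψ a - φ a * ψ T = (a : H) * ψ E
      rw [h2, smul_eq_mul, smul_eq_mul, add_sub_cancel_left]) (fun h => by
      obtain ⟨d, hd⟩ := hb.exists_avgPow_mul hι hr hwc hwn' h
      change e' * h = e' * ι d at hd
      -- The values of `φ` end in `e'`, and `e' h = e' d` with `d` in `D`. So `h` acts as `d`, which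
      -- acts by its counit.
      refine ⟨Coalgebra.counit (R := k) (ι d), ?_⟩
      rw [← hact, LeftIntegral.ofHom_act, LeftIntegral.ofHom_act]
      congr 1
      ext a
      change φ a * h = φ a * ι d
      rw [hφc, mul_assoc, mul_assoc, hd])
  refine ⟨χ, hχ, fun d => LeftIntegral.act_algebraMap_injective hne ?_⟩
  exact (hχ.act_eq _ _).symm.trans (hact d)

/-- On `D` all convolution powers of `χ` equal `ε`, since `Δ` preserves `D`. On the group-like `u`
they are the powers of `χ(u)`, an `n`th root of unity. As `D` and `u` generate `H`, the `n`-th power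
of `χ` is `ε`. -/
lemma charOrder_pos_of_map_eq_counit (hΔu : IsGroupLikeElem k (u : H)) (hun : u ^ n = 1)
    {χ : H →ₐ[k] k} (hχ : ∀ d, χ (ι d) = Coalgebra.counit (R := k) (ι d)) : 0 < charOrder χ := by
  have hunit : ∀ m : ℕ, (toConv χ ^ m).ofConv (u : H) = χ u ^ m := by
    intro m
    induction m with
    | zero =>
      rw [pow_zero, pow_zero, ← hΔu.counit_eq_one (R := k)]
      rfl
    | succ m ih =>
      rw [pow_succ, pow_succ, ← ih]
      have h1 := convMul_apply' (toConv χ ^ m).ofConv χ (u : H)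
      rw [hΔu.comul_eq_tmul_self] at h1
      exact h1
  have hzero : ∀ (m : ℕ) (d : D), (toConv χ ^ m).ofConv (ι d) = Coalgebra.counit (R := k) (ι d) := by
    intro m
    induction m with
    | zero => exact fun d => rfl
    | succ m ih =>
      intro d
      rw [pow_succ]
      have key : ∀ (ρ π : H →ₐ[k] k) (z : D ⊗[k] D),
          (∀ d, ρ (ι d) = Coalgebra.counit (R := k) (ι d)) →
          (∀ d, π (ι d) = Coalgebra.counit (R := k) (ι d)) →
          LinearMap.mul' k k (TensorProduct.map ρ.toLinearMap π.toLinearMap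
            (Algebra.TensorProduct.map ι ι z)) =
          LinearMap.mul' k k (TensorProduct.map (Bialgebra.counitAlgHom k H).toLinearMap
            (Bialgebra.counitAlgHom k H).toLinearMap (Algebra.TensorProduct.map ι ι z)) := by
        intro ρ π z hρ hπ
        induction z with
        | zero => simp
        | tmul a b => simp [hρ, hπ]
        | add a b ha hb => simp only [map_add, ha, hb]
      have h1 := convMul_apply' (toConv χ ^ m).ofConv χ (ι d)
      have h2 := convMul_apply' (Bialgebra.counitAlgHom k H) (Bialgebra.counitAlgHom k H) (ι d)
      rw [← hb.map_comulHom hι hr d] at h1 h2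
      rw [key _ _ _ ih hχ, ← h2] at h1
      refine h1.trans ?_
      have h3 : toConv (Bialgebra.counitAlgHom k H) = 1 := rfl
      rw [h3, one_mul]
      rfl
  refine orderOf_pos_iff.2 (isOfFinOrder_iff_pow_eq_one.2 ⟨n, NeZero.pos n, ?_⟩)
  apply WithConv.ofConv_injective
  ext h
  have huN : (toConv χ ^ n).ofConv (u : H) = 1 := by
    rw [hunit, ← map_pow, ← Units.val_pow_eq_pow_val, hun, Units.val_one, map_one]
  refine hb.mem_of_unit_mul_mem hι hr hu (N := LinearMap.eqLocus
    (toConv χ ^ n).ofConv.toLinearMap (Bialgebra.counitAlgHom k H).toLinearMap) (hzero n) ?_ h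
  intro h hh
  change (toConv χ ^ n).ofConv h = Coalgebra.counit (R := k) h at hh
  change (toConv χ ^ n).ofConv (u * h) = Coalgebra.counit (R := k) (u * h)
  rw [map_mul, huN, hh, Bialgebra.counit_mul, hΔu.counit_eq_one]

lemma hasIntegralMinor_one [Coalgebra.IsCocomm k H] (hΔu : IsGroupLikeElem k (u : H))
    (hun : u ^ n = 1) {t b : D} (ht : t ≠ 0) (hεt : Coalgebra.counit (R := k) (ι t) = 0)
    (hgen : ∀ d, Coalgebra.counit (R := k) (ι d) = 0 → ∃ c, d = t * c)
    (hrel : ι t * u = u * ι b * ι t) : HasIntegralMinor k H 1 := by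
  obtain ⟨χ, hχ, hχι⟩ :=
    hb.exists_isIntegralCharacter hι hr hu hΔu.counit_eq_one hun ht hεt hgen hrel
  exact ⟨χ, hχ, hb.charOrder_pos_of_map_eq_counit hι hr hu hΔu hun hχι,
    windingIndex_eq_one_of_isCocomm χ⟩

end IsBiwinding

end IntegralCharacter

/-! ### The two cases -/

section Conclusion

universe u v

variable {k : Type u} {H : Type v} [Field k] [Ring H] [HopfAlgebra k H]

lemma sub_one_dvd_zpow_sub_one {D : Type*} [CommRing D] (y : Dˣ) (m : ℤ) :
    (y : D) - 1 ∣ ((y ^ m : Dˣ) : D) - 1 := by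
  have h1 : ∀ m : ℕ, (y : D) - 1 ∣ ((y ^ m : Dˣ) : D) - 1 := by
    intro m
    have := sub_dvd_pow_sub_pow (y : D) 1 m
    rwa [one_pow, ← Units.val_pow_eq_pow_val] at this
  cases m with
  | ofNat m => simpa using h1 m
  | negSucc m =>
    rw [zpow_negSucc]
    have h2 : (((y ^ (m + 1))⁻¹ : Dˣ) : D) - 1 =
        (((y ^ (m + 1) : Dˣ) : D) - 1) * -(((y ^ (m + 1))⁻¹ : Dˣ) : D) := by
      rw [mul_neg, sub_mul, Units.mul_inv]
      ring
    rw [h2]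
    exact (h1 (m + 1)).mul_right _

namespace IsBiwinding

variable {σ : H →ₐ[k] H} {n : ℕ} {ζ : k} [NeZero n] (hb : IsBiwinding σ n ζ)
  {D : Type*} [CommRing D] [IsDomain D] [Algebra k D] {ι : D →ₐ[k] H}
  (hι : Function.Injective ι) (hr : ∀ h, h ∈ comp σ ζ 0 ↔ h ∈ ι.range)
  {u : Hˣ} (hu : (u : H) ∈ comp σ ζ 1)
include hb hι hr hu

lemma hasIntegralMinor_of_polynomial [Coalgebra.IsCocomm k H] {x : D}
    (hx : Function.Bijective (aeval x : k[X] →ₐ[k] D)) {ξ : k}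
    (hΔu : IsGroupLikeElem k (u : H)) (hun : u ^ n = 1)
    (hrel : ι x * u = ξ • (u * ι x)) (hεx : Coalgebra.counit (R := k) (ι x) = 0) :
    HasIntegralMinor k H 1 := by
  refine hb.hasIntegralMinor_one hι hr hu hΔu hun (t := x) (b := algebraMap k D ξ) ?_ hεx ?_ ?_
  · rintro rfl
    exact X_ne_zero (hx.1 (by rw [aeval_X, map_zero]))
  · intro d hd
    obtain ⟨p, rfl⟩ := hx.2 d
    have h1 : Coalgebra.counit (R := k) (ι (aeval x p)) = p.eval 0 := by
      change Bialgebra.counitAlgHom k H (ι (aeval x p)) = _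
      rw [← aeval_algHom_apply, ← aeval_algHom_apply, Bialgebra.counitAlgHom_apply, hεx,
        coe_aeval_eq_eval]
    rw [h1, ← coeff_zero_eq_eval_zero, ← X_dvd_iff] at hd
    obtain ⟨q, rfl⟩ := hd
    exact ⟨aeval x q, by rw [map_mul, aeval_X]⟩
  · rw [hrel, AlgHom.commutes, ← Algebra.commutes, Algebra.smul_def, mul_assoc]

lemma hasIntegralMinor_of_laurent [Coalgebra.IsCocomm k H] {y : Dˣ}
    (hΔy : IsGroupLikeElem k (ι y)) (hy : Function.Bijective (laurentHom (k := k) y))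
    (hΔu : IsGroupLikeElem k (u : H)) (hun : u ^ n = 1) (hrel : ι y * u = u * ι ((y⁻¹ : Dˣ) : D)) :
    HasIntegralMinor k H 1 := by
  -- The value of `b` comes from `(y - 1) u = u (y⁻¹ - 1) = u (-y⁻¹) (y - 1)`.
  refine hb.hasIntegralMinor_one hι hr hu hΔu hun (t := (y : D) - 1)
    (b := -((y⁻¹ : Dˣ) : D)) ?_ ?_ ?_ ?_
  · intro h
    have h1 : (LaurentPolynomial.T 1 : LaurentPolynomial k) = LaurentPolynomial.T 0 := hy.1 (by
      rw [laurentHom_T, laurentHom_T, zpow_one, zpow_zero, Units.val_one, sub_eq_zero.1 h])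
    have h2 := congrArg LaurentPolynomial.degree h1
    rw [LaurentPolynomial.degree_T, LaurentPolynomial.degree_T] at h2
    exact absurd h2 (by decide)
  · rw [map_sub, map_sub, hΔy.counit_eq_one, map_one, Bialgebra.counit_one, sub_self]
  · have key : ∀ d : D, (y : D) - 1 ∣ d - algebraMap k D (Coalgebra.counit (R := k) (ι d)) := by
      intro d
      obtain ⟨p, rfl⟩ := hy.2 d
      induction p using LaurentPolynomial.induction_on' with
      | add p q hp hq =>
        rw [map_add, map_add, map_add, map_add, add_sub_add_comm]
        exact dvd_add hp hq
      | C_mul_T m c =>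
        have h2 : laurentHom y (LaurentPolynomial.C c) = algebraMap k D c :=
          (laurentHom (k := k) y).commutes c
        have h3 : Coalgebra.counit (R := k) (ι ((y ^ m : Dˣ) : D)) = 1 := by
          have h4 := isGroupLikeElem_zpow (k := k) (Y := Units.map (ι : D →* H) y) hΔy m
          rw [← map_zpow] at h4
          exact h4.counit_eq_one
        rw [map_mul, h2, laurentHom_T, map_mul, Bialgebra.counit_mul, h3, mul_one, AlgHom.commutes,
          Bialgebra.counit_algebraMap, ← mul_sub_one]
        exact (sub_one_dvd_zpow_sub_one y m).mul_left _
    intro d hd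
    have := key d
    rwa [hd, map_zero, sub_zero] at this
  · rw [map_sub, map_one, sub_mul, hrel, one_mul, map_neg, mul_neg, neg_mul, mul_sub, mul_assoc,
      ← map_mul, Units.inv_mul, map_one, mul_one, mul_one, neg_sub]

end IsBiwinding

lemma exists_isPrimitiveRoot_of_coprime [IsAlgClosed k] {n : ℕ} (hn : 0 < n)
    (h : ∀ p : ℕ, 0 < p → CharP k p → Nat.Coprime n p) : ∃ ζ : k, IsPrimitiveRoot ζ n := by
  have hne : (n : k) ≠ 0 := by
    obtain ⟨p, hp⟩ := CharP.exists k
    intro h0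
    rw [CharP.cast_eq_zero_iff k p] at h0
    have hp0 : 0 < p := Nat.pos_of_dvd_of_pos h0 hn
    have h1 := h p hp0 hp
    have h2 : p = 1 := h1.symm.eq_one_of_dvd h0
    subst h2
    exact CharP.false_of_nontrivial_of_char_one (R := k)
  have : NeZero (n : k) := ⟨hne⟩
  exact HasEnoughRootsOfUnity.exists_primitiveRoot k n

end Conclusion

end HopfGK

end

/-! ### The theorem -/

theorem theorem4p1 {k : Type*} {H : Type*} [Field k] [IsAlgClosed k] [Ring H] [HopfAlgebra k H]
    (π : H →ₐ[k] k) (n : ℕ) (hyp : HopfGK.Hypotheses k H π n) (hn : 1 < n)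
    (hmin : HopfGK.windingIndex π = 1) :
    ((HopfGK.IsPrimitiveCase π ∧
        ∃ ξ : k, IsPrimitiveRoot ξ n ∧ Nonempty (H ≃ₐc[k] HopfGK.Taft k n 0 ξ)) ∨
      (HopfGK.IsGroupLikeCase π ∧ Nonempty (H ≃ₐc[k] MonoidAlgebra k (DihedralGroup 0)))) ∧
    Coalgebra.IsCocomm k H ∧
    HopfGK.HasIntegralMinor k H 1 := by
  have : NeZero n := ⟨hyp.order_pos.ne'⟩
  have := hyp.affine
  obtain ⟨ζ, hζ⟩ := HopfGK.exists_isPrimitiveRoot_of_coprime hyp.order_pos hyp.coprime_char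
  have heq := HopfGK.leftWindingHom_eq_rightWindingHom hmin
  have hb := HopfGK.isBiwinding_leftWindingHom hζ hyp.order_eq heq
  obtain ⟨D, _, _, ⟨e⟩⟩ := hyp.dedekind
  -- The Dedekind domain `D` is given only as a ring isomorphic to the invariants, so its
  -- `k`-algebra structure is transported from them.
  let _ : Algebra k D := ((e.symm : _ →+* D).comp
    (algebraMap k (HopfGK.invariants (HopfGK.leftGroup π)))).toAlgebra
  let ι : D →ₐ[k] H := (HopfGK.invariants (HopfGK.leftGroup π)).val.comp
    (AlgHom.mk (e : D →+* HopfGK.invariants (HopfGK.leftGroup π))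
      fun c => e.apply_symm_apply (algebraMap k _ c))
  have hι : Function.Injective ι := Subtype.val_injective.comp e.injective
  have hr : ∀ h, h ∈ HopfGK.comp (HopfGK.leftWindingHom π) ζ 0 ↔ h ∈ ι.range := by
    intro h
    rw [HopfGK.mem_comp_zero]
    refine (HopfGK.mem_invariants_closure (f := HopfGK.leftWinding π)).symm.trans ⟨fun hh => ?_, ?_⟩
    · exact ⟨e.symm ⟨h, hh⟩, congrArg Subtype.val (e.apply_symm_apply ⟨h, hh⟩)⟩
    · rintro ⟨d, rfl⟩
      exact (e d).2
  have hrange : ι.range = HopfGK.classicalComponent π := by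
    ext h
    rw [HopfGK.mem_classicalComponent heq, ← hr, HopfGK.mem_comp_zero]
  have := hb.finiteType hι hr
  rcases hb.exists_polynomial_or_laurent hι hr hyp.gkDim_eq with ⟨x, hΔx, hx⟩ | ⟨y, hΔy, hy⟩
  · obtain ⟨u, ξ, hu, hΔu, hε, hun, hξ, hrel, hεx⟩ :=
      hb.exists_of_polynomial hι hr hyp.piDegree_eq hΔx hx
    have hiso := hb.nonempty_equiv_taft hι hr hu hΔx hx ⟨hε, hΔu⟩ hun hrel hεx
    have hco : Coalgebra.IsCocomm k H := HopfGK.isCocomm_of_bialgEquiv hiso.some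
    refine ⟨.inl ⟨⟨ι.comp (Polynomial.aeval x), hι.comp hx.1, ?_, ?_⟩, ξ, hξ, hiso⟩, hco,
      hb.hasIntegralMinor_of_polynomial hι hr hu hx ⟨hε, hΔu⟩ hun hrel hεx⟩
    · rw [AlgHom.range_comp, (AlgHom.range_eq_top _).2 hx.2, Algebra.map_top, hrange]
    · simpa using hΔx
  · obtain ⟨hn2, u, hu, hΔu, hε, hun, hrel⟩ :=
      hb.exists_of_laurent hι hr hyp.piDegree_eq hn hΔy hy
    have hiso := hb.nonempty_equiv_dihedral hι hr hu hn2 hΔy hy ⟨hε, hΔu⟩ hun hrel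
    have hco : Coalgebra.IsCocomm k H := HopfGK.isCocomm_of_bialgEquiv hiso.some
    refine ⟨.inr ⟨⟨ι.comp (HopfGK.laurentHom y), hι.comp hy.1, ?_, ?_⟩, hiso⟩, hco,
      hb.hasIntegralMinor_of_laurent hι hr hu hΔy hy ⟨hε, hΔu⟩ hun hrel⟩
    · rw [AlgHom.range_comp, (AlgHom.range_eq_top _).2 hy.2, Algebra.map_top, hrange]
    · rw [AlgHom.comp_apply, HopfGK.laurentHom_T, zpow_one]
      exact hΔy.comul_eq_tmul_self
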